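/- Let $\Lambda$ be the algebra of symmetric functions, with power sums $p_n$ and skew Schur functions $s_{\lambda/\mu}$. A specialization is an algebra homomorphism of $\Lambda$ to $\mathbb C$; write $f(a)$ for the value of a specialization $a$ at $f\in\Lambda$. Let $N\ge 1$ and let $a[1],b[1],\dots,a[N],b[N]$ be specializations. The periodic Schur process with parameter $t$ gives to partitions $\lambda^{(1)},\mu^{(1)},\dots,\lambda^{(N)},\mu^{(N)}$ the weight $$w(\lambda,\mu)=t^{|\lambda^{(0)}|}\prod_{k=1}^N s_{\lambda^{(k-1)}/\mu^{(k)}}(a[k])\,s_{\lambda^{(k)}/\mu^{(k)}}(b[k]),\qquad \lambda^{(0)}:=\lambda^{(N)}.$$ Put $a_n[k]=\frac1n p_n(a[k])$, $b_n[k]=\frac1n p_n(b[k])$, $A_n=\sum_{k=1}^N a_n[k]$, $B_n=\sum_{k=1}^N b_n[k]$. For $s\neq0$ with $s^N=t$ put $\tilde a_n[k]=s^{-kn}a_n[k]$, $\tilde b_n[k]=s^{kn}b_n[k]$. Proposition. The partition function $Z(N,t,a,b)=\sum_{\lambda,\mu}w(\lambda,\mu)$ is $$Z(N,t,a,b)=\prod_{n\ge1}\frac1{1-t^n}\,\exp\Bigl(\sum_{n=1}^\infty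 n\Bigl(\sum_{1\le l<k\le N}a_n[k]b_n[l]+\frac{t^nA_nB_n}{1-t^n}\Bigr)\Bigr)$$ $$=\prod_{n\ge1}\frac1{1-s^{nN}}\,\exp\Bigl(\sum_{n=1}^\infty\frac n{1-s^{nN}}\sum_{k,l=1}^N\bigl(\mathbf 1_{k>l}\,s^{(k-l)n}+\mathbf 1_{k\le l}\,s^{(N+k-l)n}\bigr)\tilde a_n[k]\tilde b_n[l]\Bigr).$$ (i) Formally: the identities hold when $a[1],b[1],\dots,a[N],b[N]$ are the $2N$ canonical embeddings of $\Lambda$ (over any field of characteristic $0$) into $\Lambda^{\otimes 2N}$, as identities of formal series in $\Lambda^{\otimes 2N}[t]$ for the first formula and, with a formal variable $s$ and $t=s^N$, of formal series with coefficients that are Laurent series in $s$ for the second one. All the infinite sums and products converge formally. (ii) Numerically: let $t\in\mathbb C$, $|t|<1$, and let the series $\sum_{n\ge1}n\,a_n[k]b_n[l]$ converge absolutely for all $k,l$. Then the infinite products and the series in the exponents converge, and the first formula, and for $t\ne0$ and every $s$ with $s^N=t$ the second one, hold with $Z(N,t,a,b)$ understood as the sum, absolutely convergent, over the sizes $(|\lambda^{(k)}|,|\mu^{(k)}|)_{1\le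 k\le N}\in\mathbb Z_{\ge0}^{2N}$, of the finite sums of the weights $w(\lambda,\mu)$ of the sequences of the given sizes. If the weights $w(\lambda,\mu)$ are absolutely summable, or if they are all real and non-negative, then $Z(N,t,a,b)$ is also the sum of all the weights in any order. -/

import Mathlib

open scoped LaurentSeries MvPowerSeries.WithPiTopology

noncomputable section

namespace PeriodicSchur

/-- The algebra `Λ` of symmetric functions over `K`: the formal power series of bounded degree in
countably many variables `x₀, x₁, x₂, …` that are invariant under all permutations of the
variables. -/
def SymmFun (K : Type*) [Field K] : Subalgebra K (MvPowerSeries ℕ K) where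
  carrier := {f | (∀ e : Equiv.Perm ℕ, MvPowerSeries.rename e f = f) ∧
    ∃ B : ℕ, ∀ d : ℕ →₀ ℕ, MvPowerSeries.coeff d f ≠ 0 → d.degree ≤ B}
  mul_mem' := by
    rintro f g ⟨hf, B, hB⟩ ⟨hg, C, hC⟩
    refine ⟨fun e => by rw [map_mul, hf, hg], B + C, fun d hd => ?_⟩
    classical
    rw [MvPowerSeries.coeff_mul] at hd
    obtain ⟨p, hp, hne⟩ := Finset.exists_ne_zero_of_sum_ne_zero hd
    rw [← Finset.HasAntidiagonal.mem_antidiagonal.mp hp, map_add]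
    exact add_le_add (hB _ (left_ne_zero_of_mul hne)) (hC _ (right_ne_zero_of_mul hne))
  add_mem' := by
    rintro f g ⟨hf, B, hB⟩ ⟨hg, C, hC⟩
    refine ⟨fun e => by rw [map_add, hf, hg], max B C, fun d hd => ?_⟩
    rw [map_add] at hd
    by_cases h : MvPowerSeries.coeff d f = 0
    · rw [h, zero_add] at hd
      exact le_max_of_le_right (hC d hd)
    · exact le_max_of_le_left (hB d h)
  algebraMap_mem' := by
    intro r
    refine ⟨fun e => AlgHom.commutes _ r, 0, fun d hd => ?_⟩
    classical
    rw [MvPowerSeries.algebraMap_apply, MvPowerSeries.coeff_C] at hd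
    by_cases h : d = 0
    · simp [h]
    · simp [h] at hd

/-- A power series whose coefficient at `x^d` is `1` or `0` according to a condition on the
exponents that does not depend on the order of the variables and that fixes the degree is a
symmetric function. -/
theorem indicator_mem (K : Type*) [Field K] (P : (ℕ →₀ ℕ) → Prop) [DecidablePred P] (n : ℕ)
    (hP : ∀ (e : Equiv.Perm ℕ) (d : ℕ →₀ ℕ), P (d.embDomain e.toEmbedding) ↔ P d)
    (hn : ∀ d, P d → d.degree = n) :
    ((fun d => if P d then 1 else 0 : MvPowerSeries ℕ K)) ∈ SymmFun K := by
  refine ⟨fun e => ?_, n, fun d hd => ?_⟩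
  · ext d
    have hd : (d.embDomain e.symm.toEmbedding).embDomain e.toEmbedding = d := by
      rw [Finsupp.embDomain_eq_mapDomain, Finsupp.embDomain_eq_mapDomain,
        ← Finsupp.mapDomain_comp]
      convert Finsupp.mapDomain_id
      ext x
      simp
    have h := MvPowerSeries.coeff_embDomain_rename e.toEmbedding
      (fun d => if P d then 1 else 0 : MvPowerSeries ℕ K) (d.embDomain e.symm.toEmbedding)
    rw [hd] at h
    refine h.trans ?_
    change (if P (d.embDomain e.symm.toEmbedding) then (1 : K) else 0) = if P d then 1 else 0
    simp only [hP]
  · by_contra hlt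
    apply hd
    change (if P d then (1 : K) else 0) = 0
    exact if_neg fun h => hlt (hn d h).le

/-- The complete homogeneous symmetric function `hₙ`, the sum of all monomials of degree `n`. -/
def completeH (K : Type*) [Field K] (n : ℕ) : SymmFun K :=
  ⟨fun d => if d.degree = n then 1 else 0,
    indicator_mem K (fun d => d.degree = n) n
      (fun e d => by
        rw [Finsupp.embDomain_eq_mapDomain, Finsupp.degree_mapDomain]) (fun _ h => h)⟩

open Classical in
/-- The Newton power sum `pₙ = ∑ᵢ xᵢⁿ`, `n ≥ 1`. -/
def powerSum (K : Type*) [Field K] (n : ℕ) : SymmFun K :=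
  ⟨fun d => if ∃ i, d = Finsupp.single i n then 1 else 0,
    indicator_mem K (fun d => ∃ i, d = Finsupp.single i n) n
      (fun e d => by
        constructor
        · rintro ⟨i, hi⟩
          refine ⟨e.symm i, Finsupp.embDomain_injective e.toEmbedding ?_⟩
          simp [hi, Finsupp.embDomain_single]
        · rintro ⟨i, rfl⟩
          exact ⟨e i, by simp [Finsupp.embDomain_single]⟩)
      (fun d h => by obtain ⟨i, rfl⟩ := h; simp)⟩

/-- `hₙ` for an integer index, with `hₙ = 0` for `n < 0`. -/
def completeHInt (K : Type*) [Field K] (n : ℤ) : SymmFun K :=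
  if 0 ≤ n then completeH K n.toNat else 0

/-- The skew Schur function `s_{λ/μ} = det [h_{λᵢ - μⱼ - i + j}]`, where the order `r` of the
determinant is the larger of the two numbers of parts (any larger `r` gives the same value).
It vanishes unless `μ ⊆ λ`. Partitions are Young diagrams, `λᵢ` being the length of row `i`. -/
def skewSchur (K : Type*) [Field K] (lam mu : YoungDiagram) : SymmFun K :=
  Matrix.det (Matrix.of fun i j : Fin (max (lam.colLen 0) (mu.colLen 0)) =>
    completeHInt K ((lam.rowLen i : ℤ) - (mu.rowLen j : ℤ) - (i : ℤ) + (j : ℤ)))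

/-- Families `(λ^{(1)}, …, λ^{(N)}), (μ^{(1)}, …, μ^{(N)})` of partitions; the index `k : Fin N`
stands for the superscript `k + 1`. -/
abbrev PartSeq (N : ℕ) : Type := (Fin N → YoungDiagram) × (Fin N → YoungDiagram)

section Weights

variable {K F S : Type*} [Field K] [Field F] [CommRing S] [Algebra K S] [Algebra F S]
variable {N : ℕ} [NeZero N]

/-- The weight
`t^{|λ^{(0)}|} ∏_{k=1}^{N} s_{λ^{(k-1)}/μ^{(k)}}(a[k]) s_{λ^{(k)}/μ^{(k)}}(b[k])`, where
`λ^{(0)} = λ^{(N)}`: the subtraction `k - 1` in `Fin N` is cyclic. The values of the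
specializations `a[k]`, `b[k]` are in a commutative algebra `S`. -/
def weight (t : F) (a b : Fin N → (SymmFun K →ₐ[K] S)) (x : PartSeq N) : S :=
  t ^ (x.1 (0 - 1)).card •
    ∏ k : Fin N, (a k (skewSchur K (x.1 (k - 1)) (x.2 k)) * b k (skewSchur K (x.1 k) (x.2 k)))

/-- `pₙ(c) / n` for a specialization `c`. -/
def scaledPower (c : SymmFun K →ₐ[K] S) (n : ℕ) : S := (n : K)⁻¹ • c (powerSum K n)

/-- `n (∑_{1 ≤ l < k ≤ N} aₙ[k] bₙ[l] + tⁿ Aₙ Bₙ / (1 - tⁿ))`. -/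
def exponentTerm (t : F) (a b : Fin N → (SymmFun K →ₐ[K] S)) (n : ℕ) : S :=
  (n : F) • ((∑ k : Fin N, ∑ l : Fin N with l < k, scaledPower (a k) n * scaledPower (b l) n) +
    (t ^ n / (1 - t ^ n)) •
      ((∑ k : Fin N, scaledPower (a k) n) * (∑ l : Fin N, scaledPower (b l) n)))

/-- `ãₙ[k] = s^{-kn} aₙ[k]`. -/
def twistA (s : F) (a : Fin N → (SymmFun K →ₐ[K] S)) (k : Fin N) (n : ℕ) : S :=
  (s⁻¹) ^ (((k : ℕ) + 1) * n) • scaledPower (a k) n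

/-- `b̃ₙ[k] = s^{kn} bₙ[k]`. -/
def twistB (s : F) (b : Fin N → (SymmFun K →ₐ[K] S)) (k : Fin N) (n : ℕ) : S :=
  s ^ (((k : ℕ) + 1) * n) • scaledPower (b k) n

/-- `n / (1 - s^{nN}) ∑_{k,l=1}^{N} (1_{k>l} s^{(k-l)n} + 1_{k≤l} s^{(N+k-l)n}) ãₙ[k] b̃ₙ[l]`. -/
def symExponentTerm (s : F) (a b : Fin N → (SymmFun K →ₐ[K] S)) (n : ℕ) : S :=
  ((n : F) / (1 - s ^ (n * N))) • ∑ k : Fin N, ∑ l : Fin N,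
    (if l < k then s ^ (((k : ℕ) - (l : ℕ)) * n) else s ^ ((N + (k : ℕ) - (l : ℕ)) * n)) •
      (twistA s a k n * twistB s b l n)

end Weights

section Formal

/-- The ring of formal series: power series in `2N` alphabets of countably many variables, over
the field of formal Laurent series in one more variable (which is `t`, or an `N`-th root `s` of
`t`). The completion of `Λ^{⊗2N}[t]` consists of those series which are symmetric in each alphabet
and whose coefficients have no negative powers of `t`. Infinite sums converge
coefficientwise. -/
abbrev FormalRing (K : Type*) [Field K] (N : ℕ) : Type _ :=
  MvPowerSeries ((Fin N ⊕ Fin N) × ℕ) K⸨X⸩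

/-- The formal specialization `f ↦ f(x_{j,0}, x_{j,1}, …)`, that is, the `j`-th of the `2N` copies
of `Λ`. -/
def formalSpec (K : Type*) [Field K] (N : ℕ) (j : Fin N ⊕ Fin N) :
    SymmFun K →ₐ[K] FormalRing K N :=
  ((MvPowerSeries.mapAlgHom (Algebra.ofId K K⸨X⸩)).comp
    (MvPowerSeries.rename (Function.Embedding.sectR j ℕ))).comp (SymmFun K).val

/-- The formal copies `a[k]` of `Λ`. -/
def formalA (K : Type*) [Field K] (N : ℕ) (k : Fin N) : SymmFun K →ₐ[K] FormalRing K N :=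
  formalSpec K N (Sum.inl k)

/-- The formal copies `b[k]` of `Λ`. -/
def formalB (K : Type*) [Field K] (N : ℕ) (k : Fin N) : SymmFun K →ₐ[K] FormalRing K N :=
  formalSpec K N (Sum.inr k)

/-- The formal variable of the Laurent series. -/
def formalVar (K : Type*) [Field K] : K⸨X⸩ := HahnSeries.single 1 1

/-- The exponential `∑ fʲ / j!` of a formal series `f` with zero constant term. -/
def formalExp {K : Type*} [Field K] [CharZero K] {N : ℕ} (f : FormalRing K N) : FormalRing K N :=
  (PowerSeries.exp K).subst f

end Formal

section Sizes

theorem finite_card_eq (n : ℕ) : {lam : YoungDiagram | lam.card = n}.Finite := by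
  refine Set.Finite.of_finite_image (f := YoungDiagram.cells)
    (Set.Finite.subset (Finset.finite_toSet (Finset.range n ×ˢ Finset.range n).powerset) ?_)
    (fun x _ y _ h => YoungDiagram.ext h)
  rintro _ ⟨lam, hlam, rfl⟩
  rw [Finset.mem_coe, Finset.mem_powerset]
  rintro ⟨i, j⟩ hij
  have hlam' : lam.cells.card = n := hlam
  have h1 : (lam.row i).card ≤ n := hlam' ▸ Finset.card_filter_le _ _
  have h2 : (lam.col j).card ≤ n := hlam' ▸ Finset.card_filter_le _ _
  rw [← YoungDiagram.rowLen_eq_card] at h1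
  rw [← YoungDiagram.colLen_eq_card] at h2
  rw [YoungDiagram.mem_cells] at hij
  rw [Finset.mem_product, Finset.mem_range, Finset.mem_range]
  exact ⟨(YoungDiagram.mem_iff_lt_colLen.mp hij).trans_le h2,
    (YoungDiagram.mem_iff_lt_rowLen.mp hij).trans_le h1⟩

/-- The finite set of partitions of `n`. -/
def partitionsOf (n : ℕ) : Finset YoungDiagram := (finite_card_eq n).toFinset

/-- The finite set of all families with `|λ^{(k)}| = d.1 k` and `|μ^{(k)}| = d.2 k`. -/
def sequencesOfSize {N : ℕ} (d : (Fin N → ℕ) × (Fin N → ℕ)) : Finset (PartSeq N) :=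
  (Fintype.piFinset fun k => partitionsOf (d.1 k)) ×ˢ
    (Fintype.piFinset fun k => partitionsOf (d.2 k))

end Sizes

end PeriodicSchur

end

/-! Let `U(a)` send `ν` to `∑ s_{λ/ν}(a) λ` and `D(b)` send `λ` to `∑ s_{λ/μ}(b) μ` on the free
module on partitions. A weight is the contribution of one closed path, so the partition function is
the trace of `t^{|λ|} U(a[1]) D(b[1]) ⋯ U(a[N]) D(b[N])` (`traceAt_prod`). Two facts suffice to
compute it. Branching makes `U` multiplicative and `D` antimultiplicative in the generating series
`H = ∑ hₙ Xⁿ` (`opU_mul`, `opD_mul`). The skew Cauchy identity says `D(b) U(a) = e · U(a) D(b)` for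
the scalar series `e` with power sums `pₙ(a) pₙ(b)` (`commutation`).

Moving every `D` to the right of every `U` produces the factors for the pairs `l < k` and leaves
`U(A) D(B)` for the united alphabets (`prod_operators`). Let `Zₙ` be the part of its weighted trace
in which `n` boxes are removed and added back. Cyclicity of the trace followed by commutation gives
`Zₙ = tⁿ ∑ eᵢ Zₙ₋ᵢ`, that is, `Z(z) = E(tz) Z(tz)`. The solution has power sums `tⁿ/(1 - tⁿ)` times
those of `E`, and `Z₀` counts partitions because the degree-zero part of `U(A) D(B)` has unit
diagonal (`eq_mul_coeff_of_rec`, `gather_trace_prod`). `U` has infinitely many terms on a basis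
vector, so it is kept as a power series graded by the number of added boxes, which makes all the
algebra finite.

Branching and skew Cauchy are proved first for one variable, by column operations on the
Jacobi-Trudi determinant (`skew_mul_geom`) and by a reflection of interlacing partitions
(`card_strips`), and then for finite alphabets. Each entry depends on finitely many coefficients of
`H`, and over an algebraically closed field any `H` with constant term `1` agrees to any given order
with the series of a finite alphabet (`exists_coeff_eq_geomProd`). Domains embed in such fields.

Skew Schur functions are homogeneous, so the grading by added boxes can be read off from the
monomials; this turns the trace formula into one identity of coefficients (`sum_coeff_skewProd`),
used twice. With the formal alphabets it gives the formal statement, since only finitely many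
families contribute to a given monomial and power of `t`. With one marking variable per
specialization it gives an identity over `ℂ`, which is evaluated with all marks equal to `1`.
Absolute convergence there (`AbsEv`) is preserved by products and `exp`, and the monomials that
occur correspond exactly to the admissible sizes of partitions. The `s`-form is an algebraic
rewriting of each term of the exponent (`symExponentTerm_eq`). -/

noncomputable section

namespace PeriodicSchur

/-! ### Young diagrams through their row lengths. -/

section Diagrams

theorem ext_rowLen {lam mu : YoungDiagram} (h : ∀ i, lam.rowLen i = mu.rowLen i) : lam = mu := by
  ext ⟨i, j⟩
  rw [YoungDiagram.mem_cells, YoungDiagram.mem_cells, YoungDiagram.mem_iff_lt_rowLen,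
    YoungDiagram.mem_iff_lt_rowLen, h]

theorem le_iff_rowLen {lam mu : YoungDiagram} : mu ≤ lam ↔ ∀ i, mu.rowLen i ≤ lam.rowLen i := by
  constructor
  · intro h i
    by_contra! hlt
    exact lt_irrefl _ (YoungDiagram.mem_iff_lt_rowLen.mp (h (YoungDiagram.mem_iff_lt_rowLen.mpr hlt)))
  · rintro h ⟨i, j⟩ hij
    exact YoungDiagram.mem_iff_lt_rowLen.mpr
      ((YoungDiagram.mem_iff_lt_rowLen.mp hij).trans_le (h i))

theorem rowLen_eq_zero_iff {lam : YoungDiagram} {i : ℕ} :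
    lam.rowLen i = 0 ↔ lam.colLen 0 ≤ i := by
  have h : 0 < lam.rowLen i ↔ i < lam.colLen 0 :=
    YoungDiagram.mem_iff_lt_rowLen.symm.trans YoungDiagram.mem_iff_lt_colLen
  omega

theorem card_eq_sum_rowLen (lam : YoungDiagram) {r : ℕ} (hr : lam.colLen 0 ≤ r) :
    lam.card = ∑ i ∈ Finset.range r, lam.rowLen i := by
  have h : ∀ c ∈ lam.cells, c.1 ∈ Finset.range r := by
    rintro ⟨i, j⟩ hc
    rw [Finset.mem_range]
    have h0 : (i, 0) ∈ lam := lam.up_left_mem le_rfl (Nat.zero_le j) ((YoungDiagram.mem_cells _).mp hc)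
    exact (YoungDiagram.mem_iff_lt_colLen.mp h0).trans_le hr
  rw [YoungDiagram.card, Finset.card_eq_sum_card_fiberwise h]
  refine Finset.sum_congr rfl fun i _ => ?_
  rw [YoungDiagram.rowLen_eq_card]
  rfl

theorem colLen_le_card (lam : YoungDiagram) : lam.colLen 0 ≤ lam.card := by
  rw [YoungDiagram.colLen_eq_card]
  exact Finset.card_filter_le _ _

theorem rowLen_le_card (lam : YoungDiagram) (i : ℕ) : lam.rowLen i ≤ lam.card := by
  rw [YoungDiagram.rowLen_eq_card]
  exact Finset.card_filter_le _ _

theorem card_le_card {lam mu : YoungDiagram} (h : mu ≤ lam) : mu.card ≤ lam.card :=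
  Finset.card_le_card (YoungDiagram.cells_subset_iff.mpr h)

/-- The Young diagram with given row lengths. -/
def ofRows (f : ℕ → ℕ) (hf : Antitone f) (r : ℕ) : YoungDiagram where
  cells := (Finset.range r ×ˢ Finset.range (f 0)).filter fun c => c.2 < f c.1
  isLowerSet := by
    rintro ⟨i, j⟩ ⟨i', j'⟩ h hc
    obtain ⟨h1, h2⟩ := Prod.mk_le_mk.mp h
    simp only [Finset.coe_filter, Finset.mem_product, Finset.mem_range, Set.mem_ofPred_eq] at hc ⊢
    have := hf h1
    have := hf (Nat.zero_le i')
    omega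

theorem rowLen_ofRows {f : ℕ → ℕ} (hf : Antitone f) {r : ℕ} (hr : f r = 0) (i : ℕ) :
    (ofRows f hf r).rowLen i = f i := by
  have h : ∀ j, j < (ofRows f hf r).rowLen i ↔ j < f i := by
    intro j
    rw [← YoungDiagram.mem_iff_lt_rowLen, ← YoungDiagram.mem_cells]
    simp only [ofRows, Finset.mem_filter, Finset.mem_product, Finset.mem_range]
    have h0 := hf (Nat.zero_le i)
    constructor
    · exact fun h => h.2
    · intro h
      refine ⟨⟨?_, by omega⟩, h⟩
      by_contra! hi
      have := hf hi
      omega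
  have h1 := h (f i)
  have h2 := h ((ofRows f hf r).rowLen i)
  omega

@[simp]
theorem mem_partitionsOf {n : ℕ} {lam : YoungDiagram} : lam ∈ partitionsOf n ↔ lam.card = n := by
  simp [partitionsOf]

/-- The finite set of partitions of size at most `n`. -/
def partitionsLE (n : ℕ) : Finset YoungDiagram :=
  open Classical in (Finset.range (n + 1)).biUnion partitionsOf

@[simp]
theorem mem_partitionsLE {n : ℕ} {lam : YoungDiagram} : lam ∈ partitionsLE n ↔ lam.card ≤ n := by
  simp [partitionsLE]

end Diagrams

/-! ### Jacobi-Trudi determinants attached to an arbitrary power series. -/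

section SkewDet

open PowerSeries

variable {S : Type*} [CommRing S]

/-- The coefficient of a power series at an integer, `0` at the negative integers. -/
def coeffInt (H : S⟦X⟧) (z : ℤ) : S := if 0 ≤ z then coeff z.toNat H else 0

theorem coeffInt_of_neg (H : S⟦X⟧) {z : ℤ} (h : z < 0) : coeffInt H z = 0 := by
  simp [coeffInt, h]

theorem coeffInt_natCast (H : S⟦X⟧) (n : ℕ) : coeffInt H n = coeff n H := by
  simp [coeffInt]

/-- The Jacobi-Trudi determinant of order `r`. -/
def skewDet (r : ℕ) (H : S⟦X⟧) (lam mu : YoungDiagram) : S :=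
  Matrix.det (Matrix.of fun i j : Fin r =>
    coeffInt H ((lam.rowLen i : ℤ) - (mu.rowLen j : ℤ) - (i : ℤ) + (j : ℤ)))

/-- The value of `s_{λ/μ}` when `H` is the generating function of the values of the `hₙ`. -/
def skew (H : S⟦X⟧) (lam mu : YoungDiagram) : S :=
  skewDet (max (lam.colLen 0) (mu.colLen 0)) H lam mu

/-- The added row is zero except for its last entry `h₀ = 1`, all other indices in it being
negative. -/
theorem skewDet_succ {H : S⟦X⟧} (hH : constantCoeff H = 1) {lam mu : YoungDiagram} {r : ℕ}
    (hl : lam.colLen 0 ≤ r) (hm : mu.colLen 0 ≤ r) :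
    skewDet (r + 1) H lam mu = skewDet r H lam mu := by
  rw [skewDet, Matrix.det_succ_row _ (Fin.last r), Finset.sum_eq_single (Fin.last r)]
  · have h1 : lam.rowLen r = 0 := rowLen_eq_zero_iff.mpr hl
    have h2 : mu.rowLen r = 0 := rowLen_eq_zero_iff.mpr hm
    have h3 : (-1 : S) ^ (r + r) = 1 := Even.neg_one_pow ⟨r, rfl⟩
    simp only [Fin.val_last, Matrix.of_apply, h1, h2, h3]
    rw [skewDet]
    have : coeffInt H (((0 : ℕ) : ℤ) - ((0 : ℕ) : ℤ) - r + r) = 1 := by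
      simp [coeffInt, hH]
    rw [this, one_mul, one_mul]
    congr 1
    ext i j
    simp
  · intro j _ hj
    have h1 : lam.rowLen r = 0 := rowLen_eq_zero_iff.mpr hl
    have h2 : (j : ℕ) < r := by
      have := j.2
      have : (j : ℕ) ≠ r := fun h => hj (Fin.ext h)
      omega
    rw [Matrix.of_apply, coeffInt_of_neg, mul_zero, zero_mul]
    simp only [Fin.val_last, h1]
    omega
  · simp

theorem skewDet_eq_skew {H : S⟦X⟧} (hH : constantCoeff H = 1) {lam mu : YoungDiagram} {r : ℕ}
    (hl : lam.colLen 0 ≤ r) (hm : mu.colLen 0 ≤ r) : skewDet r H lam mu = skew H lam mu := by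
  obtain ⟨k, rfl⟩ := Nat.exists_eq_add_of_le (max_le hl hm)
  clear hl hm
  induction k with
  | zero => rfl
  | succ k ih =>
    rw [← add_assoc, skewDet_succ hH (by omega) (by omega), ih]

/-- If `μ_p > λ_p`, all entries in rows from `p` on and columns up to `p` have negative index. The
matrix is then block triangular, with a zero row in the leading block. -/
theorem skew_eq_zero {H : S⟦X⟧} {lam mu : YoungDiagram} (h : ¬ mu ≤ lam) : skew H lam mu = 0 := by
  rw [le_iff_rowLen] at h
  push Not at h
  obtain ⟨p, hp⟩ := h
  have hp' : p < max (lam.colLen 0) (mu.colLen 0) := by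
    by_contra! hlt
    have : mu.rowLen p = 0 := rowLen_eq_zero_iff.mpr ((le_max_right _ _).trans hlt)
    omega
  rw [skew, skewDet, Matrix.twoBlockTriangular_det _ (fun i : Fin _ => (i : ℕ) ≤ p)]
  · rw [Matrix.det_eq_zero_of_row_eq_zero ⟨⟨p, hp'⟩, le_rfl⟩, zero_mul]
    rintro ⟨j, hj⟩
    rw [Matrix.toSquareBlockProp_def, Matrix.of_apply, Matrix.of_apply]
    apply coeffInt_of_neg
    have := mu.rowLen_anti j p hj
    simp only
    omega
  · intro i hi j hj
    rw [Matrix.of_apply]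
    apply coeffInt_of_neg
    have := mu.rowLen_anti j p hj
    have := lam.rowLen_anti p i (by omega)
    omega

/-- The determinant only involves `hₙ` with `n` at most the first row of `λ` plus the order. This
locality allows `H` to be replaced by the series of a finite alphabet. -/
theorem skew_congr {H H' : S⟦X⟧} {M : ℕ} (h : ∀ n ≤ M, coeff n H = coeff n H')
    {lam mu : YoungDiagram} (hM : 2 * lam.card + mu.card ≤ M) : skew H lam mu = skew H' lam mu := by
  rw [skew, skew, skewDet, skewDet]
  congr 1
  ext i j
  simp only [Matrix.of_apply, coeffInt]
  split_ifs with h0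
  · apply h
    have := rowLen_le_card lam i
    have := colLen_le_card lam
    have := colLen_le_card mu
    have := j.2
    omega
  · rfl

theorem map_skew {S' : Type*} [CommRing S'] (φ : S →+* S') (H : S⟦X⟧) (lam mu : YoungDiagram) :
    φ (skew H lam mu) = skew (PowerSeries.map φ H) lam mu := by
  rw [skew, skewDet, RingHom.map_det, skew, skewDet]
  congr 1
  ext i j
  simp only [RingHom.mapMatrix_apply, Matrix.map_apply, Matrix.of_apply, coeffInt]
  split_ifs <;> simp

theorem skew_one (lam mu : YoungDiagram) [Decidable (lam = mu)] :
    skew (1 : S⟦X⟧) lam mu = if lam = mu then 1 else 0 := by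
  have hc : ∀ z : ℤ, coeffInt (1 : S⟦X⟧) z = if z = 0 then 1 else 0 := by
    intro z
    rw [coeffInt, coeff_one]
    split_ifs <;> first | rfl | omega
  set r := max (lam.colLen 0) (mu.colLen 0) with hr
  split_ifs with h
  · subst h
    rw [skew, skewDet]
    convert Matrix.det_one (n := Fin (max (lam.colLen 0) (lam.colLen 0))) (R := S)
    ext i j
    rw [Matrix.of_apply, hc, Matrix.one_apply]
    congr 1
    rw [eq_iff_iff, Fin.ext_iff]
    constructor
    · intro h
      rcases lt_trichotomy (i : ℕ) j with h' | h' | h'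
      · have := lam.rowLen_anti i j h'.le
        omega
      · exact h'
      · have := lam.rowLen_anti j i h'.le
        omega
    · intro h
      rw [h]
      ring
  · by_contra hne
    apply h
    by_cases hle : mu ≤ lam
    swap
    · exact absurd (skew_eq_zero hle) hne
    -- A nonzero term of the Leibniz expansion matches the numbers `λ_i - i` with the `μ_j - j`.
    -- Summing the matches gives equal sizes, which together with `μ ⊆ λ` forces equality.
    have hex : ∃ σ : Equiv.Perm (Fin r), ∀ i : Fin r,
        (lam.rowLen (σ i) : ℤ) - mu.rowLen i - (σ i : ℕ) + i = 0 := by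
      rw [skew, skewDet, Matrix.det_apply] at hne
      obtain ⟨σ, -, hσ⟩ := Finset.exists_ne_zero_of_sum_ne_zero hne
      refine ⟨σ, fun i => ?_⟩
      by_contra hi
      apply hσ
      rw [Finset.prod_eq_zero (Finset.mem_univ i), smul_zero]
      rw [Matrix.of_apply, hc, if_neg hi]
    obtain ⟨σ, hσ⟩ := hex
    have hsum : lam.card = mu.card := by
      rw [card_eq_sum_rowLen lam (le_max_left _ (mu.colLen 0)),
        card_eq_sum_rowLen mu (le_max_right (lam.colLen 0) _), ← hr, Finset.sum_range,
        Finset.sum_range]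
      have h1 : ∑ i : Fin r, ((lam.rowLen (σ i) : ℤ) - mu.rowLen i - (σ i : ℕ) + i) = 0 :=
        Finset.sum_eq_zero fun i _ => hσ i
      rw [Finset.sum_add_distrib, Finset.sum_sub_distrib, Finset.sum_sub_distrib,
        Equiv.sum_comp σ (fun i : Fin r => (lam.rowLen i : ℤ)),
        Equiv.sum_comp σ (fun i : Fin r => ((i : ℕ) : ℤ))] at h1
      zify
      linarith
    exact (YoungDiagram.ext (Finset.eq_of_subset_of_card_le
      (YoungDiagram.cells_subset_iff.mpr hle) hsum.le)).symm

end SkewDet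

/-! ### Horizontal strips and branching for one added variable. -/

section Strips

open PowerSeries

/-- `lam / mu` is a horizontal strip. -/
def IsStrip (lam mu : YoungDiagram) : Prop :=
  ∀ i, mu.rowLen i ≤ lam.rowLen i ∧ lam.rowLen (i + 1) ≤ mu.rowLen i

theorem IsStrip.le {lam mu : YoungDiagram} (h : IsStrip lam mu) : mu ≤ lam :=
  le_iff_rowLen.mpr fun i => (h i).1

variable {S : Type*} [CommRing S]

/-- The geometric series `1 / (1 - yX)`. -/
def geom (y : S) : S⟦X⟧ := PowerSeries.mk fun n => y ^ n

@[simp]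
theorem constantCoeff_geom (y : S) : constantCoeff (geom y) = 1 := by
  simp [geom, ← coeff_zero_eq_constantCoeff_apply]

theorem geom_eq (y : S) : geom y = 1 + X * (C y * geom y) := by
  ext n
  cases n with
  | zero => simp [geom]
  | succ n => simp [geom, coeff_succ_X_mul, coeff_one, pow_succ, mul_comm]

theorem coeffInt_mul_geom (H : S⟦X⟧) (y : S) (z : ℤ) :
    coeffInt (H * geom y) z = coeffInt H z + y * coeffInt (H * geom y) (z - 1) := by
  have h : H * geom y = H + X * (C y * (H * geom y)) := by
    conv_lhs => rw [geom_eq]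
    ring
  rcases lt_trichotomy z 0 with h0 | rfl | h0
  · rw [coeffInt_of_neg _ h0, coeffInt_of_neg _ h0, coeffInt_of_neg _ (by omega)]
    simp
  · rw [coeffInt_of_neg _ (by norm_num : (0 : ℤ) - 1 < 0), h]
    simp [coeffInt]
  · obtain ⟨n, rfl⟩ : ∃ n : ℕ, z = (n + 1 : ℕ) := ⟨z.toNat - 1, by omega⟩
    rw [show ((n + 1 : ℕ) : ℤ) - 1 = (n : ℕ) by push_cast; ring, coeffInt_natCast,
      coeffInt_natCast, coeffInt_natCast]
    conv_lhs => rw [h]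
    rw [map_add, coeff_succ_X_mul, coeff_C_mul]

theorem coeffInt_mul_geom_eq_sum (H : S⟦X⟧) (y : S) (z : ℤ) (m : ℕ) :
    coeffInt (H * geom y) z =
      ∑ d ∈ Finset.range m, y ^ d * coeffInt H (z - d) + y ^ m * coeffInt (H * geom y) (z - m) := by
  induction m with
  | zero => simp
  | succ m ih =>
    rw [ih, Finset.sum_range_succ, coeffInt_mul_geom H y (z - m), pow_succ]
    push_cast
    rw [sub_sub]
    ring

theorem sum_Icc_strip (H : S⟦X⟧) (y : S) (z : ℤ) (a b : ℕ) :
    ∑ k ∈ Finset.Icc a b, y ^ (k - a) * coeffInt H (z - k) =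
      ∑ d ∈ Finset.range (b + 1 - a), y ^ d * coeffInt H (z - a - d) := by
  rw [← Finset.Ico_add_one_right_eq_Icc, Finset.sum_Ico_eq_sum_range]
  refine Finset.sum_congr rfl fun d _ => ?_
  rw [Nat.add_sub_cancel_left]
  push_cast
  rw [sub_sub]

open Classical in
/-- The branching rule for adjoining one variable to an alphabet. -/
theorem skew_mul_geom {H : S⟦X⟧} (hH : constantCoeff H = 1) (y : S) (lam nu : YoungDiagram) :
    skew (H * geom y) lam nu = ∑ ka ∈ (partitionsLE lam.card).filter (IsStrip · nu),
      y ^ (ka.card - nu.card) * skew H lam ka := by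
  set r := max (lam.colLen 0) (nu.colLen 0) with hr
  -- Column `j` will be a sum over `κ_j` from `ν_j` to `b j = ν_{j-1}`, which is the strip
  -- condition. Column `0` has no predecessor; its bound `λ_0 + ν_0` is large enough that the
  -- remainder has negative index. The order `r + 1` ensures that a first column exists.
  set b : Fin (r + 1) → ℕ :=
    Fin.cons (lam.rowLen 0 + nu.rowLen 0) (fun j : Fin r => nu.rowLen j) with hb
  set t : Fin (r + 1) → Finset ℕ := fun j => Finset.Icc (nu.rowLen j) (b j) with ht
  have hab : ∀ j : Fin (r + 1), nu.rowLen j ≤ b j := by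
    intro j
    refine Fin.cases ?_ (fun j => ?_) j
    · simp [hb]
    · simpa [hb] using nu.rowLen_anti j (j + 1) (Nat.le_succ _)
  have hG : constantCoeff (H * geom y) = 1 := by simp [hH]
  -- Unrolling `g_z = h_z + y g_{z-1}` in column `j` exactly `ν_{j-1} + 1 - ν_j` times ends in a
  -- multiple of column `j - 1`, which a column operation removes.
  rw [← skewDet_eq_skew hG (r := r + 1) (by omega) (by omega), skewDet,
    Matrix.det_eq_of_forall_col_eq_smul_add_pred
      (B := Matrix.of fun i j : Fin (r + 1) => ∑ k ∈ t j, y ^ (k - nu.rowLen j) *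
        coeffInt H ((lam.rowLen i : ℤ) - (i : ℤ) + (j : ℤ) - k))
      (fun j : Fin r => y ^ (nu.rowLen j + 1 - nu.rowLen (j + 1)))]
  · rw [← Matrix.det_transpose]
    have hM : (Matrix.of fun i j : Fin (r + 1) => ∑ k ∈ t j, y ^ (k - nu.rowLen j) *
        coeffInt H ((lam.rowLen i : ℤ) - (i : ℤ) + (j : ℤ) - k)).transpose =
        fun j => ∑ k ∈ t j, fun i : Fin (r + 1) => y ^ (k - nu.rowLen j) *
          coeffInt H ((lam.rowLen i : ℤ) - (i : ℤ) + (j : ℤ) - k) := by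
      ext j i
      rw [Matrix.transpose_apply, Matrix.of_apply, Finset.sum_apply]
    have hterm : ∀ p : Fin (r + 1) → ℕ, Matrix.detRowAlternating (R := S)
        (fun j i : Fin (r + 1) => y ^ (p j - nu.rowLen j) *
          coeffInt H ((lam.rowLen i : ℤ) - (i : ℤ) + (j : ℤ) - p j)) =
        y ^ (∑ j, (p j - nu.rowLen j)) * Matrix.det (Matrix.of fun i j : Fin (r + 1) =>
          coeffInt H ((lam.rowLen i : ℤ) - p j - (i : ℤ) + (j : ℤ))) := by
      intro p
      rw [← Finset.prod_pow_eq_pow_sum, ← Matrix.det_transpose (Matrix.of _),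
        ← Matrix.det_mul_column]
      change Matrix.det _ = _
      congr 1
      ext j i
      simp only [Matrix.of_apply, Matrix.transpose_apply]
      congr 2
      ring
    rw [hM]
    -- Multilinearity turns the determinant into a sum over all choices of `κ_j`, and each choice
    -- gives a Jacobi-Trudi determinant for `λ/κ`.
    refine ((Matrix.detRowAlternating (R := S)).toMultilinearMap.map_sum_finset
      (fun j k => fun i : Fin (r + 1) => y ^ (k - nu.rowLen j) *
          coeffInt H ((lam.rowLen i : ℤ) - (i : ℤ) + (j : ℤ) - k)) t).trans ?_
    refine (Finset.sum_congr rfl fun p _ => hterm p).trans ?_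
    symm
    have hcard : ∀ ka : YoungDiagram, IsStrip ka nu → ka.colLen 0 ≤ r + 1 →
        ka.card - nu.card = ∑ j : Fin (r + 1), (ka.rowLen j - nu.rowLen j) := by
      intro ka hs hc
      rw [card_eq_sum_rowLen ka hc, card_eq_sum_rowLen nu (r := r + 1) (by omega),
        Finset.sum_range, Finset.sum_range]
      exact (Finset.sum_tsub_distrib (s := Finset.univ) (f := fun j : Fin (r + 1) => ka.rowLen j)
        (g := fun j => nu.rowLen j) fun j _ => (hs j).1).symm
    -- Only nonzero terms are matched, so `κ ⊆ λ` may be assumed; this bounds the number of rows of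
    -- `κ` and puts it in the finite index set.
    refine Finset.sum_bij_ne_zero (fun ka _ _ j => ka.rowLen (j : Fin (r + 1))) ?_ ?_ ?_ ?_
    · intro ka h1 h2
      have hle : ka ≤ lam := by
        by_contra hle
        exact h2 (by rw [skew_eq_zero hle, mul_zero])
      have hs := (Finset.mem_filter.mp h1).2
      rw [Fintype.mem_piFinset]
      intro j
      refine Finset.mem_Icc.mpr ⟨(hs j).1, ?_⟩
      refine Fin.cases ?_ (fun j => ?_) j
      · have := le_iff_rowLen.mp hle 0
        simp [hb]
        omega
      · simpa [hb] using (hs j).2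
    · intro ka h1 h2 ka' h1' h2' heq
      have hle : ∀ {ka : YoungDiagram}, y ^ (ka.card - nu.card) * skew H lam ka ≠ 0 → ka ≤ lam := by
        intro ka h2
        by_contra hle
        exact h2 (by rw [skew_eq_zero hle, mul_zero])
      apply ext_rowLen
      intro i
      by_cases hi : i < r + 1
      · exact congrFun heq ⟨i, hi⟩
      · have h0 : lam.rowLen i = 0 := rowLen_eq_zero_iff.mpr (by omega)
        have h3 := le_iff_rowLen.mp (hle h2) i
        have h4 := le_iff_rowLen.mp (hle h2') i
        omega
    · intro p hp hne
      rw [Fintype.mem_piFinset] at hp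
      have hp1 : ∀ j, nu.rowLen (j : Fin (r + 1)) ≤ p j := fun j => (Finset.mem_Icc.mp (hp j)).1
      have hp2 : ∀ j : Fin r, p j.succ ≤ nu.rowLen j := by
        intro j
        simpa [hb] using (Finset.mem_Icc.mp (hp j.succ)).2
      set f : ℕ → ℕ := fun i => if h : i < r + 1 then p ⟨i, h⟩ else 0 with hf
      have hfn : ∀ i, f (i + 1) ≤ nu.rowLen i := by
        intro i
        by_cases hi : i < r
        · simpa [hf, hi] using hp2 ⟨i, hi⟩
        · simp [hf, hi]
      have hnf : ∀ i, nu.rowLen i ≤ f i := by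
        intro i
        by_cases hi : i < r + 1
        · have hfi : f i = p ⟨i, hi⟩ := dif_pos hi
          exact hfi ▸ hp1 ⟨i, hi⟩
        · have h0 : nu.rowLen i = 0 := rowLen_eq_zero_iff.mpr (by omega)
          omega
      have hanti : Antitone f := antitone_nat_of_succ_le fun i => (hfn i).trans (hnf i)
      have hrow := rowLen_ofRows hanti (r := r + 1) (by simp [hf])
      have hs : IsStrip (ofRows f hanti (r + 1)) nu := fun i => by
        rw [hrow, hrow]
        exact ⟨hnf i, hfn i⟩
      have hcol : (ofRows f hanti (r + 1)).colLen 0 ≤ r + 1 :=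
        rowLen_eq_zero_iff.mp (by rw [hrow]; simp [hf])
      have hpf : (fun j : Fin (r + 1) => (ofRows f hanti (r + 1)).rowLen j) = p := by
        funext j
        rw [hrow]
        exact dif_pos j.2
      have hval : y ^ ((ofRows f hanti (r + 1)).card - nu.card) *
          skew H lam (ofRows f hanti (r + 1)) = y ^ (∑ j, (p j - nu.rowLen j)) *
            Matrix.det (Matrix.of fun i j : Fin (r + 1) =>
              coeffInt H ((lam.rowLen i : ℤ) - p j - (i : ℤ) + (j : ℤ))) := by
        rw [hcard _ hs hcol, ← skewDet_eq_skew hH (r := r + 1) (by omega) hcol, skewDet, ← hpf]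
      have hne' := hval.trans_ne hne
      have hle : ofRows f hanti (r + 1) ≤ lam := by
        by_contra hle
        exact hne' (by rw [skew_eq_zero hle, mul_zero])
      exact ⟨_, Finset.mem_filter.mpr ⟨mem_partitionsLE.mpr (card_le_card hle), hs⟩, hne', hpf⟩
    · intro ka h1 h2
      have hle : ka ≤ lam := by
        by_contra hle
        exact h2 (by rw [skew_eq_zero hle, mul_zero])
      have hcol : ka.colLen 0 ≤ r + 1 := by
        refine rowLen_eq_zero_iff.mp ?_
        have h0 : lam.rowLen (r + 1) = 0 := rowLen_eq_zero_iff.mpr (by omega)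
        have := le_iff_rowLen.mp hle (r + 1)
        omega
      rw [hcard _ (Finset.mem_filter.mp h1).2 hcol,
        ← skewDet_eq_skew hH (r := r + 1) (by omega) hcol, skewDet]
  · intro i
    simp only [Matrix.of_apply, ht]
    rw [sum_Icc_strip, coeffInt_mul_geom_eq_sum H y _ (b 0 + 1 - nu.rowLen 0),
      coeffInt_of_neg (z := _ - ((b 0 + 1 - nu.rowLen 0 : ℕ) : ℤ)), mul_zero, add_zero]
    · refine Finset.sum_congr rfl fun d _ => ?_
      congr 2
      simp only [Fin.val_zero]
      ring
    · have := hab 0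
      have h2 : b 0 = lam.rowLen 0 + nu.rowLen 0 := by simp [hb]
      have := lam.rowLen_anti 0 i (Nat.zero_le _)
      simp only [Fin.val_zero] at *
      omega
  · intro i j
    have hbj : b j.succ = nu.rowLen j := by simp [hb]
    have h1 := nu.rowLen_anti j (j + 1) (Nat.le_succ _)
    simp only [Matrix.of_apply, ht]
    rw [sum_Icc_strip, hbj,
      coeffInt_mul_geom_eq_sum H y _ (nu.rowLen j + 1 - nu.rowLen (j + 1))]
    congr 1
    · refine Finset.sum_congr ?_ fun d _ => ?_
      · simp
      · congr 2
        simp only [Fin.val_succ]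
        push_cast
        ring
    · congr 2
      simp only [Fin.val_succ, Fin.val_castSucc]
      push_cast [Nat.cast_sub (show nu.rowLen (j + 1) ≤ nu.rowLen j + 1 by omega)]
      ring

end Strips

/-! ### The skew Cauchy identity for two one-letter alphabets. -/

section OneVariable

open PowerSeries

variable {S : Type*} [CommRing S]

open Classical in
theorem skew_geom (y : S) (lam mu : YoungDiagram) :
    skew (geom y) lam mu = if IsStrip lam mu then y ^ (lam.card - mu.card) else 0 := by
  have h := skew_mul_geom (H := (1 : S⟦X⟧)) (by simp) y lam mu
  rw [one_mul] at h
  rw [h, Finset.sum_filter, Finset.sum_eq_single lam]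
  · simp [skew_one]
  · intro ka _ hne
    simp [skew_one, hne.symm]
  · simp

/-- The branching rule for adjoining one variable to an alphabet. -/
theorem skew_mul_geom' {H : S⟦X⟧} (hH : constantCoeff H = 1) (y : S) (lam nu : YoungDiagram) :
    skew (H * geom y) lam nu =
      ∑ ka ∈ partitionsLE lam.card, skew H lam ka * skew (geom y) ka nu := by
  classical
  rw [skew_mul_geom hH, Finset.sum_filter]
  refine Finset.sum_congr rfl fun ka _ => ?_
  rw [skew_geom]
  split_ifs <;> ring

/-- Sum the relation over all rows and use `max + min = sum`; the row `λ_0` and the term `max(μ_0,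
ν_0)` stay unpaired because of the index shift. -/
theorem card_add_card_of_reflection {lam ka mu nu : YoungDiagram}
    (h : ∀ i, ka.rowLen i + lam.rowLen (i + 1) =
      max (mu.rowLen (i + 1)) (nu.rowLen (i + 1)) + min (mu.rowLen i) (nu.rowLen i)) :
    ka.card + lam.card + max (mu.rowLen 0) (nu.rowLen 0) = mu.card + nu.card + lam.rowLen 0 := by
  obtain ⟨R, h1, h2, h3, h4⟩ : ∃ R, lam.colLen 0 ≤ R ∧ ka.colLen 0 ≤ R ∧ mu.colLen 0 ≤ R ∧
      nu.colLen 0 ≤ R :=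
    ⟨lam.colLen 0 + ka.colLen 0 + mu.colLen 0 + nu.colLen 0, by omega, by omega, by omega, by omega⟩
  have hsum := Finset.sum_congr (rfl : Finset.range R = Finset.range R) fun i _ => h i
  rw [Finset.sum_add_distrib, Finset.sum_add_distrib] at hsum
  rw [card_eq_sum_rowLen ka h2, card_eq_sum_rowLen lam (r := R + 1) (by omega),
    card_eq_sum_rowLen mu h3, card_eq_sum_rowLen nu h4, Finset.sum_range_succ']
  have hmax := Finset.sum_range_succ' (fun i => max (mu.rowLen i) (nu.rowLen i)) R
  rw [Finset.sum_range_succ, rowLen_eq_zero_iff.mpr h3, rowLen_eq_zero_iff.mpr h4] at hmax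
  have hmm : ∑ i ∈ Finset.range R, max (mu.rowLen i) (nu.rowLen i) +
      ∑ i ∈ Finset.range R, min (mu.rowLen i) (nu.rowLen i) =
      ∑ i ∈ Finset.range R, mu.rowLen i + ∑ i ∈ Finset.range R, nu.rowLen i := by
    rw [← Finset.sum_add_distrib, ← Finset.sum_add_distrib]
    exact Finset.sum_congr rfl fun i _ => max_add_min _ _
  simp only [max_self] at hmax
  omega

open Classical in
-- For given `μ, ν`, both `λ_{i+1}` and `κ_i` range over the interval from `max(μ_{i+1}, ν_{i+1})`
-- to `min(μ_i, ν_i)`, so reflecting it gives a bijection on these rows. The remaining freedom is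
-- `λ_0 ≥ max(μ_0, ν_0)`; its excess equals `|κ| + n - |μ|`, which explains the last condition on
-- `κ`.
theorem card_strips (mu nu : YoungDiagram) (n : ℕ) :
    ((partitionsOf (nu.card + n)).filter fun lam => IsStrip lam nu ∧ IsStrip lam mu).card =
      ((partitionsLE nu.card).filter fun ka =>
        (IsStrip nu ka ∧ IsStrip mu ka) ∧ mu.card ≤ ka.card + n).card := by
  have hanti : ∀ lam : YoungDiagram, IsStrip lam nu → IsStrip lam mu → Antitone fun i =>
      max (mu.rowLen (i + 1)) (nu.rowLen (i + 1)) + min (mu.rowLen i) (nu.rowLen i) -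
        lam.rowLen (i + 1) := by
    intro lam h1 h2
    refine antitone_nat_of_succ_le fun i => ?_
    have := h1 i; have := h1 (i + 1); have := h1 (i + 1 + 1)
    have := h2 i; have := h2 (i + 1); have := h2 (i + 1 + 1)
    omega
  have hrow : ∀ (lam : YoungDiagram) (h1 : IsStrip lam nu) (h2 : IsStrip lam mu) (i : ℕ),
      (ofRows _ (hanti lam h1 h2) (mu.colLen 0 + nu.colLen 0)).rowLen i =
        max (mu.rowLen (i + 1)) (nu.rowLen (i + 1)) + min (mu.rowLen i) (nu.rowLen i) -
          lam.rowLen (i + 1) := by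
    intro lam h1 h2
    refine rowLen_ofRows _ ?_
    rw [rowLen_eq_zero_iff.mpr (show mu.colLen 0 ≤ mu.colLen 0 + nu.colLen 0 by omega),
      rowLen_eq_zero_iff.mpr (show mu.colLen 0 ≤ mu.colLen 0 + nu.colLen 0 + 1 by omega),
      rowLen_eq_zero_iff.mpr (show nu.colLen 0 ≤ mu.colLen 0 + nu.colLen 0 + 1 by omega)]
    simp
  refine Finset.card_bij (fun lam hlam => ofRows _ (hanti lam (Finset.mem_filter.mp hlam).2.1
    (Finset.mem_filter.mp hlam).2.2) (mu.colLen 0 + nu.colLen 0)) ?_ ?_ ?_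
  · intro lam hlam
    obtain ⟨hc, h1, h2⟩ := Finset.mem_filter.mp hlam
    rw [mem_partitionsOf] at hc
    have hs := card_add_card_of_reflection (lam := lam)
      (ka := ofRows _ (hanti lam h1 h2) (mu.colLen 0 + nu.colLen 0)) (mu := mu) (nu := nu) (by
        intro i
        rw [hrow lam h1 h2]
        have := h1 i; have := h2 i
        omega)
    have hs1 : IsStrip nu (ofRows _ (hanti lam h1 h2) (mu.colLen 0 + nu.colLen 0)) := by
      intro i
      rw [hrow lam h1 h2]
      have := h1 i; have := h2 i; have := h1 (i + 1); have := h2 (i + 1)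
      omega
    have hs2 : IsStrip mu (ofRows _ (hanti lam h1 h2) (mu.colLen 0 + nu.colLen 0)) := by
      intro i
      rw [hrow lam h1 h2]
      have := h1 i; have := h2 i; have := h1 (i + 1); have := h2 (i + 1)
      omega
    refine Finset.mem_filter.mpr ⟨mem_partitionsLE.mpr (card_le_card hs1.le), ⟨hs1, hs2⟩, ?_⟩
    have := (h1 0).1; have := (h2 0).1
    omega
  · intro lam hlam lam' hlam' heq
    obtain ⟨hc, h1, h2⟩ := Finset.mem_filter.mp hlam
    obtain ⟨hc', h1', h2'⟩ := Finset.mem_filter.mp hlam'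
    rw [mem_partitionsOf] at hc hc'
    have hsucc : ∀ i, lam.rowLen (i + 1) = lam'.rowLen (i + 1) := by
      intro i
      have := congrArg (fun k => YoungDiagram.rowLen k i) heq
      simp only [hrow lam h1 h2, hrow lam' h1' h2'] at this
      have := h1 i; have := h2 i; have := h1 (i + 1); have := h2 (i + 1)
      have := h1' i; have := h2' i; have := h1' (i + 1); have := h2' (i + 1)
      omega
    apply ext_rowLen
    rintro (_ | i)
    · rw [card_eq_sum_rowLen lam (r := lam.colLen 0 + lam'.colLen 0 + 1) (by omega),
        Finset.sum_range_succ'] at hc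
      rw [card_eq_sum_rowLen lam' (r := lam.colLen 0 + lam'.colLen 0 + 1) (by omega),
        Finset.sum_range_succ'] at hc'
      have := Finset.sum_congr (rfl : Finset.range (lam.colLen 0 + lam'.colLen 0) = _)
        fun i _ => hsucc i
      omega
    · exact hsucc i
  · intro ka hka
    obtain ⟨hc, ⟨h1, h2⟩, hn⟩ := Finset.mem_filter.mp hka
    -- The inverse reflection: the first row takes the excess prescribed by the sizes.
    set f : ℕ → ℕ := fun i => Nat.casesOn i
      (max (mu.rowLen 0) (nu.rowLen 0) + (ka.card + n - mu.card))
      (fun i => max (mu.rowLen (i + 1)) (nu.rowLen (i + 1)) + min (mu.rowLen i) (nu.rowLen i) -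
        ka.rowLen i) with hf
    have hf0 : f 0 = max (mu.rowLen 0) (nu.rowLen 0) + (ka.card + n - mu.card) := rfl
    have hfs : ∀ i, f (i + 1) = max (mu.rowLen (i + 1)) (nu.rowLen (i + 1)) +
        min (mu.rowLen i) (nu.rowLen i) - ka.rowLen i := fun i => rfl
    have hanti' : Antitone f := by
      refine antitone_nat_of_succ_le fun i => ?_
      cases i with
      | zero =>
        rw [hfs, hf0]
        have := h1 0; have := h2 0
        omega
      | succ i =>
        rw [hfs, hfs]
        have := h1 i; have := h1 (i + 1); have := h2 i; have := h2 (i + 1)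
        omega
    have hr0 : ∀ i, mu.colLen 0 + nu.colLen 0 ≤ i → mu.rowLen i = 0 ∧ nu.rowLen i = 0 :=
      fun i hi => ⟨rowLen_eq_zero_iff.mpr (by omega), rowLen_eq_zero_iff.mpr (by omega)⟩
    have hrow' := rowLen_ofRows hanti' (r := mu.colLen 0 + nu.colLen 0 + 1) (by
      rw [hfs]
      have := hr0 (mu.colLen 0 + nu.colLen 0) le_rfl
      have := hr0 (mu.colLen 0 + nu.colLen 0 + 1) (by omega)
      omega)
    have hs1 : IsStrip (ofRows f hanti' (mu.colLen 0 + nu.colLen 0 + 1)) nu := by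
      intro i
      rw [hrow', hrow']
      have := h1 i; have := h2 i
      refine ⟨?_, by rw [hfs]; omega⟩
      cases i with
      | zero => rw [hf0]; omega
      | succ i =>
        have := h1 i; have := h2 i
        rw [hfs]; omega
    have hs2 : IsStrip (ofRows f hanti' (mu.colLen 0 + nu.colLen 0 + 1)) mu := by
      intro i
      rw [hrow', hrow']
      have := h1 i; have := h2 i
      refine ⟨?_, by rw [hfs]; omega⟩
      cases i with
      | zero => rw [hf0]; omega
      | succ i =>
        have := h1 i; have := h2 i
        rw [hfs]; omega
    have hs := card_add_card_of_reflection (ka := ka) (mu := mu) (nu := nu)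
      (lam := ofRows f hanti' (mu.colLen 0 + nu.colLen 0 + 1)) (by
        intro i
        rw [hrow', hfs]
        have := h1 i; have := h2 i
        omega)
    rw [hrow', hf0] at hs
    refine ⟨_, Finset.mem_filter.mpr ⟨mem_partitionsOf.mpr (by omega), hs1, hs2⟩, ?_⟩
    apply ext_rowLen
    intro i
    rw [hrow _ hs1 hs2, hrow', hfs]
    have := h1 i; have := h2 i
    omega

/-- The skew Cauchy identity, by degrees, for alphabets of one variable. -/
theorem skew_cauchy_geom (x y : S) (mu nu : YoungDiagram) (n : ℕ) :
    ∑ lam ∈ partitionsOf (nu.card + n), skew (geom x) lam nu * skew (geom y) lam mu =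
      ∑ p ∈ Finset.HasAntidiagonal.antidiagonal n, coeff p.1 (geom (x * y)) *
        ∑ ka ∈ (partitionsLE nu.card).filter (fun ka => mu.card = ka.card + p.2),
          skew (geom y) nu ka * skew (geom x) mu ka := by
  classical
  -- Every nonzero term on either side is the same monomial `xⁿ y^{|ν|+n-|μ|}`, so the identity
  -- reduces to the equality of two cardinalities.
  have hl : ∑ lam ∈ partitionsOf (nu.card + n), skew (geom x) lam nu * skew (geom y) lam mu =
      ∑ lam ∈ (partitionsOf (nu.card + n)).filter (fun lam => IsStrip lam nu ∧ IsStrip lam mu),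
        x ^ n * y ^ (nu.card + n - mu.card) := by
    rw [Finset.sum_filter]
    refine Finset.sum_congr rfl fun lam hlam => ?_
    rw [mem_partitionsOf] at hlam
    rw [skew_geom, skew_geom, hlam, Nat.add_sub_cancel_left]
    split_ifs <;> simp_all
  have hr : ∑ p ∈ Finset.HasAntidiagonal.antidiagonal n, coeff p.1 (geom (x * y)) *
        ∑ ka ∈ (partitionsLE nu.card).filter (fun ka => mu.card = ka.card + p.2),
          skew (geom y) nu ka * skew (geom x) mu ka =
      ∑ ka ∈ (partitionsLE nu.card).filter (fun ka =>
        (IsStrip nu ka ∧ IsStrip mu ka) ∧ mu.card ≤ ka.card + n),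
        x ^ n * y ^ (nu.card + n - mu.card) := by
    simp_rw [Finset.sum_filter, Finset.mul_sum]
    rw [Finset.sum_comm]
    refine Finset.sum_congr rfl fun ka _ => ?_
    rw [skew_geom, skew_geom]
    by_cases hs : IsStrip nu ka ∧ IsStrip mu ka
    swap
    · rw [if_neg (c := (IsStrip nu ka ∧ IsStrip mu ka) ∧ mu.card ≤ ka.card + n) (fun h => hs h.1)]
      refine Finset.sum_eq_zero fun p _ => ?_
      rw [not_and_or] at hs
      rcases hs with hs | hs <;> simp [hs]
    have h1 := card_le_card hs.1.le
    have h2 := card_le_card hs.2.le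
    by_cases hn : mu.card ≤ ka.card + n
    -- For given `κ` the size condition selects one splitting of `n`; its first part is the power of
    -- `xy` taken from `1/(1 - xyX)`.
    · rw [if_pos (c := (IsStrip nu ka ∧ IsStrip mu ka) ∧ mu.card ≤ ka.card + n) ⟨hs, hn⟩, Finset.sum_eq_single (n - (mu.card - ka.card), mu.card - ka.card)]
      · rw [if_pos (by simp only; omega), if_pos hs.1, if_pos hs.2]
        simp only [geom, coeff_mk, mul_pow]
        obtain ⟨c, hc⟩ := Nat.exists_eq_add_of_le h1
        obtain ⟨d, hd⟩ := Nat.exists_eq_add_of_le h2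
        obtain ⟨e, rfl⟩ : ∃ e, n = e + d := ⟨n - d, by omega⟩
        have e1 : e + d - (mu.card - ka.card) = e := by omega
        have e2 : mu.card - ka.card = d := by omega
        have e3 : nu.card - ka.card = c := by omega
        have e4 : nu.card + (e + d) - mu.card = e + c := by omega
        rw [e1, e2, e3, e4]
        ring
      · rintro ⟨i, j⟩ hp hne
        rw [Finset.HasAntidiagonal.mem_antidiagonal] at hp
        rw [if_neg, mul_zero]
        intro h
        apply hne
        simp only at h hp
        rw [Prod.mk.injEq]
        omega
      · intro h
        exact absurd (Finset.HasAntidiagonal.mem_antidiagonal.mpr (by simp only; omega)) h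
    · rw [if_neg (c := (IsStrip nu ka ∧ IsStrip mu ka) ∧ mu.card ≤ ka.card + n) (fun h => hn h.2)]
      refine Finset.sum_eq_zero fun p hp => ?_
      rw [Finset.HasAntidiagonal.mem_antidiagonal] at hp
      rw [if_neg (by omega), mul_zero]
  rw [hl, hr, Finset.sum_const, Finset.sum_const, card_strips]

end OneVariable

/-! ### Power series determined by their power sums. -/

section Newton

open PowerSeries
open Finset.HasAntidiagonal (antidiagonal mem_antidiagonal)

variable {S : Type*} [CommRing S]

/-- Newton's identities `n hₙ = ∑ qᵢ hₙ₋ᵢ` between a power series `H = ∑ hₙ Xⁿ` with constant term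
`1` and its power sums `qₙ`. -/
def IsNewton (q : ℕ → S) (H : S⟦X⟧) : Prop :=
  constantCoeff H = 1 ∧ X * d⁄dX S H = PowerSeries.mk q * H

theorem coeff_X_mul_derivative (H : S⟦X⟧) (n : ℕ) : coeff n (X * d⁄dX S H) = n * coeff n H := by
  cases n with
  | zero => simp
  | succ n =>
    rw [coeff_succ_X_mul, coeff_derivative]
    push_cast
    ring

theorem isNewton_iff {q : ℕ → S} {H : S⟦X⟧} : IsNewton q H ↔ constantCoeff H = 1 ∧
    ∀ n : ℕ, n * coeff n H = ∑ p ∈ antidiagonal n, q p.1 * coeff p.2 H := by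
  refine and_congr_right fun _ => ?_
  rw [PowerSeries.ext_iff]
  refine forall_congr' fun n => ?_
  rw [coeff_X_mul_derivative, coeff_mul]
  simp only [coeff_mk]

theorem IsNewton.zero_apply {q : ℕ → S} {H : S⟦X⟧} (h : IsNewton q H) : q 0 = 0 := by
  have := (isNewton_iff.mp h).2 0
  simpa [h.1] using this.symm

theorem isNewton_one : IsNewton (0 : ℕ → S) 1 := by
  refine ⟨by simp, ?_⟩
  rw [derivative_one, mul_zero, show PowerSeries.mk (0 : ℕ → S) = 0 from rfl, zero_mul]

/-- The condition is the logarithmic derivative equation, so power sums add under multiplication.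
This and uniqueness replace manipulations with logarithms. -/
theorem IsNewton.mul {q q' : ℕ → S} {H H' : S⟦X⟧} (h : IsNewton q H) (h' : IsNewton q' H') :
    IsNewton (q + q') (H * H') := by
  refine ⟨by rw [map_mul, h.1, h'.1, one_mul], ?_⟩
  have hq : PowerSeries.mk (q + q') = PowerSeries.mk q + PowerSeries.mk q' := by
    ext n
    simp
  rw [Derivation.leibniz, hq, smul_eq_mul, smul_eq_mul]
  linear_combination H' * h.2 + H * h'.2

theorem IsNewton.prod {ι : Type*} {s : Finset ι} {q : ι → ℕ → S} {H : ι → S⟦X⟧}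
    (h : ∀ i ∈ s, IsNewton (q i) (H i)) : IsNewton (∑ i ∈ s, q i) (∏ i ∈ s, H i) := by
  classical
  induction s using Finset.induction_on with
  | empty => simpa using isNewton_one
  | insert i s hi ih =>
    rw [Finset.sum_insert hi, Finset.prod_insert hi]
    exact (h i (Finset.mem_insert_self _ _)).mul
      (ih fun j hj => h j (Finset.mem_insert_of_mem hj))

theorem IsNewton.map {S' : Type*} [CommRing S'] (φ : S →+* S') {q : ℕ → S} {H : S⟦X⟧}
    (h : IsNewton q H) : IsNewton (fun n => φ (q n)) (PowerSeries.map φ H) := by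
  rw [isNewton_iff] at h ⊢
  refine ⟨by rw [← coeff_zero_eq_constantCoeff_apply, coeff_map, coeff_zero_eq_constantCoeff_apply,
    h.1, map_one], fun n => ?_⟩
  have := congrArg φ (h.2 n)
  simpa using this

theorem IsNewton.rescale (c : S) {q : ℕ → S} {H : S⟦X⟧} (h : IsNewton q H) :
    IsNewton (fun n => c ^ n * q n) (PowerSeries.rescale c H) := by
  rw [isNewton_iff] at h ⊢
  refine ⟨by rw [← coeff_zero_eq_constantCoeff_apply, coeff_rescale,
    coeff_zero_eq_constantCoeff_apply, h.1, pow_zero, one_mul], fun n => ?_⟩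
  rw [coeff_rescale, mul_left_comm, h.2 n, Finset.mul_sum]
  refine Finset.sum_congr rfl fun p hp => ?_
  rw [coeff_rescale, ← mem_antidiagonal.mp hp, pow_add]
  ring

/-- The power sums of an alphabet with one letter `y`. -/
def powerSeq (y : S) (n : ℕ) : S := if n = 0 then 0 else y ^ n

theorem isNewton_geom (y : S) : IsNewton (powerSeq y) (geom y) := by
  rw [isNewton_iff]
  refine ⟨by simp, fun n => ?_⟩
  rw [Finset.Nat.sum_antidiagonal_eq_sum_range_succ_mk, Finset.sum_range_succ']
  simp only [powerSeq, geom, coeff_mk, if_pos, zero_mul, add_zero]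
  rw [Finset.sum_congr rfl (g := fun _ => y ^ n)]
  · simp
  · intro i hi
    rw [Finset.mem_range] at hi
    rw [if_neg (by omega), ← pow_add]
    congr 1
    omega

/-- Newton's identities determine `n hₙ` recursively, and `n` can be cancelled in characteristic
zero; the recursion respects truncation at `M`. -/
theorem IsNewton.coeff_congr [IsDomain S] [CharZero S] {q q' : ℕ → S} {H H' : S⟦X⟧}
    (h : IsNewton q H) (h' : IsNewton q' H') {M : ℕ} (hq : ∀ n ≤ M, q n = q' n) :
    ∀ n ≤ M, coeff n H = coeff n H' := by
  intro n
  induction n using Nat.strong_induction_on with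
  | _ n ih =>
    intro hn
    rcases Nat.eq_zero_or_pos n with rfl | hpos
    · rw [coeff_zero_eq_constantCoeff_apply, coeff_zero_eq_constantCoeff_apply, h.1, h'.1]
    have hn0 : (n : S) ≠ 0 := by exact_mod_cast hpos.ne'
    apply mul_left_cancel₀ hn0
    rw [(isNewton_iff.mp h).2, (isNewton_iff.mp h').2]
    refine Finset.sum_congr rfl fun p hp => ?_
    rw [mem_antidiagonal] at hp
    rcases Nat.eq_zero_or_pos p.1 with h0 | h0
    · rw [h0, h.zero_apply, h'.zero_apply, zero_mul, zero_mul]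
    · rw [hq _ (by omega), ih p.2 (by omega) (by omega)]

theorem IsNewton.unique [IsDomain S] [CharZero S] {q : ℕ → S} {H H' : S⟦X⟧}
    (h : IsNewton q H) (h' : IsNewton q H') : H = H' := by
  ext n
  exact h.coeff_congr h' (M := n) (fun _ _ => rfl) n le_rfl

theorem IsNewton.powerSum_eq {q : ℕ → S} {H : S⟦X⟧} (h : IsNewton q H) (n : ℕ) :
    q n = n * coeff n H - ∑ i ∈ Finset.range n, q i * coeff (n - i) H := by
  rw [(isNewton_iff.mp h).2, Finset.Nat.sum_antidiagonal_eq_sum_range_succ_mk,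
    Finset.sum_range_succ, Nat.sub_self, coeff_zero_eq_constantCoeff_apply, h.1, mul_one,
    add_sub_cancel_left]

theorem IsNewton.powerSum_congr {q q' : ℕ → S} {H H' : S⟦X⟧}
    (h : IsNewton q H) (h' : IsNewton q' H') {M : ℕ} (hH : ∀ n ≤ M, coeff n H = coeff n H') :
    ∀ n ≤ M, q n = q' n := by
  intro n
  induction n using Nat.strong_induction_on with
  | _ n ih =>
    intro hn
    rw [h.powerSum_eq, h'.powerSum_eq, hH n hn]
    congr 1
    refine Finset.sum_congr rfl fun i hi => ?_
    rw [Finset.mem_range] at hi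
    rw [ih i hi (by omega), hH _ (by omega)]

section Exp

variable [Algebra ℚ S]

/-- The power series `∑ qₙ Xⁿ / n`. -/
def logSeries (q : ℕ → S) : S⟦X⟧ := PowerSeries.mk fun n => (n : ℚ)⁻¹ • q n

theorem hasSubst_logSeries (q : ℕ → S) : HasSubst (logSeries q) :=
  HasSubst.of_constantCoeff_zero' (by
    simp [logSeries, ← coeff_zero_eq_constantCoeff_apply])

/-- The power series `exp(∑ qₙ Xⁿ / n)` with power sums `qₙ`. -/
def newtonExp (q : ℕ → S) : S⟦X⟧ := (PowerSeries.exp S).subst (logSeries q)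

theorem isNewton_newtonExp {q : ℕ → S} (h0 : q 0 = 0) : IsNewton q (newtonExp q) := by
  refine ⟨?_, ?_⟩
  · rw [newtonExp, ← coeff_zero_eq_constantCoeff_apply, coeff_subst' (hasSubst_logSeries q),
      finsum_eq_single _ 0]
    · simp
    · intro n hn
      have : constantCoeff (logSeries q) = 0 := by
        simp [logSeries, ← coeff_zero_eq_constantCoeff_apply]
      rw [coeff_zero_eq_constantCoeff_apply, map_pow, this, zero_pow hn, smul_zero]
  · rw [newtonExp, derivative_subst (hasSubst_logSeries q), derivative_exp, mul_left_comm,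
      mul_comm]
    congr 1
    ext n
    rw [coeff_X_mul_derivative, logSeries, coeff_mk, coeff_mk]
    rcases Nat.eq_zero_or_pos n with rfl | hn
    · simp [h0]
    · rw [← nsmul_eq_mul, ← Nat.cast_smul_eq_nsmul ℚ, smul_smul,
        mul_inv_cancel₀ (by exact_mod_cast hn.ne'), one_smul]

end Exp

end Newton

/-! ### Raising and lowering operators, and matrix entries of their products. -/

section Operators

open PowerSeries
open Finset.HasAntidiagonal (antidiagonal mem_antidiagonal)

variable {S : Type*} [CommRing S]

/-- The endomorphisms of the free module on all partitions. -/
abbrev FockEnd (S : Type*) [CommRing S] : Type _ := Module.End S (YoungDiagram →₀ S)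

/-- The operator `ν ↦ ∑ s_{λ/ν} λ`, graded by `|λ| - |ν|`. -/
def opU (H : S⟦X⟧) : PowerSeries (FockEnd S) := PowerSeries.mk fun n =>
  Finsupp.linearCombination S fun nu : YoungDiagram =>
    ∑ lam ∈ partitionsOf (nu.card + n), Finsupp.single lam (skew H lam nu)

/-- The operator `λ ↦ ∑ s_{λ/μ} μ`. -/
def opD (H : S⟦X⟧) : FockEnd S :=
  Finsupp.linearCombination S fun lam : YoungDiagram =>
    ∑ mu ∈ partitionsLE lam.card, Finsupp.single mu (skew H lam mu)

/-- The scalar series. -/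
def scalarOp (e : S⟦X⟧) : PowerSeries (FockEnd S) := PowerSeries.map (algebraMap S (FockEnd S)) e

theorem coeff_opU_single (H : S⟦X⟧) (n : ℕ) (nu : YoungDiagram) :
    coeff n (opU H) (Finsupp.single nu 1) =
      ∑ lam ∈ partitionsOf (nu.card + n), Finsupp.single lam (skew H lam nu) := by
  simp [opU]

theorem opD_single (H : S⟦X⟧) (lam : YoungDiagram) :
    opD H (Finsupp.single lam 1) =
      ∑ mu ∈ partitionsLE lam.card, Finsupp.single mu (skew H lam mu) := by
  simp [opD]

theorem sum_single_apply (s : Finset YoungDiagram) (c : YoungDiagram → S) (mu : YoungDiagram)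
    [Decidable (mu ∈ s)] : (∑ ka ∈ s, Finsupp.single ka (c ka)) mu = if mu ∈ s then c mu else 0 := by
  classical
  rw [Finsupp.finsetSum_apply]
  simp [Finsupp.single_apply]

theorem end_sum_single (A : FockEnd S) (s : Finset YoungDiagram) (c : YoungDiagram → S) :
    A (∑ ka ∈ s, Finsupp.single ka (c ka)) = ∑ ka ∈ s, c ka • A (Finsupp.single ka 1) := by
  rw [map_sum]
  refine Finset.sum_congr rfl fun ka _ => ?_
  rw [← map_smul, Finsupp.smul_single, smul_eq_mul, mul_one]

theorem coeff_opU_apply (H : S⟦X⟧) (n : ℕ) (nu lam : YoungDiagram) :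
    coeff n (opU H) (Finsupp.single nu 1) lam =
      if lam.card = nu.card + n then skew H lam nu else 0 := by
  classical
  rw [coeff_opU_single, sum_single_apply]
  simp

theorem opD_apply (H : S⟦X⟧) (lam mu : YoungDiagram) :
    opD H (Finsupp.single lam 1) mu = skew H lam mu := by
  classical
  rw [opD_single, sum_single_apply]
  split_ifs with h
  · rfl
  · rw [skew_eq_zero]
    exact fun hle => h (mem_partitionsLE.mpr (card_le_card hle))

theorem fockEnd_ext {A B : FockEnd S}
    (h : ∀ nu lam, A (Finsupp.single nu 1) lam = B (Finsupp.single nu 1) lam) : A = B := by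
  refine Finsupp.lhom_ext' fun nu => LinearMap.ext_ring ?_
  exact Finsupp.ext fun lam => h nu lam

theorem fockSeries_ext {A B : PowerSeries (FockEnd S)}
    (h : ∀ n nu lam, coeff n A (Finsupp.single nu 1) lam = coeff n B (Finsupp.single nu 1) lam) :
    A = B :=
  PowerSeries.ext fun n => fockEnd_ext fun nu lam => h n nu lam

theorem scalarOp_mul_comm (e : S⟦X⟧) (A : PowerSeries (FockEnd S)) :
    scalarOp e * A = A * scalarOp e := by
  ext1 n
  rw [coeff_mul, coeff_mul, ← Finset.Nat.sum_antidiagonal_swap]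
  refine Finset.sum_congr rfl fun p _ => ?_
  simp only [scalarOp, coeff_map, Prod.fst_swap, Prod.snd_swap]
  exact Algebra.commutes _ _

theorem scalarOp_mul (e e' : S⟦X⟧) : scalarOp (e * e') = scalarOp e * scalarOp e' :=
  map_mul _ _ _

theorem scalarOp_one : scalarOp (1 : S⟦X⟧) = 1 := map_one _

theorem coeff_scalarOp_mul_apply (e : S⟦X⟧) (A : PowerSeries (FockEnd S)) (n : ℕ)
    (v : YoungDiagram →₀ S) (lam : YoungDiagram) : coeff n (scalarOp e * A) v lam =
      ∑ p ∈ antidiagonal n, coeff p.1 e * coeff p.2 A v lam := by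
  rw [coeff_mul, LinearMap.sum_apply, Finsupp.finsetSum_apply]
  refine Finset.sum_congr rfl fun p _ => ?_
  simp [scalarOp, Module.algebraMap_end_apply]

theorem coeff_opU_mul_opU_apply (H H' : S⟦X⟧) (n : ℕ) (nu lam : YoungDiagram) :
    coeff n (opU H * opU H') (Finsupp.single nu 1) lam = if lam.card = nu.card + n then
      ∑ ka ∈ partitionsLE lam.card, skew H lam ka * skew H' ka nu else 0 := by
  classical
  rw [coeff_mul, LinearMap.sum_apply, Finsupp.finsetSum_apply]
  have h : ∀ p ∈ antidiagonal n, (coeff p.1 (opU H) * coeff p.2 (opU H'))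
      (Finsupp.single nu 1) lam = ∑ ka ∈ partitionsOf (nu.card + p.2),
        if lam.card = nu.card + n then skew H lam ka * skew H' ka nu else 0 := by
    intro p hp
    rw [mem_antidiagonal] at hp
    rw [Module.End.mul_apply, coeff_opU_single, end_sum_single, Finsupp.finsetSum_apply]
    refine Finset.sum_congr rfl fun ka hka => ?_
    rw [mem_partitionsOf] at hka
    rw [Finsupp.smul_apply, coeff_opU_apply, smul_eq_mul, mul_ite, mul_zero, mul_comm]
    congr 1
    rw [eq_iff_iff]
    omega
  rw [Finset.sum_congr rfl h]
  split_ifs with hc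
  swap
  · simp
  have hsub : ∑ ka ∈ partitionsLE lam.card, skew H lam ka * skew H' ka nu =
      ∑ ka ∈ (partitionsLE lam.card).filter (fun ka => nu.card ≤ ka.card),
        skew H lam ka * skew H' ka nu := by
    rw [Finset.sum_filter_of_ne]
    intro ka _ hne
    by_contra hlt
    exact hne (by rw [skew_eq_zero (fun hle => hlt (card_le_card hle)), mul_zero])
  rw [hsub, ← Finset.sum_fiberwise_of_maps_to (t := antidiagonal n)
    (g := fun ka : YoungDiagram => (n - (ka.card - nu.card), ka.card - nu.card))]
  · refine Finset.sum_congr rfl fun p hp => Finset.sum_congr ?_ fun _ _ => rfl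
    rw [mem_antidiagonal] at hp
    ext ka
    simp only [mem_partitionsOf, Finset.mem_filter, mem_partitionsLE, Prod.ext_iff]
    omega
  · intro ka hka
    simp only [Finset.mem_filter, mem_partitionsLE] at hka
    rw [mem_antidiagonal]
    simp only
    omega

theorem opD_mul_opD_apply (H H' : S⟦X⟧) (lam nu : YoungDiagram) :
    (opD H' * opD H) (Finsupp.single lam 1) nu =
      ∑ ka ∈ partitionsLE lam.card, skew H lam ka * skew H' ka nu := by
  rw [Module.End.mul_apply, opD_single, end_sum_single, Finsupp.finsetSum_apply]
  refine Finset.sum_congr rfl fun ka _ => ?_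
  rw [Finsupp.smul_apply, opD_apply, smul_eq_mul]

theorem coeff_opD_mul_opU_apply (Ha Hb : S⟦X⟧) (n : ℕ) (nu mu : YoungDiagram) :
    coeff n (C (opD Hb) * opU Ha) (Finsupp.single nu 1) mu =
      ∑ lam ∈ partitionsOf (nu.card + n), skew Ha lam nu * skew Hb lam mu := by
  rw [coeff_C_mul, Module.End.mul_apply, coeff_opU_single, end_sum_single,
    Finsupp.finsetSum_apply]
  refine Finset.sum_congr rfl fun ka _ => ?_
  rw [Finsupp.smul_apply, opD_apply, smul_eq_mul]

theorem coeff_opU_mul_opD_apply (Ha Hb : S⟦X⟧) (n : ℕ) (nu mu : YoungDiagram) :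
    coeff n (opU Ha * C (opD Hb)) (Finsupp.single nu 1) mu =
      ∑ ka ∈ (partitionsLE nu.card).filter (fun ka => mu.card = ka.card + n),
        skew Hb nu ka * skew Ha mu ka := by
  rw [coeff_mul_C, Module.End.mul_apply, opD_single, end_sum_single,
    Finsupp.finsetSum_apply, Finset.sum_filter]
  refine Finset.sum_congr rfl fun ka _ => ?_
  rw [Finsupp.smul_apply, coeff_opU_apply, smul_eq_mul, mul_ite, mul_zero]

/-- The entries of the branching rule. -/
theorem opU_mul_iff {H H' : S⟦X⟧} : opU (H * H') = opU H * opU H' ↔ ∀ lam nu,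
    skew (H * H') lam nu = ∑ ka ∈ partitionsLE lam.card, skew H lam ka * skew H' ka nu := by
  constructor
  · intro h lam nu
    by_cases hle : nu ≤ lam
    · have h1 := congrArg (fun A : PowerSeries (FockEnd S) => coeff (lam.card - nu.card) A (Finsupp.single nu 1) lam) h
      have h2 := card_le_card hle
      simp only [coeff_opU_apply, coeff_opU_mul_opU_apply] at h1
      rwa [if_pos (by omega), if_pos (by omega)] at h1
    · rw [skew_eq_zero hle, Finset.sum_eq_zero]
      intro ka _
      by_cases h1 : ka ≤ lam
      · rw [skew_eq_zero (fun h2 => hle (h2.trans h1)), mul_zero]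
      · rw [skew_eq_zero h1, zero_mul]
  · intro h
    refine fockSeries_ext fun n nu lam => ?_
    rw [coeff_opU_apply, coeff_opU_mul_opU_apply, h]

theorem opD_mul_iff {H H' : S⟦X⟧} : opD (H * H') = opD H' * opD H ↔ ∀ lam nu,
    skew (H * H') lam nu = ∑ ka ∈ partitionsLE lam.card, skew H lam ka * skew H' ka nu := by
  constructor
  · intro h lam nu
    rw [← opD_apply, h, opD_mul_opD_apply]
  · intro h
    refine fockEnd_ext fun lam nu => ?_
    rw [opD_apply, opD_mul_opD_apply, h]

/-- The entries of the skew Cauchy identity. -/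
theorem opD_mul_opU_iff {Ha Hb e : S⟦X⟧} :
    C (opD Hb) * opU Ha = scalarOp e * (opU Ha * C (opD Hb)) ↔ ∀ mu nu n,
      ∑ lam ∈ partitionsOf (nu.card + n), skew Ha lam nu * skew Hb lam mu =
        ∑ p ∈ antidiagonal n, coeff p.1 e *
          ∑ ka ∈ (partitionsLE nu.card).filter (fun ka => mu.card = ka.card + p.2),
            skew Hb nu ka * skew Ha mu ka := by
  constructor
  · intro h mu nu n
    rw [← coeff_opD_mul_opU_apply, h, coeff_scalarOp_mul_apply]
    simp only [coeff_opU_mul_opD_apply]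
  · intro h
    refine fockSeries_ext fun n nu mu => ?_
    rw [coeff_opD_mul_opU_apply, h, coeff_scalarOp_mul_apply]
    simp only [coeff_opU_mul_opD_apply]

theorem opU_one : opU (1 : S⟦X⟧) = 1 := by
  classical
  refine fockSeries_ext fun n nu lam => ?_
  rw [coeff_opU_apply, skew_one, coeff_one]
  by_cases h : lam = nu
  · subst h
    by_cases hn : n = 0 <;> simp [hn]
  · by_cases hn : n = 0 <;> simp [hn, h]

theorem opD_one : opD (1 : S⟦X⟧) = 1 := by
  classical
  refine fockEnd_ext fun nu lam => ?_
  rw [opD_apply, skew_one, Module.End.one_apply, Finsupp.single_apply]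

end Operators

/-! ### Branching and skew Cauchy: from one letter to arbitrary series. -/

section Multiplicativity

open PowerSeries
open Finset.HasAntidiagonal (antidiagonal mem_antidiagonal)

variable {S : Type*} [CommRing S]

/-- The generating function of the complete functions in finitely many variables. -/
def geomProd (s : Multiset S) : S⟦X⟧ := (s.map geom).prod

theorem geomProd_cons (y : S) (s : Multiset S) : geomProd (y ::ₘ s) = geomProd s * geom y := by
  rw [geomProd, Multiset.map_cons, Multiset.prod_cons, mul_comm, geomProd]

theorem geomProd_zero : geomProd (0 : Multiset S) = 1 := by simp [geomProd]

theorem constantCoeff_geomProd (s : Multiset S) : constantCoeff (geomProd s) = 1 := by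
  induction s using Multiset.induction_on with
  | empty => simp [geomProd]
  | cons y s ih => rw [geomProd_cons, map_mul, ih, constantCoeff_geom, one_mul]

theorem opU_mul_geom {H : S⟦X⟧} (hH : constantCoeff H = 1) (y : S) :
    opU (H * geom y) = opU H * opU (geom y) :=
  opU_mul_iff.mpr fun lam nu => skew_mul_geom' hH y lam nu

theorem opD_mul_geom {H : S⟦X⟧} (hH : constantCoeff H = 1) (y : S) :
    opD (H * geom y) = opD (geom y) * opD H :=
  opD_mul_iff.mpr fun lam nu => skew_mul_geom' hH y lam nu

theorem opU_mul_geomProd {H : S⟦X⟧} (hH : constantCoeff H = 1) (s : Multiset S) :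
    opU (H * geomProd s) = opU H * opU (geomProd s) := by
  induction s using Multiset.induction_on with
  | empty => rw [geomProd_zero, mul_one, opU_one, mul_one]
  | cons y s ih =>
    rw [geomProd_cons, ← mul_assoc, opU_mul_geom (by rw [map_mul, hH, constantCoeff_geomProd,
      one_mul]), ih, opU_mul_geom (constantCoeff_geomProd s), mul_assoc]

/-- The commutation relation of the operators of two alphabets. -/
def Commutation (Ha Hb e : S⟦X⟧) : Prop :=
  C (opD Hb) * opU Ha = scalarOp e * (opU Ha * C (opD Hb))

theorem Commutation.mul_left {Ha Ha' Hb e e' : S⟦X⟧} (h : Commutation Ha Hb e)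
    (h' : Commutation Ha' Hb e') (hU : opU (Ha * Ha') = opU Ha * opU Ha') :
    Commutation (Ha * Ha') Hb (e * e') := by
  rw [Commutation] at *
  rw [hU, ← mul_assoc, h, mul_assoc, mul_assoc, h', ← mul_assoc (opU Ha), ← scalarOp_mul_comm,
    scalarOp_mul]
  simp only [mul_assoc]

theorem Commutation.mul_right {Ha Hb Hb' e e' : S⟦X⟧} (h : Commutation Ha Hb e)
    (h' : Commutation Ha Hb' e') (hD : opD (Hb * Hb') = opD Hb' * opD Hb) :
    Commutation Ha (Hb * Hb') (e * e') := by
  rw [Commutation] at *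
  rw [hD, map_mul, mul_assoc, h, ← mul_assoc, ← scalarOp_mul_comm, mul_assoc, ← mul_assoc _ (opU Ha),
    h', scalarOp_mul]
  simp only [mul_assoc]

theorem commutation_geom (x y : S) : Commutation (geom x) (geom y) (geom (x * y)) :=
  opD_mul_opU_iff.mpr fun mu nu n => skew_cauchy_geom x y mu nu n

theorem commutation_one_left (Hb : S⟦X⟧) : Commutation 1 Hb 1 := by
  rw [Commutation, opU_one, scalarOp_one, mul_one, one_mul, one_mul]

theorem commutation_one_right (Ha : S⟦X⟧) : Commutation Ha 1 1 := by
  rw [Commutation, opD_one, scalarOp_one, map_one, mul_one, one_mul]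

/-- The power sums of a finite alphabet. -/
def powerSeqSum (s : Multiset S) (n : ℕ) : S := (s.map fun y => powerSeq y n).sum

theorem isNewton_geomProd (s : Multiset S) : IsNewton (powerSeqSum s) (geomProd s) := by
  induction s using Multiset.induction_on with
  | empty =>
    rw [geomProd_zero]
    exact isNewton_one
  | cons y s ih =>
    rw [geomProd_cons]
    convert ih.mul (isNewton_geom y) using 1
    ext n
    simp [powerSeqSum, add_comm]

/-- Letters are adjoined one at a time on each side. Each pair `x, y` contributes `1/(1 - xyX)`, so
the power sums of the scalar are the products of those of the two alphabets. -/
theorem exists_commutation_geomProd (s t : Multiset S) : ∃ e : S⟦X⟧,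
    Commutation (geomProd s) (geomProd t) e ∧
      IsNewton (fun n => powerSeqSum s n * powerSeqSum t n) e := by
  have key : ∀ x : S, ∃ e : S⟦X⟧, Commutation (geom x) (geomProd t) e ∧
      IsNewton (fun n => powerSeq x n * powerSeqSum t n) e := by
    intro x
    induction t using Multiset.induction_on with
    | empty =>
      refine ⟨1, by rw [geomProd_zero]; exact commutation_one_right _, ?_⟩
      convert isNewton_one (S := S)
      simp [powerSeqSum]
    | cons y t ih =>
      obtain ⟨e, h1, h2⟩ := ih
      refine ⟨e * geom (x * y), ?_, ?_⟩
      · rw [geomProd_cons]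
        exact h1.mul_right (commutation_geom x y) (opD_mul_geom (constantCoeff_geomProd t) y)
      · convert h2.mul (isNewton_geom (x * y)) using 1
        ext n
        simp only [powerSeqSum, Multiset.map_cons, Multiset.sum_cons, Pi.add_apply, powerSeq]
        split_ifs
        · ring
        · rw [mul_pow]
          ring
  induction s using Multiset.induction_on with
  | empty =>
    refine ⟨1, by rw [geomProd_zero]; exact commutation_one_left _, ?_⟩
    convert isNewton_one (S := S)
    simp [powerSeqSum]
  | cons x s ih =>
    obtain ⟨e, h1, h2⟩ := ih
    obtain ⟨e', h1', h2'⟩ := key x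
    refine ⟨e * e', ?_, ?_⟩
    · rw [geomProd_cons]
      exact h1.mul_left h1' (opU_mul_geom (constantCoeff_geomProd s) x)
    · convert h2.mul h2' using 1
      ext n
      simp only [powerSeqSum, Multiset.map_cons, Multiset.sum_cons, Pi.add_apply]
      ring

section AlgClosed

variable {k : Type*} [Field k]

theorem geom_mul_one_sub (x : k) : geom x * (1 - C x * X) = 1 := by
  have h := geom_eq x
  linear_combination h

/-- Peel off a root `r`, nonzero because of the constant term: `X - r = -r (1 - r⁻¹X)`. The letters
of the alphabet are the inverse roots. -/
theorem exists_mul_geomProd_eq_one [IsAlgClosed k] (n : ℕ) : ∀ Q : Polynomial k, Q.natDegree = n →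
    Q.coeff 0 = 1 → ∃ s : Multiset k, (Q : k⟦X⟧) * geomProd s = 1 := by
  induction n with
  | zero =>
    intro Q hn h0
    refine ⟨0, ?_⟩
    rw [Polynomial.eq_C_of_natDegree_eq_zero hn, h0, geomProd_zero]
    simp
  | succ n ih =>
    intro Q hn h0
    obtain ⟨r, hr⟩ := IsAlgClosed.exists_root Q (by
      rw [Polynomial.degree_eq_natDegree (by rintro rfl; simp at h0), hn]
      exact_mod_cast Nat.succ_ne_zero n)
    have hr0 : r ≠ 0 := by
      rintro rfl
      rw [Polynomial.IsRoot, ← Polynomial.coeff_zero_eq_eval_zero, h0] at hr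
      exact one_ne_zero hr
    obtain ⟨Q', hQ'⟩ := Polynomial.dvd_iff_isRoot.mpr hr
    set R : Polynomial k := Polynomial.C (-r) * Q' with hR
    have hQR : Q = R * (1 - Polynomial.C r⁻¹ * Polynomial.X) := by
      rw [hQ', hR]
      have : Polynomial.C r * Polynomial.C r⁻¹ = (1 : Polynomial k) := by
        rw [← Polynomial.C_mul, mul_inv_cancel₀ hr0, Polynomial.C_1]
      rw [Polynomial.C_neg]
      linear_combination (-(Q' * Polynomial.X)) * this
    have hR0 : R.coeff 0 = 1 := by
      have := h0
      rw [hQR, Polynomial.mul_coeff_zero] at this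
      simpa using this
    have hRn : R.natDegree = n := by
      have hQ0 : Q' ≠ 0 := by
        rintro rfl
        simp [hR] at hR0
      have h1 : Q.natDegree = 1 + Q'.natDegree := by
        rw [hQ', Polynomial.natDegree_mul (Polynomial.X_sub_C_ne_zero r) hQ0,
          Polynomial.natDegree_X_sub_C]
      rw [hR, Polynomial.natDegree_C_mul (neg_ne_zero.mpr hr0)]
      omega
    obtain ⟨s, hs⟩ := ih R hRn hR0
    refine ⟨r⁻¹ ::ₘ s, ?_⟩
    have hcoe : (Q : k⟦X⟧) = (R : k⟦X⟧) * (1 - C r⁻¹ * X) := by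
      rw [hQR]
      simp
    rw [geomProd_cons, hcoe]
    linear_combination hs + (R : k⟦X⟧) * geomProd s * geom_mul_one_sub r⁻¹

/-- Truncate `1/H` to a polynomial and factor it into linear terms; the inverse of this polynomial
agrees with `H` up to order `M`. -/
theorem exists_coeff_eq_geomProd [IsAlgClosed k] {H : k⟦X⟧} (hH : constantCoeff H = 1) (M : ℕ) :
    ∃ s : Multiset k, ∀ n ≤ M, coeff n H = coeff n (geomProd s) := by
  have hne : constantCoeff H ≠ 0 := by
    rw [hH]
    exact one_ne_zero
  set Q := trunc (M + 1) H⁻¹ with hQ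
  have hQ0 : Q.coeff 0 = 1 := by
    rw [hQ, coeff_trunc, if_pos (Nat.succ_pos M), coeff_zero_eq_constantCoeff_apply,
      constantCoeff_inv, hH, inv_one]
  obtain ⟨s, hs⟩ := exists_mul_geomProd_eq_one _ Q rfl hQ0
  refine ⟨s, ?_⟩
  have h1 : X ^ (M + 1) ∣ H⁻¹ - (Q : k⟦X⟧) := by
    rw [X_pow_dvd_iff]
    intro m hm
    rw [map_sub, Polynomial.coeff_coe, hQ, coeff_trunc, if_pos hm, sub_self]
  have h2 : X ^ (M + 1) ∣ H - geomProd s := by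
    have : H - geomProd s = (H⁻¹ - (Q : k⟦X⟧)) * (-(H * geomProd s)) := by
      have h3 := PowerSeries.mul_inv_cancel H hne
      linear_combination geomProd s * h3 - H * hs
    rw [this]
    exact h1.mul_right _
  intro n hn
  have := X_pow_dvd_iff.mp h2 n (by omega)
  rwa [map_sub, sub_eq_zero] at this

theorem coeff_mul_congr {R : Type*} [CommRing R] {F F' G G' : R⟦X⟧} {M : ℕ}
    (h : ∀ n ≤ M, coeff n F = coeff n F')
    (h' : ∀ n ≤ M, coeff n G = coeff n G') : ∀ n ≤ M, coeff n (F * G) = coeff n (F' * G') := by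
  intro n hn
  rw [coeff_mul, coeff_mul]
  refine Finset.sum_congr rfl fun p hp => ?_
  rw [mem_antidiagonal] at hp
  rw [h _ (by omega), h' _ (by omega)]

theorem skew_mul_of_isAlgClosed [IsAlgClosed k] {H H' : k⟦X⟧} (hH : constantCoeff H = 1)
    (hH' : constantCoeff H' = 1) (lam nu : YoungDiagram) :
    skew (H * H') lam nu = ∑ ka ∈ partitionsLE lam.card, skew H lam ka * skew H' ka nu := by
  obtain ⟨s, hs⟩ := exists_coeff_eq_geomProd hH' (3 * (lam.card + nu.card))
  rw [skew_congr (coeff_mul_congr (fun _ _ => rfl) hs) (by omega),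
    opU_mul_iff.mp (opU_mul_geomProd hH s)]
  refine Finset.sum_congr rfl fun ka hka => ?_
  rw [mem_partitionsLE] at hka
  rw [skew_congr (mu := nu) hs (by omega)]

theorem skew_cauchy_of_isAlgClosed [IsAlgClosed k] [CharZero k] {Ha Hb e : k⟦X⟧} {pa pb : ℕ → k}
    (ha : IsNewton pa Ha) (hb : IsNewton pb Hb) (he : IsNewton (fun n => pa n * pb n) e)
    (mu nu : YoungDiagram) (n : ℕ) :
    ∑ lam ∈ partitionsOf (nu.card + n), skew Ha lam nu * skew Hb lam mu =
      ∑ p ∈ antidiagonal n, coeff p.1 e *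
        ∑ ka ∈ (partitionsLE nu.card).filter (fun ka => mu.card = ka.card + p.2),
          skew Hb nu ka * skew Ha mu ka := by
  set M := 3 * (nu.card + mu.card + n) with hM
  obtain ⟨s, hs⟩ := exists_coeff_eq_geomProd ha.1 M
  obtain ⟨t, ht⟩ := exists_coeff_eq_geomProd hb.1 M
  obtain ⟨e', h1, h2⟩ := exists_commutation_geomProd s t
  have hps := ha.powerSum_congr (isNewton_geomProd s) hs
  have hpt := hb.powerSum_congr (isNewton_geomProd t) ht
  -- Agreement of the `hₙ` up to `M` gives agreement of the power sums, hence of their products,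
  -- hence of the scalar series.
  have hee := he.coeff_congr h2 (M := M) fun i hi => by rw [hps i hi, hpt i hi]
  have hmain := opD_mul_opU_iff.mp h1 mu nu n
  rw [Finset.sum_congr rfl (g := fun lam => skew (geomProd s) lam nu * skew (geomProd t) lam mu),
    hmain]
  · refine Finset.sum_congr rfl fun p hp => ?_
    rw [mem_antidiagonal] at hp
    rw [hee p.1 (by omega)]
    congr 1
    refine Finset.sum_congr rfl fun ka hka => ?_
    rw [Finset.mem_filter, mem_partitionsLE] at hka
    rw [skew_congr hs (lam := mu) (by omega), skew_congr ht (lam := nu) (by omega)]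
  · intro lam hlam
    rw [mem_partitionsOf] at hlam
    rw [skew_congr hs (lam := lam) (by omega), skew_congr ht (lam := lam) (by omega)]

end AlgClosed

theorem constantCoeff_map_eq_one {S' : Type*} [CommRing S'] (φ : S →+* S') {H : S⟦X⟧}
    (hH : constantCoeff H = 1) : constantCoeff (PowerSeries.map φ H) = 1 := by
  rw [← coeff_zero_eq_constantCoeff_apply, coeff_map, coeff_zero_eq_constantCoeff_apply, hH,
    map_one]

section Domain

variable [IsDomain S]

/-- An embedding of a domain into an algebraically closed field. -/
def toClosure (S : Type*) [CommRing S] [IsDomain S] :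
    S →+* AlgebraicClosure (FractionRing S) :=
  (algebraMap (FractionRing S) (AlgebraicClosure (FractionRing S))).comp
    (algebraMap S (FractionRing S))

theorem toClosure_injective : Function.Injective (toClosure S) :=
  (algebraMap (FractionRing S) (AlgebraicClosure (FractionRing S))).injective.comp
    (IsFractionRing.injective S (FractionRing S))

/-- An identity between determinants in the coefficients can be checked after embedding the domain
in an algebraically closed field. -/
theorem skew_mul {H H' : S⟦X⟧} (hH : constantCoeff H = 1) (hH' : constantCoeff H' = 1)
    (lam nu : YoungDiagram) :
    skew (H * H') lam nu = ∑ ka ∈ partitionsLE lam.card, skew H lam ka * skew H' ka nu := by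
  apply toClosure_injective
  rw [map_skew, map_mul, skew_mul_of_isAlgClosed (constantCoeff_map_eq_one _ hH)
    (constantCoeff_map_eq_one _ hH'), map_sum]
  refine Finset.sum_congr rfl fun ka _ => ?_
  rw [map_mul, map_skew, map_skew]

theorem opU_mul {H H' : S⟦X⟧} (hH : constantCoeff H = 1) (hH' : constantCoeff H' = 1) :
    opU (H * H') = opU H * opU H' :=
  opU_mul_iff.mpr (skew_mul hH hH')

theorem opD_mul {H H' : S⟦X⟧} (hH : constantCoeff H = 1) (hH' : constantCoeff H' = 1) :
    opD (H * H') = opD H' * opD H :=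
  opD_mul_iff.mpr (skew_mul hH hH')

/-- The skew Cauchy identity. -/
theorem commutation [CharZero S] {Ha Hb e : S⟦X⟧} {pa pb : ℕ → S}
    (ha : IsNewton pa Ha) (hb : IsNewton pb Hb) (he : IsNewton (fun n => pa n * pb n) e) :
    Commutation Ha Hb e := by
  have : CharZero (AlgebraicClosure (FractionRing S)) :=
    charZero_of_injective_ringHom (toClosure_injective (S := S))
  refine opD_mul_opU_iff.mpr fun mu nu n => ?_
  apply toClosure_injective
  have he' : IsNewton (fun n => toClosure S (pa n) * toClosure S (pb n))
      (PowerSeries.map (toClosure S) e) := by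
    simpa only [map_mul] using he.map (toClosure S)
  have h := skew_cauchy_of_isAlgClosed (ha.map (toClosure S)) (hb.map (toClosure S)) he' mu nu n
  simpa only [map_sum, map_mul, map_skew, coeff_map] using h

end Domain

end Multiplicativity

/-! ### Reordering the product, and the recursion from cyclicity of the trace. -/

section Trace

open PowerSeries
open Finset.HasAntidiagonal (antidiagonal mem_antidiagonal)

variable {S : Type*} [CommRing S]

theorem mul_mul_mul_of_central {M : Type*} [Monoid M] {x y a d A D : M} (hx : ∀ z, x * z = z * x)
    (hy : ∀ z, y * z = z * y) (h : d * A = x * (A * d)) :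
    a * d * (y * (A * D)) = x * y * (a * A * (d * D)) := by
  have h1 : a * d * (y * (A * D)) = y * (a * (d * A) * D) := by
    rw [hy (A * D), hy (a * (d * A) * D)]
    simp only [mul_assoc]
  rw [h1, h, hx (A * d), hx y, mul_assoc y x, hx (a * A * (d * D))]
  simp only [mul_assoc]
  rw [hx D]

theorem IsNewton.unique' [IsDomain S] [CharZero S] {q q' : ℕ → S} {H H' : S⟦X⟧}
    (h : IsNewton q H) (h' : IsNewton q' H') (hq : ∀ n, q n = q' n) : H = H' := by
  obtain rfl : q = q' := funext hq
  exact h.unique h'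

/-- By induction the tail has the form `e · U D`. Only the first lowering operator still has to
cross the raising operator of the tail, which adds the pairs `k > l` with `l` the first index. -/
theorem prod_operators [IsDomain S] [CharZero S] [Algebra ℚ S] :
    ∀ (N : ℕ) {Ha Hb : Fin N → S⟦X⟧} {pa pb : Fin N → ℕ → S},
      (∀ k, IsNewton (pa k) (Ha k)) → (∀ k, IsNewton (pb k) (Hb k)) →
      ∃ e : S⟦X⟧, IsNewton (fun n => ∑ k, ∑ l with l < k, pa k n * pb l n) e ∧
        (List.ofFn fun k => opU (Ha k) * C (opD (Hb k))).prod =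
          scalarOp e * (opU (∏ k, Ha k) * C (opD (∏ k, Hb k))) := by
  intro N
  induction N with
  | zero =>
    intro Ha Hb pa pb ha hb
    refine ⟨1, by simpa using! isNewton_one, ?_⟩
    simp [scalarOp_one, opU_one, opD_one]
  | succ N ih =>
    intro Ha Hb pa pb ha hb
    obtain ⟨e, he, hprod⟩ := ih (fun k => ha k.succ) (fun k => hb k.succ)
    have hA := IsNewton.prod (s := Finset.univ) fun k _ => ha (Fin.succ k)
    have hB := IsNewton.prod (s := Finset.univ) fun k _ => hb (Fin.succ k)
    have he' := isNewton_newtonExp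
      (q := fun n => (∑ k : Fin N, pa k.succ) n * pb 0 n) (by simp [(hb 0).zero_apply])
    have hcomm := commutation hA (hb 0) he'
    refine ⟨newtonExp (fun n => (∑ k : Fin N, pa k.succ) n * pb 0 n) * e, ?_, ?_⟩
    · convert he'.mul he using 1
      ext n
      simp [Finset.sum_filter, Fin.sum_univ_succ, Finset.sum_add_distrib, Finset.sum_mul]
    · rw [List.ofFn_succ, List.prod_cons, hprod, Fin.prod_univ_succ, Fin.prod_univ_succ,
        opU_mul (ha 0).1 hA.1, mul_comm (Hb 0), opD_mul hB.1 (hb 0).1, map_mul, scalarOp_mul]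
      exact mul_mul_mul_of_central (scalarOp_mul_comm _) (scalarOp_mul_comm _) hcomm

theorem skew_self {H : S⟦X⟧} (hH : constantCoeff H = 1) (lam : YoungDiagram) :
    skew H lam lam = 1 := by
  rw [skew, skewDet, Matrix.det_of_isUpperTriangular]
  · refine Finset.prod_eq_one fun i _ => ?_
    rw [Matrix.of_apply, sub_self, zero_sub, neg_add_cancel]
    simp [coeffInt, hH]
  · intro i j hij
    have hij' : (j : ℕ) < i := hij
    rw [Matrix.of_apply, coeffInt_of_neg]
    have := lam.rowLen_anti j i hij'.le
    omega

/-- The trace over the partitions of `m`. -/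
def traceAt (m : ℕ) (A : FockEnd S) : S :=
  ∑ lam ∈ partitionsOf m, A (Finsupp.single lam 1) lam

/-- A closed path from size `m` down and up by `n` boxes, started at its lowest point instead,
begins at size `m - n`. -/
theorem traceAt_cyclic (Ha Hb : S⟦X⟧) (m n : ℕ) :
    traceAt m (coeff n (opU Ha * C (opD Hb))) =
      if n ≤ m then traceAt (m - n) (coeff n (C (opD Hb) * opU Ha)) else 0 := by
  simp only [traceAt, coeff_opD_mul_opU_apply, coeff_opU_mul_opD_apply]
  split_ifs with h
  · rw [Finset.sum_congr rfl (g := fun lam => ∑ ka ∈ partitionsOf (m - n),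
      skew Hb lam ka * skew Ha lam ka), Finset.sum_comm]
    · refine Finset.sum_congr rfl fun ka hka => ?_
      rw [mem_partitionsOf] at hka
      rw [show ka.card + n = m by omega]
      exact Finset.sum_congr rfl fun _ _ => mul_comm _ _
    · intro lam hlam
      rw [mem_partitionsOf] at hlam
      refine Finset.sum_congr ?_ fun _ _ => rfl
      ext ka
      simp only [Finset.mem_filter, mem_partitionsLE, mem_partitionsOf]
      omega
  · refine Finset.sum_eq_zero fun lam hlam => ?_
    rw [mem_partitionsOf] at hlam
    rw [Finset.filter_false_of_mem, Finset.sum_empty]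
    intro ka _
    omega

/-- Adding no boxes forces the intermediate diagram to be `λ` itself, and the diagonal entries are
`1`. -/
theorem traceAt_zero {Ha Hb : S⟦X⟧} (ha : constantCoeff Ha = 1) (hb : constantCoeff Hb = 1)
    (m : ℕ) : traceAt m (coeff 0 (opU Ha * C (opD Hb))) = ((partitionsOf m).card : S) := by
  rw [traceAt, Finset.card_eq_sum_ones, Nat.cast_sum, Nat.cast_one]
  refine Finset.sum_congr rfl fun lam _ => ?_
  rw [coeff_opU_mul_opD_apply, Finset.sum_eq_single lam]
  · rw [skew_self ha, skew_self hb, mul_one]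
  · intro ka hka hne
    rw [Finset.mem_filter] at hka
    rw [skew_eq_zero, zero_mul]
    intro hle
    exact hne (YoungDiagram.ext (Finset.eq_of_subset_of_card_le
      (YoungDiagram.cells_subset_iff.mpr hle) hka.2.le))
  · intro h
    exact absurd (by simp) h

theorem traceAt_scalarOp_mul (e : S⟦X⟧) (A : PowerSeries (FockEnd S)) (m n : ℕ) :
    traceAt m (coeff n (scalarOp e * A)) =
      ∑ p ∈ antidiagonal n, coeff p.1 e * traceAt m (coeff p.2 A) := by
  simp only [traceAt, coeff_scalarOp_mul_apply, Finset.mul_sum]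
  exact Finset.sum_comm

theorem traceAt_rec {Ha Hb e : S⟦X⟧} (h : Commutation Ha Hb e) (m n : ℕ) :
    traceAt m (coeff n (opU Ha * C (opD Hb))) = if n ≤ m then
      ∑ p ∈ antidiagonal n, coeff p.1 e * traceAt (m - n) (coeff p.2 (opU Ha * C (opD Hb)))
      else 0 := by
  rw [traceAt_cyclic, h, traceAt_scalarOp_mul]

end Trace

/-! ### The trace generating function, with the variable `X` for `t` in the coefficients. -/

section Gather

open Finset.HasAntidiagonal (antidiagonal mem_antidiagonal)

variable {σ K : Type*} [Field K]

instance [CharZero K] : CharZero (MvPowerSeries σ K) := algebraRat.charZero _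

instance [CharZero K] : CharZero (MvPowerSeries σ (PowerSeries K)) := algebraRat.charZero _

instance : IsDomain (MvPowerSeries σ K) := NoZeroDivisors.to_isDomain _

instance : IsDomain (MvPowerSeries σ (PowerSeries K)) := NoZeroDivisors.to_isDomain _

/-- By uniqueness of Newton series `R(z) = (E R)(τz)`, so `P R` obeys the recursion of `Z`. Since
`E` has constant term `1`, the `n`-th equation expresses `(1 - τⁿ) Zₙ` through earlier values, and
the factor cancels for `n > 0`. -/
theorem eq_mul_coeff_of_rec {A : Type*} [CommRing A] [IsDomain A] [CharZero A]
    {E R : PowerSeries A} {q r : ℕ → A} {τ P : A} {Z : ℕ → A}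
    (hτ : ∀ n, 0 < n → 1 - τ ^ n ≠ 0) (hE : IsNewton q E) (hR : IsNewton r R)
    (hqr : ∀ n, τ ^ n * (q n + r n) = r n) (hZ0 : Z 0 = P)
    (hZ : ∀ n, Z n = τ ^ n * ∑ p ∈ antidiagonal n, PowerSeries.coeff p.1 E * Z p.2) (n : ℕ) :
    Z n = P * PowerSeries.coeff n R := by
  have hRE : PowerSeries.rescale τ (E * R) = R :=
    ((hE.mul hR).rescale τ).unique' hR hqr
  have hRrec : ∀ n, PowerSeries.coeff n R = τ ^ n * ∑ p ∈ antidiagonal n,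
      PowerSeries.coeff p.1 E * PowerSeries.coeff p.2 R := by
    intro n
    conv_lhs => rw [← hRE]
    rw [PowerSeries.coeff_rescale, PowerSeries.coeff_mul]
  induction n using Nat.strong_induction_on with
  | _ n ih =>
    rcases Nat.eq_zero_or_pos n with rfl | hn
    · rw [PowerSeries.coeff_zero_eq_constantCoeff_apply, hR.1, mul_one, hZ0]
    · have hsplit : ∀ G : ℕ → A, ∑ p ∈ antidiagonal n, PowerSeries.coeff p.1 E * G p.2 =
          ∑ i ∈ Finset.range n, PowerSeries.coeff (i + 1) E * G (n - (i + 1)) + G n := by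
        intro G
        rw [Finset.Nat.sum_antidiagonal_eq_sum_range_succ_mk, Finset.sum_range_succ']
        simp [hE.1]
      have h1 := hZ n
      have h2 := hRrec n
      rw [hsplit] at h1
      rw [hsplit fun i => PowerSeries.coeff i R] at h2
      apply mul_left_cancel₀ (hτ n hn)
      have h3 : ∑ i ∈ Finset.range n, PowerSeries.coeff (i + 1) E * Z (n - (i + 1)) =
          P * ∑ i ∈ Finset.range n,
            PowerSeries.coeff (i + 1) E * PowerSeries.coeff (n - (i + 1)) R := by
        rw [Finset.mul_sum]
        refine Finset.sum_congr rfl fun i hi => ?_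
        rw [ih _ (by rw [Finset.mem_range] at hi; omega)]
        ring
      linear_combination h1 - P * h2 + τ ^ n * h3

/-- The inclusion of series without `X`. -/
def incl : MvPowerSeries σ K →+* MvPowerSeries σ (PowerSeries K) :=
  MvPowerSeries.map (PowerSeries.C (R := K))

/-- The series `∑ cₘ Xᵐ`. -/
def gather (c : ℕ → MvPowerSeries σ K) : MvPowerSeries σ (PowerSeries K) :=
  fun e => PowerSeries.mk fun m => MvPowerSeries.coeff e (c m)

theorem coeff_gather (c : ℕ → MvPowerSeries σ K) (e : σ →₀ ℕ) :
    MvPowerSeries.coeff e (gather c) = PowerSeries.mk fun m => MvPowerSeries.coeff e (c m) := rfl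

theorem gather_mul (s : MvPowerSeries σ K) (c : ℕ → MvPowerSeries σ K) :
    gather (fun m => s * c m) = incl s * gather c := by
  classical
  ext e m
  rw [coeff_gather, PowerSeries.coeff_mk, MvPowerSeries.coeff_mul, MvPowerSeries.coeff_mul,
    map_sum]
  refine Finset.sum_congr rfl fun p _ => ?_
  rw [coeff_gather, incl, MvPowerSeries.coeff_map, PowerSeries.coeff_C_mul, PowerSeries.coeff_mk]

theorem gather_sum {ι : Type*} (s : Finset ι) (c : ι → ℕ → MvPowerSeries σ K) :
    gather (fun m => ∑ i ∈ s, c i m) = ∑ i ∈ s, gather (c i) := by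
  ext e m
  rw [coeff_gather, map_sum, map_sum, PowerSeries.coeff_mk, map_sum]
  simp only [coeff_gather, PowerSeries.coeff_mk]

theorem gather_shift (n : ℕ) (c : ℕ → MvPowerSeries σ K) :
    gather (fun m => if n ≤ m then c (m - n) else 0) =
      MvPowerSeries.C (PowerSeries.X ^ n) * gather c := by
  ext e m
  rw [MvPowerSeries.coeff_C_mul, coeff_gather, coeff_gather, PowerSeries.coeff_mk,
    PowerSeries.coeff_X_pow_mul', PowerSeries.coeff_mk]
  split_ifs <;> simp

/-- The generating function of the numbers of partitions. -/
def partitionSeries (K : Type*) [Field K] : PowerSeries K :=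
  PowerSeries.mk fun m => ((partitionsOf m).card : K)

/-- The recursion for the traces of a single `U D`, solved with `τ = X`. The power sums of `R` come
from `Xⁿ (1 + Xⁿ/(1 - Xⁿ)) = Xⁿ/(1 - Xⁿ)`. -/
theorem gather_trace_eq [CharZero K] {Ha Hb : PowerSeries (MvPowerSeries σ K)}
    {pa pb : ℕ → MvPowerSeries σ K} (ha : IsNewton pa Ha) (hb : IsNewton pb Hb)
    {R : PowerSeries (MvPowerSeries σ (PowerSeries K))}
    (hR : IsNewton (fun n => MvPowerSeries.C (PowerSeries.X ^ n * (1 - PowerSeries.X ^ n)⁻¹) *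
      incl (pa n * pb n)) R) (n : ℕ) :
    gather (fun m => traceAt m (PowerSeries.coeff n (opU Ha * PowerSeries.C (opD Hb)))) =
      MvPowerSeries.C (partitionSeries K) * PowerSeries.coeff n R := by
  have he := isNewton_newtonExp (q := fun n => pa n * pb n) (by simp [ha.zero_apply])
  generalize newtonExp (fun n => pa n * pb n) = e at he
  have hc := commutation ha hb he
  refine eq_mul_coeff_of_rec (E := PowerSeries.map incl e) (R := R)
    (τ := MvPowerSeries.C PowerSeries.X) (Z := fun n => gather fun m =>
      traceAt m (PowerSeries.coeff n (opU Ha * PowerSeries.C (opD Hb)))) ?_ (he.map incl) hR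
    ?_ ?_ ?_ n
  · intro n hn h
    have := congrArg (fun f => PowerSeries.constantCoeff (MvPowerSeries.constantCoeff f)) h
    simp [hn.ne'] at this
  · intro n
    rcases Nat.eq_zero_or_pos n with rfl | hn
    · simp [ha.zero_apply]
    · have h1 : (PowerSeries.X ^ n * (1 - PowerSeries.X ^ n)⁻¹ : PowerSeries K) =
          PowerSeries.X ^ n * (1 + PowerSeries.X ^ n * (1 - PowerSeries.X ^ n)⁻¹) := by
        have h2 : (1 - PowerSeries.X ^ n : PowerSeries K) * (1 - PowerSeries.X ^ n)⁻¹ = 1 :=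
          PowerSeries.mul_inv_cancel _ (by simp [hn.ne'])
        linear_combination PowerSeries.X ^ n * h2
      conv_rhs => rw [h1]
      rw [map_mul _ _ (1 + _), map_add, map_one, ← map_pow]
      ring
  · simp only [traceAt_zero ha.1 hb.1]
    classical
    ext d m
    rw [coeff_gather, PowerSeries.coeff_mk, MvPowerSeries.coeff_C, ← map_natCast
      (MvPowerSeries.C (σ := σ) (R := K)), MvPowerSeries.coeff_C]
    split_ifs <;> simp [partitionSeries]
  · intro n
    conv_lhs => enter [1, m]; rw [traceAt_rec hc]
    rw [gather_shift n fun m => ∑ p ∈ antidiagonal n, PowerSeries.coeff p.1 e *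
      traceAt m (PowerSeries.coeff p.2 (opU Ha * PowerSeries.C (opD Hb))), gather_sum, map_pow]
    simp only [gather_mul, PowerSeries.coeff_map]

/-- The generating function of the traces of a product of operators. -/
theorem gather_trace_prod [CharZero K] {N : ℕ} {Ha Hb : Fin N → PowerSeries (MvPowerSeries σ K)}
    {pa pb : Fin N → ℕ → MvPowerSeries σ K} (ha : ∀ k, IsNewton (pa k) (Ha k))
    (hb : ∀ k, IsNewton (pb k) (Hb k)) {R : PowerSeries (MvPowerSeries σ (PowerSeries K))}
    (hR : IsNewton (fun n => incl (∑ k, ∑ l with l < k, pa k n * pb l n) +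
      MvPowerSeries.C (PowerSeries.X ^ n * (1 - PowerSeries.X ^ n)⁻¹) *
      incl ((∑ k, pa k n) * ∑ l, pb l n)) R) (n : ℕ) :
    gather (fun m => traceAt m (PowerSeries.coeff n
      (List.ofFn fun k => opU (Ha k) * PowerSeries.C (opD (Hb k))).prod)) =
      MvPowerSeries.C (partitionSeries K) * PowerSeries.coeff n R := by
  obtain ⟨e, he, hprod⟩ := prod_operators N ha hb
  have hA := IsNewton.prod (s := Finset.univ) fun k _ => ha k
  have hB := IsNewton.prod (s := Finset.univ) fun k _ => hb k
  have hR' := isNewton_newtonExp (q := fun n =>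
    MvPowerSeries.C (PowerSeries.X ^ n * (1 - PowerSeries.X ^ n)⁻¹) *
      incl ((∑ k, pa k) n * (∑ l, pb l) n)) (by simp [fun k => (ha k).zero_apply])
  generalize newtonExp (fun n => _ * incl ((∑ k, pa k) n * (∑ l, pb l) n)) = R' at hR'
  have hRe : R = PowerSeries.map incl e * R' := by
    have h1 := he.map (incl (σ := σ) (K := K))
    have h2 := h1.mul hR'
    refine IsNewton.unique' hR h2 fun n => ?_
    simp only [Pi.add_apply, Finset.sum_apply]
  rw [hprod, hRe]
  simp only [traceAt_scalarOp_mul]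
  rw [gather_sum, PowerSeries.coeff_mul, Finset.mul_sum]
  refine Finset.sum_congr rfl fun p _ => ?_
  rw [gather_mul, gather_trace_eq hA hB hR', PowerSeries.coeff_map]
  ring

end Gather

/-! ### Products of operators as sums over paths of partitions. -/

section Paths

open PowerSeries
open Finset.HasAntidiagonal (antidiagonal mem_antidiagonal)

variable {S : Type*} [CommRing S]

theorem end_apply (A : FockEnd S) {M : ℕ} {v : YoungDiagram →₀ S}
    (hv : ∀ nu : YoungDiagram, M < nu.card → v nu = 0) (lam : YoungDiagram) :
    A v lam = ∑ nu ∈ partitionsLE M, v nu * A (Finsupp.single nu 1) lam := by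
  classical
  have h : v = ∑ nu ∈ partitionsLE M, Finsupp.single nu (v nu) := by
    ext nu
    rw [sum_single_apply]
    split_ifs with h
    · rfl
    · exact hv nu (by simpa using h)
  conv_lhs => rw [h, end_sum_single, Finsupp.finsetSum_apply]
  simp

/-- The generating function of the entries of the operator `opU Ha * opD Hb`. -/
def kernel (M : ℕ) (Ha Hb : S⟦X⟧) (lam nu : YoungDiagram) : S⟦X⟧ :=
  ∑ mu ∈ partitionsLE M, X ^ (lam.card - mu.card) * C (skew Ha lam mu * skew Hb nu mu)

/-- The truncated difference in the exponent of `kernel` is harmless: the coefficient vanishes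
unless `μ ⊆ λ`. For the same reason enlarging the range of `μ` adds only zeros. -/
theorem coeff_kernel {M : ℕ} (Ha Hb : S⟦X⟧) (lam : YoungDiagram) {nu : YoungDiagram}
    (hnu : nu.card ≤ M) (i : ℕ) : coeff i (kernel M Ha Hb lam nu) =
      coeff i (opU Ha * C (opD Hb)) (Finsupp.single nu 1) lam := by
  rw [coeff_opU_mul_opD_apply, kernel, map_sum, Finset.sum_filter]
  have hsub : partitionsLE nu.card ⊆ partitionsLE M := fun mu hmu =>
    mem_partitionsLE.mpr ((mem_partitionsLE.mp hmu).trans hnu)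
  rw [← Finset.sum_subset hsub]
  · refine Finset.sum_congr rfl fun mu _ => ?_
    rw [coeff_X_pow_mul', coeff_C]
    by_cases hle : mu ≤ lam
    · have := card_le_card hle
      split_ifs <;> first | omega | simp [mul_comm]
    · simp [skew_eq_zero hle]
  · intro mu _ hmu
    have : ¬ mu ≤ nu := fun h => hmu (mem_partitionsLE.mpr (card_le_card h))
    simp [skew_eq_zero this]

theorem coeff_mul_apply (A B : PowerSeries (FockEnd S)) (n : ℕ) (v : YoungDiagram →₀ S)
    (lam : YoungDiagram) : coeff n (A * B) v lam =
      ∑ p ∈ antidiagonal n, coeff p.1 A (coeff p.2 B v) lam := by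
  rw [coeff_mul, LinearMap.sum_apply, Finsupp.finsetSum_apply]
  rfl

theorem sum_piFinset_succ {α β : Type*} [AddCommMonoid β] [DecidableEq α] {N : ℕ} (s : Finset α)
    (f : (Fin (N + 1) → α) → β) : ∑ l ∈ Fintype.piFinset (fun _ : Fin (N + 1) => s), f l =
      ∑ x ∈ s, ∑ l ∈ Fintype.piFinset (fun _ : Fin N => s), f (Fin.cons x l) := by
  rw [← Finset.sum_product']
  refine Finset.sum_bij' (fun l _ => (l 0, fun k => l k.succ))
    (fun p _ => (Fin.cons p.1 p.2 : Fin (N + 1) → α)) ?_ ?_ ?_ ?_ ?_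
  · intro l hl
    rw [Fintype.mem_piFinset] at hl
    simp [hl]
  · rintro ⟨x, l⟩ hl
    rw [Finset.mem_product, Fintype.mem_piFinset] at hl
    rw [Fintype.mem_piFinset]
    intro k
    refine Fin.cases ?_ (fun k => ?_) k
    · exact hl.1
    · exact hl.2 k
  · intro l _
    exact Fin.cons_self_tail l
  · intro p _
    simp
  · intro l _
    exact congrArg f (Fin.cons_self_tail l).symm

/-- Induction on the number of factors. The second conclusion, that at most `n` boxes are added in
total, is carried along because it allows every intermediate sum to be cut off at the common bound
`M`. -/
theorem coeff_prod_apply (M : ℕ) : ∀ (N : ℕ) (Ha Hb : Fin N → S⟦X⟧) (v : YoungDiagram →₀ S)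
    (s n : ℕ), (∀ nu : YoungDiagram, s < nu.card → v nu = 0) → s + n ≤ M →
    ∀ lam : YoungDiagram,
      coeff n (List.ofFn fun k => opU (Ha k) * C (opD (Hb k))).prod v lam =
        coeff n (∑ l ∈ Fintype.piFinset (fun _ : Fin N => partitionsLE M),
          C (v ((Fin.cons lam l : Fin (N + 1) → YoungDiagram) (Fin.last N))) *
          ∏ k, kernel M (Ha k) (Hb k) ((Fin.cons lam l : Fin (N + 1) → YoungDiagram) k.castSucc)
            (l k)) ∧
      (s + n < lam.card →
        coeff n (List.ofFn fun k => opU (Ha k) * C (opD (Hb k))).prod v lam = 0) := by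
  classical
  intro N
  induction N with
  | zero =>
    intro Ha Hb v s n hv _ lam
    have h0 : coeff n (List.ofFn fun k : Fin 0 => opU (Ha k) * C (opD (Hb k))).prod v lam =
        coeff n (C (v lam)) := by
      rw [List.ofFn_zero, List.prod_nil, coeff_one, coeff_C]
      split_ifs <;> simp
    rw [h0]
    refine ⟨by simp, fun h => ?_⟩
    rw [hv lam (by omega), map_zero, map_zero]
  | succ N ih =>
    intro Ha Hb v s n hv hM lam
    have key : ∀ p ∈ antidiagonal n, ∀ lam' : YoungDiagram,
        coeff p.1 (opU (Ha 0) * C (opD (Hb 0))) (coeff p.2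
          (List.ofFn fun k : Fin N => opU (Ha k.succ) * C (opD (Hb k.succ))).prod v) lam' =
        ∑ nu ∈ partitionsLE (s + p.2), coeff p.2
          (List.ofFn fun k : Fin N => opU (Ha k.succ) * C (opD (Hb k.succ))).prod v nu *
          coeff p.1 (opU (Ha 0) * C (opD (Hb 0))) (Finsupp.single nu 1) lam' := by
      intro p hp lam'
      have hp' := mem_antidiagonal.mp hp
      exact end_apply _ (fun nu hnu => (ih _ _ v s p.2 hv (by omega) nu).2 hnu) lam'
    rw [List.ofFn_succ, List.prod_cons]
    constructor
    · rw [coeff_mul_apply, sum_piFinset_succ, map_sum]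
      have hF : ∀ nu ∈ partitionsLE M, coeff n (∑ l ∈ Fintype.piFinset fun _ : Fin N =>
          partitionsLE M, C (v ((Fin.cons lam (Fin.cons nu l : Fin (N + 1) → YoungDiagram) :
            Fin (N + 1 + 1) → YoungDiagram) (Fin.last (N + 1)))) *
          ∏ k, kernel M (Ha k) (Hb k) ((Fin.cons lam (Fin.cons nu l : Fin (N + 1) → YoungDiagram) :
            Fin (N + 1 + 1) → YoungDiagram) k.castSucc)
            ((Fin.cons nu l : Fin (N + 1) → YoungDiagram) k)) =
          ∑ p ∈ antidiagonal n, coeff p.2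
            (List.ofFn fun k : Fin N => opU (Ha k.succ) * C (opD (Hb k.succ))).prod v nu *
            coeff p.1 (opU (Ha 0) * C (opD (Hb 0))) (Finsupp.single nu 1) lam := by
        intro nu hnu
        rw [mem_partitionsLE] at hnu
        have h1 : ∀ l : Fin N → YoungDiagram,
            C (v ((Fin.cons lam (Fin.cons nu l : Fin (N + 1) → YoungDiagram) :
              Fin (N + 1 + 1) → YoungDiagram) (Fin.last (N + 1)))) *
            ∏ k, kernel M (Ha k) (Hb k)
              ((Fin.cons lam (Fin.cons nu l : Fin (N + 1) → YoungDiagram) :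
                Fin (N + 1 + 1) → YoungDiagram) k.castSucc)
              ((Fin.cons nu l : Fin (N + 1) → YoungDiagram) k) =
            kernel M (Ha 0) (Hb 0) lam nu *
              (C (v ((Fin.cons nu l : Fin (N + 1) → YoungDiagram) (Fin.last N))) *
              ∏ k : Fin N, kernel M (Ha k.succ) (Hb k.succ)
                ((Fin.cons nu l : Fin (N + 1) → YoungDiagram) k.castSucc) (l k)) := by
          intro l
          rw [Fin.prod_univ_succ, ← Fin.succ_last, Fin.cons_succ, Fin.castSucc_zero, Fin.cons_zero,
            Fin.cons_zero]
          simp only [Fin.castSucc_succ, Fin.cons_succ]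
          ring
        rw [Finset.sum_congr rfl fun l _ => h1 l, ← Finset.mul_sum, coeff_mul]
        refine Finset.sum_congr rfl fun p hp => ?_
        have hp' := mem_antidiagonal.mp hp
        rw [coeff_kernel _ _ _ hnu, ← (ih _ _ v s p.2 hv (by omega) nu).1, mul_comm]
      rw [Finset.sum_congr rfl hF, Finset.sum_comm]
      refine Finset.sum_congr rfl fun p hp => ?_
      have hp' := mem_antidiagonal.mp hp
      rw [key p hp]
      refine Finset.sum_subset (fun nu hnu => ?_) fun nu _ hnu => ?_
      · rw [mem_partitionsLE] at hnu ⊢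
        omega
      · rw [mem_partitionsLE, not_le] at hnu
        rw [(ih _ _ v s p.2 hv (by omega) nu).2 hnu, zero_mul]
    · intro hlam
      rw [coeff_mul_apply]
      refine Finset.sum_eq_zero fun p hp => ?_
      have hp' := mem_antidiagonal.mp hp
      rw [key p hp]
      refine Finset.sum_eq_zero fun nu hnu => ?_
      rw [mem_partitionsLE] at hnu
      rw [coeff_opU_mul_opD_apply, Finset.filter_false_of_mem, Finset.sum_empty, mul_zero]
      intro ka hka
      rw [mem_partitionsLE] at hka
      omega

/-- The families of partitions of size at most `M`. -/
def sequencesLE (N M : ℕ) : Finset (PartSeq N) :=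
  (Fintype.piFinset fun _ => partitionsLE M) ×ˢ (Fintype.piFinset fun _ => partitionsLE M)

theorem mem_sequencesLE {N M : ℕ} {x : PartSeq N} :
    x ∈ sequencesLE N M ↔ (∀ k, (x.1 k).card ≤ M) ∧ ∀ k, (x.2 k).card ≤ M := by
  simp [sequencesLE]

/-- The product of skew Schur functions in the weight of a family. -/
def skewProd {N : ℕ} [NeZero N] (Ha Hb : Fin N → S⟦X⟧) (x : PartSeq N) : S :=
  ∏ k, (skew (Ha k) (x.1 (k - 1)) (x.2 k) * skew (Hb k) (x.1 k) (x.2 k))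

/-- Closing the path: the start is the last diagram, so predecessors become cyclic. -/
theorem fin_cons_castSucc_last {α : Type*} {N : ℕ} (l : Fin (N + 1) → α) (k : Fin (N + 1)) :
    (Fin.cons (l (Fin.last N)) l : Fin (N + 1 + 1) → α) k.castSucc = l (k - 1) := by
  refine Fin.cases ?_ (fun k => ?_) k
  · rw [Fin.castSucc_zero, Fin.cons_zero]
    rw [zero_sub, ← eq_neg_of_add_eq_zero_left (Fin.last_add_one N)]
  · rw [Fin.castSucc_succ, Fin.cons_succ]
    congr 1
    rw [eq_sub_iff_add_eq, Fin.coeSucc_eq_succ]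

/-- The trace of a product of operators is a sum over closed paths. -/
theorem traceAt_prod {N : ℕ} [NeZero N] (Ha Hb : Fin N → S⟦X⟧) {m n M : ℕ} (hM : m + n ≤ M) :
    traceAt m (coeff n (List.ofFn fun k => opU (Ha k) * C (opD (Hb k))).prod) =
      ∑ x ∈ (sequencesLE N M).filter fun x => (x.1 (0 - 1)).card = m,
        if ∑ k, ((x.1 (k - 1)).card - (x.2 k).card) = n then skewProd Ha Hb x else 0 := by
  classical
  obtain ⟨N, rfl⟩ := Nat.exists_eq_succ_of_ne_zero (NeZero.ne N)
  have hlast : (0 - 1 : Fin (N + 1)) = Fin.last N := by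
    rw [zero_sub]
    exact (eq_neg_of_add_eq_zero_left (Fin.last_add_one N)).symm
  have hK : ∀ l : Fin (N + 1) → YoungDiagram,
      coeff n (∏ k, kernel M (Ha k) (Hb k) (l (k - 1)) (l k)) =
        ∑ r ∈ Fintype.piFinset fun _ : Fin (N + 1) => partitionsLE M,
          if ∑ k, ((l (k - 1)).card - (r k).card) = n then skewProd Ha Hb (l, r) else 0 := by
    intro l
    simp only [kernel, Finset.prod_univ_sum, map_sum]
    refine Finset.sum_congr rfl fun r _ => ?_
    rw [Finset.prod_mul_distrib, Finset.prod_pow_eq_pow_sum, ← map_prod, coeff_X_pow_mul',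
      coeff_C, skewProd]
    generalize ∑ k, ((l (k - 1)).card - (r k).card) = s
    split_ifs <;> first | rfl | omega
  rw [Finset.sum_filter, sequencesLE, Finset.sum_product, hlast]
  have h1 : ∀ l ∈ Fintype.piFinset fun _ : Fin (N + 1) => partitionsLE M,
      ∑ r ∈ Fintype.piFinset fun _ : Fin (N + 1) => partitionsLE M,
        (if (l (Fin.last N)).card = m then
          if ∑ k, ((l (k - 1)).card - (r k).card) = n then skewProd Ha Hb (l, r) else 0
          else 0) = if (l (Fin.last N)).card = m then
            coeff n (∏ k, kernel M (Ha k) (Hb k) (l (k - 1)) (l k)) else 0 := by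
    intro l _
    rw [hK]
    split_ifs <;> simp
  rw [Finset.sum_congr rfl h1, traceAt]
  have h2 : ∀ lam ∈ partitionsOf m,
      coeff n (List.ofFn fun k => opU (Ha k) * C (opD (Hb k))).prod (Finsupp.single lam 1) lam =
      ∑ l ∈ Fintype.piFinset fun _ : Fin (N + 1) => partitionsLE M, if lam = l (Fin.last N) then
        coeff n (∏ k, kernel M (Ha k) (Hb k) (l (k - 1)) (l k)) else 0 := by
    intro lam hlam
    rw [mem_partitionsOf] at hlam
    rw [(coeff_prod_apply M _ Ha Hb (Finsupp.single lam 1) m n (fun nu hnu => ?_) hM lam).1,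
      map_sum]
    · refine Finset.sum_congr rfl fun l _ => ?_
      rw [← Fin.succ_last, Fin.cons_succ, Finsupp.single_apply]
      split_ifs with h
      · subst h
        simp only [map_one, one_mul, fin_cons_castSucc_last]
      · simp
    · rw [Finsupp.single_apply, if_neg]
      rintro rfl
      omega
  rw [Finset.sum_congr rfl h2, Finset.sum_comm]
  refine Finset.sum_congr rfl fun l _ => ?_
  rw [Finset.sum_ite_eq']
  simp only [mem_partitionsOf]

end Paths

/-! ### Multidegrees of the weights, and the sizes they determine. -/

section Homogeneous

open MvPowerSeries (coeff)
open Finset.HasAntidiagonal (antidiagonal mem_antidiagonal)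

variable {σ τ A : Type*} [CommRing A]

/-- Homogeneity with respect to the grading of the variables by `τ`. -/
def IsHom (g : σ → τ) (d : τ →₀ ℕ) (f : MvPowerSeries σ A) : Prop :=
  ∀ e, coeff e f ≠ 0 → e.mapDomain g = d

variable {g : σ → τ} {d d' : τ →₀ ℕ} {f f' : MvPowerSeries σ A}

theorem IsHom.zero : IsHom g d (0 : MvPowerSeries σ A) := fun _ he => absurd (map_zero _) he

theorem IsHom.one : IsHom g 0 (1 : MvPowerSeries σ A) := by
  classical
  intro e he
  rw [MvPowerSeries.coeff_one] at he
  obtain rfl : e = 0 := by by_contra h; simp [h] at he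
  exact Finsupp.mapDomain_zero

theorem IsHom.mul (h : IsHom g d f) (h' : IsHom g d' f') : IsHom g (d + d') (f * f') := by
  classical
  intro e he
  rw [MvPowerSeries.coeff_mul] at he
  obtain ⟨p, hp, hne⟩ := Finset.exists_ne_zero_of_sum_ne_zero he
  rw [← mem_antidiagonal.mp hp, Finsupp.mapDomain_add, h _ (left_ne_zero_of_mul hne),
    h' _ (right_ne_zero_of_mul hne)]

theorem IsHom.sum {ι : Type*} {s : Finset ι} {f : ι → MvPowerSeries σ A}
    (h : ∀ i ∈ s, IsHom g d (f i)) : IsHom g d (∑ i ∈ s, f i) := by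
  intro e he
  rw [map_sum] at he
  obtain ⟨i, hi, hne⟩ := Finset.exists_ne_zero_of_sum_ne_zero he
  exact h i hi e hne

theorem IsHom.prod {ι : Type*} {s : Finset ι} {d : ι → τ →₀ ℕ} {f : ι → MvPowerSeries σ A}
    (h : ∀ i ∈ s, IsHom g (d i) (f i)) : IsHom g (∑ i ∈ s, d i) (∏ i ∈ s, f i) := by
  classical
  induction s using Finset.induction_on with
  | empty => simpa using IsHom.one
  | insert i s hi ih =>
    rw [Finset.sum_insert hi, Finset.prod_insert hi]
    exact (h i (Finset.mem_insert_self _ _)).mul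
      (ih fun j hj => h j (Finset.mem_insert_of_mem hj))

theorem IsHom.sub (h : IsHom g d f) (h' : IsHom g d f') : IsHom g d (f - f') := by
  intro e he
  by_contra hne
  have h1 : coeff e f = 0 := by_contra fun h1 => hne (h e h1)
  have h2 : coeff e f' = 0 := by_contra fun h2 => hne (h' e h2)
  rw [map_sub, h1, h2, sub_zero] at he
  exact he rfl

theorem IsHom.natCast_mul (h : IsHom g d f) (n : ℕ) : IsHom g d ((n : MvPowerSeries σ A) * f) := by
  intro e he
  refine h e fun h0 => he ?_
  rw [← nsmul_eq_mul, map_nsmul, h0, smul_zero]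

theorem IsHom.powerSum {q : ℕ → MvPowerSeries σ A} {H : PowerSeries (MvPowerSeries σ A)} {j : τ}
    (hq : IsNewton q H) (hH : ∀ n, IsHom g (Finsupp.single j n) (PowerSeries.coeff n H)) (n : ℕ) :
    IsHom g (Finsupp.single j n) (q n) := by
  induction n using Nat.strong_induction_on with
  | _ n ih =>
    rw [hq.powerSum_eq]
    refine ((hH n).natCast_mul n).sub (IsHom.sum fun i hi => ?_)
    rw [Finset.mem_range] at hi
    have := (ih i hi).mul (hH (n - i))
    rwa [← Finsupp.single_add, Nat.add_sub_cancel' hi.le] at this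

/-- In each Leibniz term the indices sum to `|λ| - |μ|`. If one index is negative the term is zero;
otherwise the sum is nonnegative, so the truncated difference is the true one. -/
theorem IsHom.skew {H : PowerSeries (MvPowerSeries σ A)} {j : τ}
    (hH : ∀ n, IsHom g (Finsupp.single j n) (PowerSeries.coeff n H)) (lam mu : YoungDiagram) :
    IsHom g (Finsupp.single j (lam.card - mu.card)) (skew H lam mu) := by
  have hl := le_max_left (lam.colLen 0) (mu.colLen 0)
  have hm := le_max_right (lam.colLen 0) (mu.colLen 0)
  rw [PeriodicSchur.skew, skewDet]
  generalize max (lam.colLen 0) (mu.colLen 0) = r at hl hm ⊢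
  rw [Matrix.det_apply']
  refine IsHom.sum fun π _ => ?_
  simp only [Matrix.of_apply]
  set z : Fin r → ℤ := fun i =>
    (lam.rowLen (π i : Fin r) : ℤ) - (mu.rowLen i : ℤ) - ((π i : Fin r) : ℤ) + (i : ℤ) with hz
  have hsign : ∀ f : MvPowerSeries σ A, IsHom g (Finsupp.single j (lam.card - mu.card)) f →
      IsHom g (Finsupp.single j (lam.card - mu.card))
        (((Equiv.Perm.sign π : ℤ) : MvPowerSeries σ A) * f) := by
    intro f hf
    rcases Int.units_eq_one_or (Equiv.Perm.sign π) with h | h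
    · simpa [h] using hf
    · simpa [h] using IsHom.zero.sub hf
  apply hsign
  by_cases hneg : ∃ i, z i < 0
  · obtain ⟨i, hi⟩ := hneg
    rw [Finset.prod_eq_zero (Finset.mem_univ i) (coeffInt_of_neg H hi)]
    exact IsHom.zero
  · push Not at hneg
    have hsum : ∑ i, z i = (lam.card : ℤ) - mu.card := by
      rw [card_eq_sum_rowLen _ hl,
        card_eq_sum_rowLen _ hm]
      simp only [hz, Finset.sum_add_distrib, Finset.sum_sub_distrib]
      rw [Equiv.sum_comp π fun i : Fin r => (lam.rowLen i : ℤ),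
        Equiv.sum_comp π fun i : Fin r => ((i : ℕ) : ℤ), ← Fin.sum_univ_eq_sum_range,
        ← Fin.sum_univ_eq_sum_range]
      push_cast
      ring
    have hsum' : ∑ i, (z i).toNat = lam.card - mu.card := by
      zify
      simp only [Int.toNat_of_nonneg (hneg _), hsum]
      have := Finset.sum_nonneg fun i (_ : i ∈ Finset.univ) => hneg i
      omega
    rw [← hsum', Finsupp.single_finsetSum]
    refine IsHom.prod fun i _ => ?_
    change IsHom g _ (coeffInt H (z i))
    rw [coeffInt, if_pos (hneg i)]
    exact hH _

/-- The degrees of the weight of a family with given sizes. -/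
def expo {N : ℕ} [NeZero N] (d : (Fin N → ℕ) × (Fin N → ℕ)) : Fin N ⊕ Fin N →₀ ℕ :=
  ∑ k, (Finsupp.single (Sum.inl k) (d.1 (k - 1) - d.2 k) +
    Finsupp.single (Sum.inr k) (d.1 k - d.2 k))

theorem expo_inl {N : ℕ} [NeZero N] (d : (Fin N → ℕ) × (Fin N → ℕ)) (k : Fin N) :
    expo d (Sum.inl k) = d.1 (k - 1) - d.2 k := by
  classical
  simp only [expo, Finsupp.finsetSum_apply, Finsupp.add_apply, Finsupp.single_apply,
    Sum.inl.injEq, reduceCtorEq, if_false, add_zero, Finset.sum_ite_eq', Finset.mem_univ, if_true]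

theorem expo_inr {N : ℕ} [NeZero N] (d : (Fin N → ℕ) × (Fin N → ℕ)) (k : Fin N) :
    expo d (Sum.inr k) = d.1 k - d.2 k := by
  classical
  simp only [expo, Finsupp.finsetSum_apply, Finsupp.add_apply, Finsupp.single_apply,
    Sum.inr.injEq, reduceCtorEq, if_false, zero_add, Finset.sum_ite_eq', Finset.mem_univ, if_true]

/-- The sizes of the partitions. -/
def sizes {N : ℕ} (x : PartSeq N) : (Fin N → ℕ) × (Fin N → ℕ) :=
  (fun k => (x.1 k).card, fun k => (x.2 k).card)

/-- The sizes are compatible with `μ^{(k)} ⊆ λ^{(k-1)}, λ^{(k)}`. -/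
def Interlaced {N : ℕ} [NeZero N] (d : (Fin N → ℕ) × (Fin N → ℕ)) : Prop :=
  ∀ k, d.2 k ≤ d.1 (k - 1) ∧ d.2 k ≤ d.1 k

/-- Going from `λ^{(k-1)}` to `λ^{(k)}` the size grows by at most the degree in `b[k]`. The index `0
- 1` is the last one, that is, `λ^{(0)}`. -/
theorem Interlaced.le {N : ℕ} [NeZero N] {d : (Fin N → ℕ) × (Fin N → ℕ)} (h : Interlaced d)
    (k : Fin N) : d.1 k ≤ d.1 (0 - 1) + ∑ i with i ≤ k, expo d (Sum.inr i) := by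
  obtain ⟨N, rfl⟩ := Nat.exists_eq_succ_of_ne_zero (NeZero.ne N)
  induction k using Fin.induction with
  | zero =>
    have h0 := h 0
    have : expo d (Sum.inr 0) ≤ ∑ i with i ≤ (0 : Fin (N + 1)), expo d (Sum.inr i) :=
      Finset.single_le_sum (f := fun i => expo d (Sum.inr i)) (fun _ _ => Nat.zero_le _) (by simp)
    rw [expo_inr] at this
    exact le_trans (by omega) (Nat.add_le_add_left this _)
  | succ k ih =>
    have h1 := h k.succ
    have hk : k.succ - 1 = k.castSucc := by
      rw [sub_eq_iff_eq_add, Fin.coeSucc_eq_succ]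
    rw [hk] at h1
    have : expo d (Sum.inr k.succ) + ∑ i with i ≤ k.castSucc, expo d (Sum.inr i) ≤
        ∑ i with i ≤ k.succ, expo d (Sum.inr i) := by
      rw [← Finset.sum_insert (f := fun i => expo d (Sum.inr i))]
      · refine Finset.sum_le_sum_of_subset fun i hi => ?_
        rw [Finset.mem_insert] at hi
        rw [Finset.mem_filter]
        refine ⟨Finset.mem_univ _, ?_⟩
        rcases hi with rfl | hi
        · exact le_rfl
        · exact (Finset.mem_filter.mp hi).2.trans (Fin.castSucc_lt_succ).le
      · rw [Finset.mem_filter, not_and, not_le]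
        exact fun _ => Fin.castSucc_lt_succ
    rw [expo_inr, add_comm] at this
    have h2 : d.1 k.succ ≤ d.1 k.castSucc + (d.1 k.succ - d.2 k.succ) := by omega
    refine h2.trans ((Nat.add_le_add_right ih _).trans ?_)
    rw [add_assoc]
    exact Nat.add_le_add_left this _

/-- Starting from `|λ^{(0)}|`, each degree in `a[k]` gives `|μ^{(k)}|` and each degree in `b[k]`
gives `|λ^{(k)}|`. Interlacing makes the truncated differences invertible. -/
theorem Interlaced.eq {N : ℕ} [NeZero N] {d d' : (Fin N → ℕ) × (Fin N → ℕ)} (h : Interlaced d)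
    (h' : Interlaced d') (he : expo d = expo d') (h0 : d.1 (0 - 1) = d'.1 (0 - 1)) : d = d' := by
  have hl : ∀ k, d.1 (k - 1) - d.2 k = d'.1 (k - 1) - d'.2 k := fun k => by
    rw [← expo_inl, ← expo_inl, he]
  have hr : ∀ k, d.1 k - d.2 k = d'.1 k - d'.2 k := fun k => by
    rw [← expo_inr, ← expo_inr, he]
  have hstep : ∀ k, d.1 (k - 1) = d'.1 (k - 1) → d.2 k = d'.2 k ∧ d.1 k = d'.1 k := by
    intro k hk
    have h1 := h k
    have h2 := h' k
    have h3 := hl k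
    have h4 := hr k
    omega
  have h1 : ∀ k, d.1 k = d'.1 k := by
    intro k
    obtain ⟨N, rfl⟩ := Nat.exists_eq_succ_of_ne_zero (NeZero.ne N)
    induction k using Fin.induction with
    | zero => exact (hstep 0 h0).2
    | succ k ih =>
      have hk : k.succ - 1 = k.castSucc := by
        rw [sub_eq_iff_eq_add, Fin.coeSucc_eq_succ]
      exact (hstep k.succ (hk.symm ▸ ih)).2
  exact Prod.ext (funext h1) (funext fun k => (hstep k (h1 _)).1)

theorem skewProd_eq_zero {N : ℕ} [NeZero N] {Ha Hb : Fin N → PowerSeries A} {x : PartSeq N}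
    (hx : ¬ Interlaced (sizes x)) : skewProd Ha Hb x = 0 := by
  rw [Interlaced] at hx
  push Not at hx
  obtain ⟨k, hk⟩ := hx
  refine Finset.prod_eq_zero (Finset.mem_univ k) ?_
  by_cases h1 : x.2 k ≤ x.1 (k - 1)
  · rw [skew_eq_zero (H := Hb k), mul_zero]
    intro h2
    exact absurd (card_le_card h2) (not_le.mpr (hk (card_le_card h1)))
  · rw [skew_eq_zero h1, zero_mul]

theorem IsHom.skewProd {N : ℕ} [NeZero N] {g : σ → Fin N ⊕ Fin N}
    {Ha Hb : Fin N → PowerSeries (MvPowerSeries σ A)}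
    (hHa : ∀ k n, IsHom g (Finsupp.single (Sum.inl k) n) (PowerSeries.coeff n (Ha k)))
    (hHb : ∀ k n, IsHom g (Finsupp.single (Sum.inr k) n) (PowerSeries.coeff n (Hb k)))
    (x : PartSeq N) : IsHom g (expo (sizes x)) (skewProd Ha Hb x) :=
  IsHom.prod fun k _ => (IsHom.skew (hHa k) _ _).mul (IsHom.skew (hHb k) _ _)

end Homogeneous

/-! ### Passing from the series graded by added boxes to an ordinary exponential. -/

section Spread

open PowerSeries (exp)

variable {σ A : Type*} [CommRing A]

/-- The homogeneous component of degree `n`. -/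
def component (wt : (σ →₀ ℕ) →+ ℕ) (n : ℕ) (f : MvPowerSeries σ A) : MvPowerSeries σ A :=
  fun e => if wt e = n then MvPowerSeries.coeff e f else 0

theorem coeff_component (wt : (σ →₀ ℕ) →+ ℕ) (n : ℕ) (f : MvPowerSeries σ A) (e : σ →₀ ℕ) :
    MvPowerSeries.coeff e (component wt n f) =
      if wt e = n then MvPowerSeries.coeff e f else 0 := rfl

/-- The decomposition of a series in homogeneous components. -/
def spread (wt : (σ →₀ ℕ) →+ ℕ) : MvPowerSeries σ A →+* PowerSeries (MvPowerSeries σ A) where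
  toFun f := PowerSeries.mk fun n => component wt n f
  map_zero' := by
    ext n e
    simp [coeff_component]
  map_one' := by
    classical
    ext n e
    rw [PowerSeries.coeff_mk, PowerSeries.coeff_one, coeff_component,
      apply_ite (MvPowerSeries.coeff e), map_zero, MvPowerSeries.coeff_one]
    by_cases h : e = 0
    · subst h
      simp [eq_comm]
    · simp [h]
  map_add' f f' := by
    ext n e
    simp only [map_add, PowerSeries.coeff_mk, coeff_component]
    split_ifs <;> simp
  map_mul' f f' := by
    classical
    ext n e
    simp only [PowerSeries.coeff_mk, PowerSeries.coeff_mul, map_sum, MvPowerSeries.coeff_mul,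
      coeff_component]
    have hite : ∀ {ι : Type _} (s : Finset ι) (u : ι → A) (p : Prop) [Decidable p],
        (if p then ∑ i ∈ s, u i else 0) = ∑ i ∈ s, if p then u i else 0 := by
      intro ι s u p _
      split_ifs <;> simp
    rw [Finset.sum_comm, hite]
    refine Finset.sum_congr rfl fun p hp => ?_
    rw [Finset.HasAntidiagonal.mem_antidiagonal] at hp
    rw [← hp, map_add]
    split_ifs with h
    · rw [Finset.sum_eq_single (wt p.1, wt p.2)]
      · simp
      · intro y _ hy
        by_cases h1 : wt p.1 = y.1
        · have h2 : wt p.2 ≠ y.2 := fun h2 => hy (Prod.ext h1.symm h2.symm)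
          simp [h2]
        · simp [h1]
      · intro hn
        exact absurd (Finset.HasAntidiagonal.mem_antidiagonal.mpr h) hn
    · refine (Finset.sum_eq_zero fun y hy => ?_).symm
      rw [Finset.HasAntidiagonal.mem_antidiagonal] at hy
      by_cases h1 : wt p.1 = y.1
      · have h2 : wt p.2 ≠ y.2 := by omega
        simp [h2]
      · simp [h1]

theorem spread_apply (wt : (σ →₀ ℕ) →+ ℕ) (f : MvPowerSeries σ A) :
    spread wt f = PowerSeries.mk fun n => component wt n f := rfl

theorem coeff_spread (wt : (σ →₀ ℕ) →+ ℕ) (f : MvPowerSeries σ A) (n : ℕ) (e : σ →₀ ℕ) :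
    MvPowerSeries.coeff e (PowerSeries.coeff n (spread wt f)) =
      if wt e = n then MvPowerSeries.coeff e f else 0 := by
  rw [spread_apply, PowerSeries.coeff_mk, coeff_component]

variable [Algebra ℚ A]

theorem coeff_rat_smul (c : ℚ) (f : MvPowerSeries σ A) (e : σ →₀ ℕ) :
    MvPowerSeries.coeff e (c • f) = c • MvPowerSeries.coeff e f := rfl

/-- The series `∑ qₙ / n`, if `qₙ` is homogeneous of degree `n`. -/
def collect (wt : (σ →₀ ℕ) →+ ℕ) (q : ℕ → MvPowerSeries σ A) : MvPowerSeries σ A :=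
  fun e => (wt e : ℚ)⁻¹ • MvPowerSeries.coeff e (q (wt e))

theorem coeff_collect (wt : (σ →₀ ℕ) →+ ℕ) (q : ℕ → MvPowerSeries σ A) (e : σ →₀ ℕ) :
    MvPowerSeries.coeff e (collect wt q) = (wt e : ℚ)⁻¹ • MvPowerSeries.coeff e (q (wt e)) := rfl

theorem constantCoeff_collect (wt : (σ →₀ ℕ) →+ ℕ) (q : ℕ → MvPowerSeries σ A) :
    MvPowerSeries.constantCoeff (collect wt q) = 0 := by
  rw [← MvPowerSeries.coeff_zero_eq_constantCoeff_apply, coeff_collect]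
  simp

theorem spread_collect {wt : (σ →₀ ℕ) →+ ℕ} {q : ℕ → MvPowerSeries σ A}
    (hq : ∀ n e, MvPowerSeries.coeff e (q n) ≠ 0 → wt e = n) :
    spread wt (collect wt q) = logSeries q := by
  ext n e
  rw [coeff_spread, logSeries, PowerSeries.coeff_mk, coeff_collect,
    coeff_rat_smul]
  split_ifs with h
  · rw [h]
  · rw [by_contra fun h' => h (hq n e h'), smul_zero]

/-- `spread` is a ring homomorphism that takes the collected exponent to the logarithmic series,
hence it matches the powers of both. At a monomial `e` only the grade `wt e` is visible. -/
theorem coeff_newtonExp {wt : (σ →₀ ℕ) →+ ℕ} {q : ℕ → MvPowerSeries σ A}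
    (hq : ∀ n e, MvPowerSeries.coeff e (q n) ≠ 0 → wt e = n) (e : σ →₀ ℕ) :
    MvPowerSeries.coeff e (PowerSeries.coeff (wt e) (newtonExp q)) =
      MvPowerSeries.coeff e ((exp ℚ).subst (collect wt q)) := by
  have hs : PowerSeries.HasSubst (collect wt q) :=
    PowerSeries.HasSubst.of_constantCoeff_zero (constantCoeff_collect wt q)
  rw [newtonExp, PowerSeries.coeff_subst' (hasSubst_logSeries q), PowerSeries.coeff_subst hs]
  have := AddMonoidHom.map_finsum (MvPowerSeries.coeff (R := A) e).toAddMonoidHom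
    (PowerSeries.coeff_subst_finite' (hasSubst_logSeries q) (exp (MvPowerSeries σ A)) (wt e))
  refine this.trans (finsum_congr fun j => ?_)
  rw [← spread_collect hq, ← map_pow, PowerSeries.coeff_exp, PowerSeries.coeff_exp]
  rw [LinearMap.toAddMonoidHom_coe, algebraMap_smul, coeff_rat_smul, coeff_spread, if_pos rfl]
  simp

end Spread

/-! ### The trace formula at a single monomial. -/

section TraceFormula

variable {σ K : Type*} [Field K]

/-- The total degree in the variables of the `a[k]`. -/
def weightA {N : ℕ} (g : σ → Fin N ⊕ Fin N) : (σ →₀ ℕ) →+ ℕ where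
  toFun e := ∑ k, e.mapDomain g (Sum.inl k)
  map_zero' := by simp
  map_add' e e' := by simp [Finsupp.mapDomain_add, Finset.sum_add_distrib]

/-- The power sums of the generating function of the traces. -/
def traceSums {N : ℕ} (pa pb : Fin N → ℕ → MvPowerSeries σ K) (n : ℕ) :
    MvPowerSeries σ (PowerSeries K) :=
  incl (∑ k, ∑ l with l < k, pa k n * pb l n) +
    MvPowerSeries.C (PowerSeries.X ^ n * (1 - PowerSeries.X ^ n)⁻¹) *
      incl ((∑ k, pa k n) * ∑ l, pb l n)

/-- Every term contains one `n`-th power sum of some `a[k]` and one of some `b[l]`. -/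
theorem weightA_eq_of_coeff_traceSums {N : ℕ} {g : σ → Fin N ⊕ Fin N}
    {pa pb : Fin N → ℕ → MvPowerSeries σ K}
    (ha : ∀ k n, IsHom g (Finsupp.single (Sum.inl k) n) (pa k n))
    (hb : ∀ k n, IsHom g (Finsupp.single (Sum.inr k) n) (pb k n)) (n : ℕ) (e : σ →₀ ℕ)
    (he : MvPowerSeries.coeff e (traceSums pa pb n) ≠ 0) : weightA g e = n := by
  have hmul : ∀ k l, MvPowerSeries.coeff e (pa k n * pb l n) ≠ 0 → weightA g e = n := by
    intro k l h
    have h1 := (ha k n).mul (hb l n) e h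
    classical
    change ∑ k, e.mapDomain g (Sum.inl k) = n
    rw [h1]
    simp [Finsupp.single_apply]
  by_contra hne
  have h0 : ∀ k l, MvPowerSeries.coeff e (pa k n * pb l n) = 0 := fun k l =>
    by_contra fun h => hne (hmul k l h)
  apply he
  rw [traceSums, map_add, MvPowerSeries.coeff_C_mul, incl, MvPowerSeries.coeff_map,
    MvPowerSeries.coeff_map, Finset.sum_mul_sum]
  simp only [map_sum, h0]
  simp

/-- The coefficients of the sum of the weights. -/
theorem sum_coeff_skewProd [CharZero K] {N : ℕ} [NeZero N] {g : σ → Fin N ⊕ Fin N}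
    {Ha Hb : Fin N → PowerSeries (MvPowerSeries σ K)} {pa pb : Fin N → ℕ → MvPowerSeries σ K}
    (ha : ∀ k, IsNewton (pa k) (Ha k)) (hb : ∀ k, IsNewton (pb k) (Hb k))
    (hHa : ∀ k n, IsHom g (Finsupp.single (Sum.inl k) n) (PowerSeries.coeff n (Ha k)))
    (hHb : ∀ k n, IsHom g (Finsupp.single (Sum.inr k) n) (PowerSeries.coeff n (Hb k)))
    (e : σ →₀ ℕ) {m M : ℕ} (hM : m + weightA g e ≤ M) :
    ∑ x ∈ (sequencesLE N M).filter fun x => (x.1 (0 - 1)).card = m,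
      MvPowerSeries.coeff e (skewProd Ha Hb x) =
    PowerSeries.coeff m (partitionSeries K * MvPowerSeries.coeff e
      ((PowerSeries.exp ℚ).subst (collect (weightA g) (traceSums pa pb)))) := by
  have hq := weightA_eq_of_coeff_traceSums (fun k => IsHom.powerSum (ha k) (hHa k))
    (fun k => IsHom.powerSum (hb k) (hHb k))
  have hq0 : traceSums pa pb 0 = 0 := by
    simp [traceSums, fun k => (ha k).zero_apply]
  have hgather : gather _ = MvPowerSeries.C (partitionSeries K) *
      PowerSeries.coeff (weightA g e) (newtonExp (traceSums pa pb)) := gather_trace_prod ha hb (isNewton_newtonExp hq0) (weightA g e)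
  rw [← coeff_newtonExp hq, ← MvPowerSeries.coeff_C_mul, ← hgather, coeff_gather, PowerSeries.coeff_mk,
    traceAt_prod Ha Hb hM, map_sum]
  refine Finset.sum_congr rfl fun x _ => ?_
  -- The trace only counts paths that add `weightA g e` boxes. By homogeneity the other paths have
  -- coefficient zero at `e`, so the restriction may be dropped.
  split_ifs with h
  · rfl
  · rw [map_zero]
    by_contra hne
    apply h
    have h1 := IsHom.skewProd hHa hHb x e hne
    change _ = ∑ k, e.mapDomain g (Sum.inl k)
    rw [h1]
    simp only [expo_inl]
    rfl

/-- The sizes of the partitions are bounded in terms of the exponents. -/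
theorem mem_sequencesLE_of_coeff_ne_zero {N : ℕ} [NeZero N] {g : σ → Fin N ⊕ Fin N}
    {Ha Hb : Fin N → PowerSeries (MvPowerSeries σ K)}
    (hHa : ∀ k n, IsHom g (Finsupp.single (Sum.inl k) n) (PowerSeries.coeff n (Ha k)))
    (hHb : ∀ k n, IsHom g (Finsupp.single (Sum.inr k) n) (PowerSeries.coeff n (Hb k)))
    {e : σ →₀ ℕ} {x : PartSeq N} (hx : MvPowerSeries.coeff e (skewProd Ha Hb x) ≠ 0) :
    x ∈ sequencesLE N ((x.1 (0 - 1)).card + ∑ k, e.mapDomain g (Sum.inr k)) := by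
  have hI : Interlaced (sizes x) := by
    by_contra h
    exact hx (by rw [skewProd_eq_zero h, map_zero])
  have h1 := IsHom.skewProd hHa hHb x e hx
  have h2 : ∀ k, (x.1 k).card ≤ (x.1 (0 - 1)).card + ∑ k, e.mapDomain g (Sum.inr k) := by
    intro k
    refine (hI.le k).trans ?_
    rw [h1]
    exact Nat.add_le_add_left
      (Finset.sum_le_sum_of_subset (Finset.filter_subset _ _)) _
  exact mem_sequencesLE.mpr ⟨h2, fun k => (hI k).2.trans (h2 k)⟩

end TraceFormula

/-! ### Symmetric functions, their specializations, and the two forms of the exponent. -/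

section Symmetric

open Finset.HasAntidiagonal (antidiagonal mem_antidiagonal)

variable {K : Type*} [Field K]

/-- The power sums, with value `0` at `0`. -/
def powerSumSeq (K : Type*) [Field K] (n : ℕ) : SymmFun K := if n = 0 then 0 else powerSum K n

theorem coeff_completeH (n : ℕ) (d : ℕ →₀ ℕ) :
    MvPowerSeries.coeff d (completeH K n : MvPowerSeries ℕ K) = if d.degree = n then 1 else 0 := rfl

open Classical in
theorem coeff_powerSum (n : ℕ) (d : ℕ →₀ ℕ) :
    MvPowerSeries.coeff d (powerSum K n : MvPowerSeries ℕ K) =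
      if ∃ i, d = Finsupp.single i n then 1 else 0 := rfl

/-- A factorization of `x^d` into an `i`-th power of one variable and a cofactor amounts to a
variable with exponent at least `i`. -/
theorem coeff_powerSum_mul_completeH {i j : ℕ} (hi : i ≠ 0) (d : ℕ →₀ ℕ) :
    MvPowerSeries.coeff d (powerSum K i * completeH K j : MvPowerSeries ℕ K) =
      if d.degree = i + j then (({x ∈ d.support | i ≤ d x}.card : ℕ) : K) else 0 := by
  classical
  rw [MvPowerSeries.coeff_mul]
  simp only [coeff_powerSum, coeff_completeH, boole_mul]
  have hdeg : ∀ p ∈ antidiagonal d, (∃ x, p.1 = Finsupp.single x i) →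
      (p.2.degree = j ↔ d.degree = i + j) := by
    rintro p hp ⟨x, hx⟩
    rw [← mem_antidiagonal.mp hp, map_add, hx, Finsupp.degree_single]
    omega
  split_ifs with h
  · rw [Finset.card_eq_sum_ones, Nat.cast_sum, Nat.cast_one]
    symm
    rw [← Finset.sum_filter_add_sum_filter_not (antidiagonal d)
      (fun p => ∃ x, p.1 = Finsupp.single x i)]
    rw [Finset.sum_eq_zero (s := Finset.filter (fun p => ¬ _) _), add_zero]
    · refine Finset.sum_bij (fun x _ => (Finsupp.single x i, d - Finsupp.single x i)) ?_ ?_ ?_ ?_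
      · intro x hx
        rw [Finset.mem_filter] at hx
        rw [Finset.mem_filter, mem_antidiagonal]
        refine ⟨add_tsub_cancel_of_le (Finsupp.single_le_iff.mpr hx.2), x, rfl⟩
      · intro x _ y _ hxy
        have := congrArg Prod.fst hxy
        exact Finsupp.single_left_injective hi this
      · rintro p hp
        rw [Finset.mem_filter] at hp
        obtain ⟨hp, x, hx⟩ := hp
        have hd := mem_antidiagonal.mp hp
        have hxi : i ≤ d x := by
          rw [← hd, hx]
          simp
        refine ⟨x, ?_, ?_⟩
        · rw [Finset.mem_filter, Finsupp.mem_support_iff]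
          exact ⟨by omega, hxi⟩
        · refine Prod.ext hx.symm ?_
          rw [← hd, hx, add_tsub_cancel_left]
      · intro x hx
        rw [Finset.mem_filter] at hx
        rw [if_pos ⟨x, rfl⟩, if_pos]
        refine (hdeg (_, _) ?_ ⟨x, rfl⟩).mpr h
        rw [mem_antidiagonal]
        exact add_tsub_cancel_of_le (Finsupp.single_le_iff.mpr hx.2)
    · intro p hp
      rw [if_neg (Finset.mem_filter.mp hp).2]
  · refine Finset.sum_eq_zero fun p hp => ?_
    split_ifs with h1 h2
    · exact absurd ((hdeg p hp h1).mp h2) h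
    · rfl
    · rfl

theorem isNewton_completeH : IsNewton (powerSumSeq K) (PowerSeries.mk (completeH K)) := by
  classical
  rw [isNewton_iff]
  refine ⟨?_, fun n => ?_⟩
  · refine Subtype.ext (MvPowerSeries.ext fun d => ?_)
    rw [← PowerSeries.coeff_zero_eq_constantCoeff_apply, PowerSeries.coeff_mk, coeff_completeH]
    change _ = MvPowerSeries.coeff d (1 : MvPowerSeries ℕ K)
    rw [MvPowerSeries.coeff_one]
    simp [Finsupp.degree_eq_zero_iff]
  · refine Subtype.ext (MvPowerSeries.ext fun d => ?_)
    rw [Finset.Nat.sum_antidiagonal_eq_sum_range_succ_mk, Finset.sum_range_succ']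
    simp only [PowerSeries.coeff_mk, powerSumSeq, if_pos, zero_mul, add_zero, Nat.succ_ne_zero,
      if_false]
    rw [← nsmul_eq_mul, AddSubmonoidClass.coe_nsmul, map_nsmul, coeff_completeH, AddSubmonoidClass.coe_finsetSum,
      map_sum]
    have h1 : ∀ i ∈ Finset.range n, MvPowerSeries.coeff d
        ((powerSum K (i + 1) * completeH K (n - (i + 1)) : SymmFun K) : MvPowerSeries ℕ K) =
        if d.degree = n then (({x ∈ d.support | i + 1 ≤ d x}.card : ℕ) : K) else 0 := by
      intro i hi
      rw [Finset.mem_range] at hi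
      change MvPowerSeries.coeff d (_ * _) = _
      rw [coeff_powerSum_mul_completeH (Nat.succ_ne_zero i), Nat.add_sub_cancel' (by omega)]
    rw [Finset.sum_congr rfl h1]
    split_ifs with h
    · rw [← Nat.cast_sum, nsmul_one]
      congr 1
      -- Count the pairs of a variable `x` and an `i` with `1 ≤ i ≤ d x` in the other order: each
      -- variable contributes `d x`, and the total is the degree `n`.
      simp only [Finset.card_filter]
      rw [Finset.sum_comm, ← h, Finsupp.degree_apply]
      refine Finset.sum_congr rfl fun x hx => ?_
      rw [← Finset.card_filter]
      have hle : d x ≤ ∑ i ∈ d.support, d i := Finset.single_le_sum (fun _ _ => Nat.zero_le _) hx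
      rw [show Finset.filter (fun i => i + 1 ≤ d x) (Finset.range (∑ i ∈ d.support, d i)) =
        Finset.range (d x) by ext i; simp only [Finset.mem_filter, Finset.mem_range]; omega,
        Finset.card_range]
    · simp

variable {F S : Type*} [Field F] [CommRing S] [Algebra K S] [Algebra F S]

/-- The generating function of the values of the complete symmetric functions. -/
def specSeries (c : SymmFun K →ₐ[K] S) : PowerSeries S :=
  PowerSeries.map (c : SymmFun K →+* S) (PowerSeries.mk (completeH K))

theorem coeff_specSeries (c : SymmFun K →ₐ[K] S) (n : ℕ) :
    PowerSeries.coeff n (specSeries c) = c (completeH K n) := by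
  simp [specSeries]

theorem isNewton_specSeries (c : SymmFun K →ₐ[K] S) :
    IsNewton (fun n => c (powerSumSeq K n)) (specSeries c) :=
  isNewton_completeH.map (c : SymmFun K →+* S)

theorem skewSchur_eq (lam mu : YoungDiagram) :
    skewSchur K lam mu = skew (PowerSeries.mk (completeH K)) lam mu := by
  rw [skewSchur, skew, skewDet]
  congr 1
  ext1 i j
  simp only [Matrix.of_apply, completeHInt, coeffInt, PowerSeries.coeff_mk]

theorem map_skewSchur (c : SymmFun K →ₐ[K] S) (lam mu : YoungDiagram) :
    c (skewSchur K lam mu) = skew (specSeries c) lam mu := by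
  rw [skewSchur_eq]
  exact map_skew (c : SymmFun K →+* S) _ lam mu

theorem weight_eq {N : ℕ} [NeZero N] (t : F) (a b : Fin N → (SymmFun K →ₐ[K] S)) (x : PartSeq N) :
    weight t a b x = t ^ (x.1 (0 - 1)).card •
      skewProd (fun k => specSeries (a k)) (fun k => specSeries (b k)) x := by
  simp only [weight, skewProd, map_skewSchur]

theorem map_skewProd {S' : Type*} [CommRing S'] (φ : S →+* S') {N : ℕ} [NeZero N]
    (Ha Hb : Fin N → PowerSeries S) (x : PartSeq N) : φ (skewProd Ha Hb x) =
      skewProd (fun k => PowerSeries.map φ (Ha k)) (fun k => PowerSeries.map φ (Hb k)) x := by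
  simp only [skewProd, map_prod, map_mul, map_skew]

theorem powerSumSeq_succ (n : ℕ) : powerSumSeq K (n + 1) = powerSum K (n + 1) := by
  simp [powerSumSeq]

theorem exponentTerm_eq [CharZero K] [CharZero F] {N : ℕ} (t : F) (a b : Fin N → (SymmFun K →ₐ[K] S)) {n : ℕ}
    (hn : n ≠ 0) : exponentTerm t a b n = (n : F)⁻¹ •
      ((∑ k, ∑ l with l < k, a k (powerSum K n) * b l (powerSum K n)) +
        (t ^ n / (1 - t ^ n)) • ((∑ k, a k (powerSum K n)) * ∑ l, b l (powerSum K n))) := by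
  -- The two fields of scalars need not be related, but both inverses undo multiplication by the
  -- integer `n`.
  have hK : ∀ f : S, (n : K)⁻¹ • f = (n : F)⁻¹ • f := by
    intro f
    have h1 : (n : K) • ((n : K)⁻¹ • f) = f := smul_inv_smul₀ (by exact_mod_cast hn) f
    have h2 : (n : F) • ((n : K)⁻¹ • f) = f := by
      rw [Nat.cast_smul_eq_nsmul] at h1 ⊢
      exact h1
    rw [← inv_smul_smul₀ (by exact_mod_cast hn : (n : F) ≠ 0) ((n : K)⁻¹ • f), h2]
  simp only [exponentTerm, scaledPower, hK, smul_mul_smul_comm, ← Finset.smul_sum]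
  have hn' : (n : F) * ((n : F)⁻¹ * (n : F)⁻¹) = (n : F)⁻¹ := by
    have : (n : F) ≠ 0 := by exact_mod_cast hn
    field_simp
  rw [smul_comm (t ^ n / (1 - t ^ n)), ← smul_add, smul_smul, hn']

/-- The twists contribute `s^{(l-k)n}`, which reduces the two coefficients to `1` and `s^{Nn} = tⁿ`.
Then `1/(1 - tⁿ) = 1 + tⁿ/(1 - tⁿ)` separates the pairs `l < k` from the full double sum. -/
theorem symExponentTerm_eq {N : ℕ} {s : F} (hs : s ≠ 0) (a b : Fin N → (SymmFun K →ₐ[K] S)) {n : ℕ}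
    (hn : 1 - (s ^ N) ^ n ≠ 0) : symExponentTerm s a b n = exponentTerm (s ^ N) a b n := by
  have h1 : ∀ k l : Fin N,
      (if l < k then s ^ (((k : ℕ) - (l : ℕ)) * n) else s ^ ((N + (k : ℕ) - (l : ℕ)) * n)) •
        (twistA s a k n * twistB s b l n) =
      (if l < k then 1 else (s ^ N) ^ n) • (scaledPower (a k) n * scaledPower (b l) n) := by
    intro k l
    rw [twistA, twistB, smul_mul_smul_comm, smul_smul]
    congr 1
    rw [inv_pow]
    split_ifs with h
    · have h' : (l : ℕ) < k := h
      rw [mul_left_comm, ← pow_add, ← add_mul,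
        show (k : ℕ) - (l : ℕ) + ((l : ℕ) + 1) = k + 1 by omega, inv_mul_cancel₀ (pow_ne_zero _ hs)]
    · have h' : (l : ℕ) < N := l.2
      rw [mul_left_comm, ← pow_add, ← add_mul,
        show N + (k : ℕ) - (l : ℕ) + ((l : ℕ) + 1) = k + 1 + N by omega, add_mul (_ + 1) N n, pow_add,
        inv_mul_cancel_left₀ (pow_ne_zero _ hs), pow_mul]
  simp only [symExponentTerm, exponentTerm, h1]
  rw [mul_comm n N, pow_mul, div_eq_mul_inv, mul_smul]
  congr 1
  generalize (s ^ N) ^ n = T at *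
  have h2 : ∀ k l : Fin N, (1 - T)⁻¹ • (if l < k then 1 else T) •
      (scaledPower (a k) n * scaledPower (b l) n) =
      (if l < k then scaledPower (a k) n * scaledPower (b l) n else 0) +
        (T / (1 - T)) • (scaledPower (a k) n * scaledPower (b l) n) := by
    intro k l
    rw [smul_smul]
    split_ifs
    · nth_rewrite 2 [← one_smul F (scaledPower (a k) n * scaledPower (b l) n)]
      rw [← add_smul]
      congr 1
      field_simp
      ring
    · rw [zero_add, inv_mul_eq_div]
  simp only [Finset.smul_sum, h2, Finset.sum_add_distrib, Finset.sum_mul_sum, Finset.sum_filter]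

end Symmetric

/-! ### Young diagrams as partitions of integers, and Euler's product. -/

section PartitionCount

theorem sum_rowLens (lam : YoungDiagram) : lam.rowLens.sum = lam.card := by
  rw [card_eq_sum_rowLen lam le_rfl, YoungDiagram.rowLens, ← List.sum_toFinset _ List.nodup_range,
    List.toFinset_range]

theorem card_partitionsOf (m : ℕ) : (partitionsOf m).card = Fintype.card (Nat.Partition m) := by
  rw [← Finset.card_univ]
  refine Finset.card_bij (fun lam hlam => ⟨lam.rowLens, fun {i} hi =>
    lam.pos_of_mem_rowLens i (by simpa using hi), by
      rw [mem_partitionsOf] at hlam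
      rw [Multiset.sum_coe, sum_rowLens, hlam]⟩) (fun _ _ => Finset.mem_univ _) ?_ ?_
  · intro lam _ mu _ h
    have h1 : (lam.rowLens : Multiset ℕ) = mu.rowLens := congrArg Nat.Partition.parts h
    rw [Multiset.coe_eq_coe] at h1
    have h2 := h1.eq_of_sortedGE lam.rowLens_sorted mu.rowLens_sorted
    exact YoungDiagram.equivListRowLens.injective (Subtype.ext h2)
  · intro p _
    set w : {w : List ℕ // w.SortedGE ∧ ∀ x ∈ w, 0 < x} := ⟨p.parts.sort (· ≥ ·),
      (p.parts.pairwise_sort (· ≥ ·)).sortedGE, fun x hx => p.parts_pos (by simpa using hx)⟩ with hw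
    have h : (YoungDiagram.equivListRowLens.symm w).rowLens = w.1 :=
      congrArg Subtype.val (YoungDiagram.equivListRowLens.apply_symm_apply w)
    refine ⟨YoungDiagram.equivListRowLens.symm w, ?_, ?_⟩
    · rw [mem_partitionsOf, ← sum_rowLens, h, ← Multiset.sum_coe, hw, Multiset.sort_eq,
        p.parts_sum]
    · refine Nat.Partition.ext ?_
      change ((YoungDiagram.equivListRowLens.symm w).rowLens : Multiset ℕ) = _
      rw [h, hw, Multiset.sort_eq]

open PowerSeries in
theorem eventually_coeff_prod_eq (K : Type*) [Field K] (m : ℕ) :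
    ∀ᶠ s : Finset ℕ in Filter.atTop,
      coeff m (∏ n ∈ s, (1 - (X : K⟦X⟧) ^ (n + 1))⁻¹) = coeff m (partitionSeries K) := by
  -- In the discrete topology, convergence of a coefficient is eventual equality.
  let : TopologicalSpace K := ⊥
  have : DiscreteTopology K := ⟨rfl⟩
  have h := Nat.Partition.hasProd_powerSeriesMk_card_restricted K fun _ => True
  rw [HasProd, WithPiTopology.tendsto_iff_coeff_tendsto] at h
  have h1 := h m (show {_} ∈ _ by rw [nhds_discrete]; exact Filter.mem_pure.mpr rfl)
  rw [SummationFilter.unconditional_filter, Filter.mem_map] at h1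
  filter_upwards [h1] with s hs
  rw [Set.mem_preimage, Set.mem_singleton_iff, coeff_mk] at hs
  rw [partitionSeries, coeff_mk, card_partitionsOf, ← Finset.card_univ]
  convert hs using 2
  · refine Finset.prod_congr rfl fun n _ => ?_
    rw [if_pos trivial]
    simp only [pow_mul]
    rw [PowerSeries.inv_eq_iff_mul_eq_one (by simp)]
    exact WithPiTopology.tsum_pow_mul_one_sub_of_constantCoeff_eq_zero (by simp)
  · congr 1
    simp [Nat.Partition.restricted]

end PartitionCount

/-! ### Convergence of Laurent series, and the substitution of a power of the variable. -/

section Laurent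

open scoped Topology WithZero
open Filter

variable {K : Type*} [Field K]

theorem tendsto_laurent {ι : Type*} {l : Filter ι} {u : ι → K⸨X⸩} {x : K⸨X⸩}
    (h : ∀ D : ℤ, ∀ᶠ i in l, ∀ n < D, (u i).coeff n = x.coeff n) : Tendsto u l (𝓝 x) := by
  intro U hU
  obtain ⟨γ, hγ⟩ := Valued.mem_nhds.mp hU
  -- The value `exp(-D)` lies one step below the radius of the given neighbourhood, so agreement of
  -- all coefficients below `D` is enough.
  set D := -(WithZero.log (MonoidWithZeroHom.ValueGroup₀.embedding γ.1) - 1) with hD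
  have hD' : WithZero.exp (-D) < MonoidWithZeroHom.ValueGroup₀.embedding γ.1 := by
    rw [← WithZero.lt_log_iff_exp_lt (by simp), hD]
    simp
  rw [mem_map]
  filter_upwards [h D] with i hi
  have h1 : Valued.v (u i - x) < MonoidWithZeroHom.ValueGroup₀.embedding γ.1 := by
    refine lt_of_le_of_lt ((LaurentSeries.valuation_le_iff_coeff_lt_eq_zero K).mpr ?_) hD'
    intro n hn
    rw [HahnSeries.coeff_sub, sub_eq_zero, hi n hn]
  rw [← Valued.v.restrict_lt_iff_lt_embedding] at h1
  exact hγ h1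

/-- The substitution of `X ^ r` for the variable. -/
def powVar (K : Type*) [Field K] (r : ℕ) (hr : r ≠ 0) : PowerSeries K →+* K⸨X⸩ :=
  (HahnSeries.ofPowerSeries ℤ K).comp (PowerSeries.expand r hr).toRingHom

theorem coeff_powVar (r : ℕ) (hr : r ≠ 0) (f : PowerSeries K) (n : ℕ) :
    (powVar K r hr f).coeff n = if r ∣ n then PowerSeries.coeff (n / r) f else 0 := by
  change ((PowerSeries.expand r hr f : PowerSeries K) : K⸨X⸩).coeff n = _
  rw [LaurentSeries.coeff_coe_powerSeries, PowerSeries.coeff_expand]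

theorem coeff_powVar_of_neg (r : ℕ) (hr : r ≠ 0) (f : PowerSeries K) {n : ℤ} (hn : n < 0) :
    (powVar K r hr f).coeff n = 0 := by
  change ((PowerSeries.expand r hr f : PowerSeries K) : K⸨X⸩).coeff n = _
  rw [PowerSeries.coeff_coe, if_pos hn]

theorem powVar_X (r : ℕ) (hr : r ≠ 0) : powVar K r hr PowerSeries.X = formalVar K ^ r := by
  change ((PowerSeries.expand r hr PowerSeries.X : PowerSeries K) : K⸨X⸩) = _
  rw [PowerSeries.expand_X, map_pow, PowerSeries.coe_X, formalVar]

theorem powVar_C (r : ℕ) (hr : r ≠ 0) (c : K) :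
    powVar K r hr (PowerSeries.C c) = algebraMap K K⸨X⸩ c := by
  change ((PowerSeries.expand r hr (PowerSeries.C c) : PowerSeries K) : K⸨X⸩) = _
  rw [PowerSeries.expand_C, PowerSeries.coe_C, LaurentSeries.algebraMap_apply]

theorem tendsto_powVar {ι : Type*} {l : Filter ι} (r : ℕ) (hr : r ≠ 0) {u : ι → PowerSeries K}
    {U : PowerSeries K} (h : ∀ m, ∀ᶠ i in l, PowerSeries.coeff m (u i) = PowerSeries.coeff m U) :
    Tendsto (fun i => powVar K r hr (u i)) l (𝓝 (powVar K r hr U)) := by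
  refine tendsto_laurent fun D => ?_
  have h1 : ∀ᶠ i in l, ∀ m ∈ Finset.range D.toNat,
      PowerSeries.coeff m (u i) = PowerSeries.coeff m U :=
    (Finset.eventually_all _).mpr fun m _ => h m
  filter_upwards [h1] with i hi n hn
  rcases lt_or_ge n 0 with h0 | h0
  · rw [coeff_powVar_of_neg _ _ _ h0, coeff_powVar_of_neg _ _ _ h0]
  · lift n to ℕ using h0
    rw [coeff_powVar, coeff_powVar]
    split_ifs
    · refine hi _ ?_
      rw [Finset.mem_range]
      have := Nat.div_le_self n r
      omega
    · rfl

theorem powVar_inv (r : ℕ) (hr : r ≠ 0) {f : PowerSeries K} (hf : PowerSeries.constantCoeff f ≠ 0) :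
    powVar K r hr f⁻¹ = (powVar K r hr f)⁻¹ := by
  refine eq_inv_of_mul_eq_one_left ?_
  rw [← map_mul, PowerSeries.inv_mul_cancel _ hf, map_one]

theorem hasProd_powVar (r : ℕ) (hr : r ≠ 0) :
    HasProd (fun n : ℕ => (1 - (formalVar K ^ r) ^ (n + 1))⁻¹) (powVar K r hr (partitionSeries K)) := by
  have h := tendsto_powVar r hr (eventually_coeff_prod_eq K)
  refine h.congr fun s => ?_
  rw [map_prod]
  refine Finset.prod_congr rfl fun n _ => ?_
  rw [powVar_inv, map_sub, map_one, map_pow, powVar_X]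
  simp

end Laurent

/-! ### The formal identity, for both choices of the variable. -/

section FormalIdentity

open scoped Topology
open Filter

variable {K : Type*} [Field K] {N : ℕ}

/-- The formal specializations over the base field. -/
def baseSpec (K : Type*) [Field K] (N : ℕ) (j : Fin N ⊕ Fin N) :
    SymmFun K →ₐ[K] MvPowerSeries ((Fin N ⊕ Fin N) × ℕ) K :=
  (MvPowerSeries.rename (Function.Embedding.sectR j ℕ)).comp (SymmFun K).val

theorem formalSpec_apply (j : Fin N ⊕ Fin N) (f : SymmFun K) :
    formalSpec K N j f = MvPowerSeries.map (algebraMap K K⸨X⸩) (baseSpec K N j f) := rfl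

theorem isHom_baseSpec (j : Fin N ⊕ Fin N) (n : ℕ) :
    IsHom Prod.fst (Finsupp.single j n) (PowerSeries.coeff n (specSeries (baseSpec K N j))) := by
  intro e he
  rw [coeff_specSeries] at he
  have h1 : e ∈ Set.range (Finsupp.mapDomain (Function.Embedding.sectR j ℕ)) := by
    by_contra h
    exact he (MvPowerSeries.coeff_rename_eq_zero _ _ h)
  obtain ⟨d, rfl⟩ := h1
  have h2 : MvPowerSeries.coeff d (completeH K n : MvPowerSeries ℕ K) ≠ 0 := by
    rw [← Finsupp.embDomain_eq_mapDomain] at he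
    rwa [← MvPowerSeries.coeff_embDomain_rename (Function.Embedding.sectR j ℕ)]
  rw [coeff_completeH] at h2
  have h3 : d.degree = n := by
    by_contra h
    simp [h] at h2
  rw [← Finsupp.mapDomain_comp, ← h3]
  change Finsupp.mapDomain (fun _ => j) d = _
  rw [Finsupp.mapDomain, Finsupp.sum, Finsupp.degree_apply, Finsupp.single_finsetSum]

theorem specSeries_formalSpec (j : Fin N ⊕ Fin N) : specSeries (formalSpec K N j) =
    PowerSeries.map (MvPowerSeries.map (algebraMap K K⸨X⸩)) (specSeries (baseSpec K N j)) := by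
  ext1 n
  rw [PowerSeries.coeff_map, coeff_specSeries, coeff_specSeries, formalSpec_apply]

/-- The power sums of the formal specializations. -/
def basePower (K : Type*) [Field K] (N : ℕ) (j : Fin N ⊕ Fin N) (n : ℕ) :
    MvPowerSeries ((Fin N ⊕ Fin N) × ℕ) K :=
  baseSpec K N j (powerSumSeq K n)

variable {r : ℕ} (hr : r ≠ 0)

theorem map_powVar_incl {σ : Type*} (f : MvPowerSeries σ K) :
    MvPowerSeries.map (powVar K r hr) (incl f) = MvPowerSeries.map (algebraMap K K⸨X⸩) f := by
  ext1 e
  rw [MvPowerSeries.coeff_map, MvPowerSeries.coeff_map, incl, MvPowerSeries.coeff_map, powVar_C]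

theorem map_powVar_C_mul {σ : Type*} (c : PowerSeries K) (f : MvPowerSeries σ (PowerSeries K)) :
    MvPowerSeries.map (powVar K r hr) (MvPowerSeries.C c * f) =
      powVar K r hr c • MvPowerSeries.map (powVar K r hr) f := by
  ext1 e
  rw [MvPowerSeries.coeff_map, MvPowerSeries.coeff_C_mul, map_mul, MvPowerSeries.coeff_smul,
    MvPowerSeries.coeff_map]

theorem exponentTerm_formal [CharZero K] {n : ℕ} (hn : n ≠ 0) :
    exponentTerm (formalVar K ^ r) (formalA K N) (formalB K N) n =
      (n : K⸨X⸩)⁻¹ • MvPowerSeries.map (powVar K r hr)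
        (traceSums (fun k => basePower K N (Sum.inl k)) (fun k => basePower K N (Sum.inr k)) n) := by
  have : CharZero K⸨X⸩ := algebraRat.charZero _
  rw [exponentTerm_eq _ _ _ hn, traceSums, map_add, map_powVar_C_mul, map_powVar_incl,
    map_powVar_incl, map_mul (powVar K r hr), powVar_inv, map_sub, map_one, map_pow, powVar_X,
    ← div_eq_mul_inv]
  · simp only [map_sum, map_mul, formalA, formalB, formalSpec_apply, basePower, powerSumSeq, hn,
      if_false]
  · simp [hn]

/-- The exponent. -/
def formalExponent (K : Type*) [Field K] [CharZero K] (N : ℕ) :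
    MvPowerSeries ((Fin N ⊕ Fin N) × ℕ) (PowerSeries K) :=
  collect (weightA Prod.fst)
    (traceSums (fun k => basePower K N (Sum.inl k)) (fun k => basePower K N (Sum.inr k)))

theorem weightA_basePower {n : ℕ} {e : (Fin N ⊕ Fin N) × ℕ →₀ ℕ}
    (he : MvPowerSeries.coeff e (traceSums (fun k => basePower K N (Sum.inl k))
      (fun k => basePower K N (Sum.inr k)) n) ≠ 0) : weightA Prod.fst e = n :=
  weightA_eq_of_coeff_traceSums
    (fun k => IsHom.powerSum (isNewton_specSeries (baseSpec K N (Sum.inl k))) (isHom_baseSpec _))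
    (fun k => IsHom.powerSum (isNewton_specSeries (baseSpec K N (Sum.inr k))) (isHom_baseSpec _))
    n e he

/-- At each monomial the only index that can contribute is its degree in the `a`-variables, so the
sum is finite coefficientwise. -/
theorem hasSum_exponentTerm_formal [CharZero K] :
    HasSum (fun n : ℕ => exponentTerm (formalVar K ^ r) (formalA K N) (formalB K N) (n + 1))
      (MvPowerSeries.map (powVar K r hr) (formalExponent K N)) := by
  rw [MvPowerSeries.WithPiTopology.hasSum_iff_hasSum_coeff]
  intro e
  simp only [exponentTerm_formal hr (Nat.succ_ne_zero _), MvPowerSeries.coeff_smul,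
    MvPowerSeries.coeff_map]
  have h0 : ∀ n, weightA Prod.fst e ≠ n + 1 →
      ((n + 1 : ℕ) : K⸨X⸩)⁻¹ * powVar K r hr (MvPowerSeries.coeff e
        (traceSums (fun k => basePower K N (Sum.inl k))
          (fun k => basePower K N (Sum.inr k)) (n + 1))) = 0 := by
    intro n hn
    have : MvPowerSeries.coeff e (traceSums (fun k => basePower K N (Sum.inl k))
      (fun k => basePower K N (Sum.inr k)) (n + 1)) = 0 :=
      by_contra fun h => hn (weightA_basePower h)
    rw [this, map_zero, mul_zero]
  rw [formalExponent, coeff_collect]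
  rcases Nat.eq_zero_or_pos (weightA Prod.fst e) with h | h
  · rw [h, Nat.cast_zero, inv_zero, zero_smul, map_zero]
    convert hasSum_zero using 2 with n
    exact h0 n (by omega)
  · obtain ⟨w, hw⟩ := Nat.exists_eq_succ_of_ne_zero h.ne'
    have h1 : powVar K r hr (((weightA Prod.fst e : ℕ) : ℚ)⁻¹ • MvPowerSeries.coeff e
        (traceSums (fun k => basePower K N (Sum.inl k)) (fun k => basePower K N (Sum.inr k))
          (weightA Prod.fst e))) =
        ((w + 1 : ℕ) : K⸨X⸩)⁻¹ * powVar K r hr (MvPowerSeries.coeff e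
        (traceSums (fun k => basePower K N (Sum.inl k))
          (fun k => basePower K N (Sum.inr k)) (w + 1))) := by
      have : CharZero K⸨X⸩ := algebraRat.charZero _
      rw [hw, eq_inv_mul_iff_mul_eq₀ (by exact_mod_cast Nat.succ_ne_zero w),
        ← map_natCast (powVar K r hr), ← map_mul, ← nsmul_eq_mul, ← Nat.cast_smul_eq_nsmul ℚ,
        smul_inv_smul₀ (by exact_mod_cast Nat.succ_ne_zero w)]
    rw [h1]
    exact hasSum_single w fun n hn => h0 n (by omega)

theorem constantCoeff_formalExponent [CharZero K] :
    MvPowerSeries.constantCoeff (MvPowerSeries.map (powVar K r hr) (formalExponent K N)) = 0 := by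
  rw [← MvPowerSeries.coeff_zero_eq_constantCoeff_apply, MvPowerSeries.coeff_map,
    MvPowerSeries.coeff_zero_eq_constantCoeff_apply, formalExponent, constantCoeff_collect, map_zero]

/-- At each monomial the exponential is a finite sum of powers, which a ring homomorphism respects;
the rational coefficients are preserved since ring homomorphisms out of `ℚ` are unique. -/
theorem formalExp_map [CharZero K] : formalExp (MvPowerSeries.map (powVar K r hr) (formalExponent K N)) =
    MvPowerSeries.map (powVar K r hr) ((PowerSeries.exp ℚ).subst (formalExponent K N)) := by
  have hs : PowerSeries.HasSubst (formalExponent K N) :=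
    PowerSeries.HasSubst.of_constantCoeff_zero (constantCoeff_collect _ _)
  ext1 e
  rw [formalExp, PowerSeries.coeff_subst
    (PowerSeries.HasSubst.of_constantCoeff_zero (constantCoeff_formalExponent hr)),
    MvPowerSeries.coeff_map, PowerSeries.coeff_subst hs]
  have := AddMonoidHom.map_finsum (powVar K r hr).toAddMonoidHom
    (PowerSeries.coeff_subst_finite hs (PowerSeries.exp ℚ) e)
  refine Eq.trans (finsum_congr fun j => ?_) this.symm
  rw [PowerSeries.coeff_exp, PowerSeries.coeff_exp, ← map_pow, MvPowerSeries.coeff_map]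
  change _ = powVar K r hr _
  have h1 := RingHom.congr_fun (Subsingleton.elim ((algebraMap K K⸨X⸩).comp (algebraMap ℚ K))
    ((powVar K r hr).comp (algebraMap ℚ (PowerSeries K)))) (1 / (j.factorial : ℚ))
  rw [Algebra.smul_def, Algebra.smul_def (A := PowerSeries K), map_mul]
  exact congrArg₂ _ h1 rfl

theorem hasSum_weight_formal [CharZero K] [NeZero N] :
    HasSum (weight (formalVar K ^ r) (formalA K N) (formalB K N))
      (powVar K r hr (partitionSeries K) •
        formalExp (MvPowerSeries.map (powVar K r hr) (formalExponent K N))) := by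
  classical
  rw [MvPowerSeries.WithPiTopology.hasSum_iff_hasSum_coeff]
  intro e
  set c : PartSeq N → K := fun x => MvPowerSeries.coeff e
    (skewProd (fun k => specSeries (baseSpec K N (Sum.inl k)))
      (fun k => specSeries (baseSpec K N (Sum.inr k))) x) with hc
  have h1 : ∀ x, MvPowerSeries.coeff e (weight (formalVar K ^ r) (formalA K N) (formalB K N) x) =
      powVar K r hr (PowerSeries.X ^ (x.1 (0 - 1)).card * PowerSeries.C (c x)) := by
    intro x
    rw [weight_eq, MvPowerSeries.coeff_smul, map_mul, map_pow, powVar_X, powVar_C]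
    simp only [formalA, formalB, specSeries_formalSpec]
    rw [← map_skewProd, MvPowerSeries.coeff_map]
  simp only [h1]
  rw [formalExp_map, MvPowerSeries.coeff_smul, MvPowerSeries.coeff_map, ← map_mul, HasSum]
  simp only [← map_sum]
  refine tendsto_powVar r hr fun m => ?_
  rw [SummationFilter.unconditional_filter]
  -- The first two summands are required by the trace formula. Together with the degree in the
  -- `b`-variables they bound all families contributing to `e` with `|λ^{(0)}| = m`.
  set M := m + weightA Prod.fst e + ∑ k, e.mapDomain Prod.fst (Sum.inr k) with hM
  filter_upwards [eventually_ge_atTop (sequencesLE N M)] with s hs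
  have h3 : _ = PowerSeries.coeff m (partitionSeries K * MvPowerSeries.coeff e
      ((PowerSeries.exp ℚ).subst (formalExponent K N))) :=
    sum_coeff_skewProd (g := Prod.fst) (M := M)
      (fun k => isNewton_specSeries (baseSpec K N (Sum.inl k)))
      (fun k => isNewton_specSeries (baseSpec K N (Sum.inr k)))
      (fun k n => isHom_baseSpec _ n) (fun k n => isHom_baseSpec _ n) e (by omega)
  rw [← h3, map_sum, Finset.sum_filter]
  have h2 : ∀ x, PowerSeries.coeff m (PowerSeries.X ^ (x.1 (0 - 1)).card * PowerSeries.C (c x)) =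
      if (x.1 (0 - 1)).card = m then c x else 0 := by
    intro x
    rw [PowerSeries.coeff_X_pow_mul', PowerSeries.coeff_C]
    split_ifs <;> first | rfl | omega
  simp only [h2]
  refine (Finset.sum_subset hs fun x _ hx => ?_).symm
  rw [ite_eq_right_iff]
  intro hm
  by_contra hne
  have h3 := mem_sequencesLE_of_coeff_ne_zero (g := Prod.fst)
    (fun k n => isHom_baseSpec _ n) (fun k n => isHom_baseSpec _ n) hne
  refine hx (mem_sequencesLE.mpr ?_)
  rw [mem_sequencesLE, hm] at h3
  exact ⟨fun k => (h3.1 k).trans (by omega), fun k => (h3.2 k).trans (by omega)⟩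

theorem formalVar_pow_ne_one {r : ℕ} (hr : r ≠ 0) {n : ℕ} (hn : n ≠ 0) : 1 - (formalVar K ^ r) ^ n ≠ 0 := by
  rw [← powVar_X r hr, ← map_pow, ← map_one (powVar K r hr), ← map_sub]
  intro h
  have h1 := congrArg (fun f => HahnSeries.coeff f ((0 : ℕ) : ℤ)) h
  simp only [coeff_powVar] at h1
  simp [hn] at h1

end FormalIdentity

/-! ### Absolutely convergent evaluation of series. -/

section Evaluation

open Finset.HasAntidiagonal (antidiagonal mem_antidiagonal)

/-- Exponents of the marks and powers of `X` are treated as one index monoid, so that the Cauchy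
product theorem for absolutely convergent families applies to products of series. -/
instance prodHasAntidiagonal {A B : Type*} [AddMonoid A] [AddMonoid B] [Finset.HasAntidiagonal A]
    [Finset.HasAntidiagonal B] : Finset.HasAntidiagonal (A × B) where
  antidiagonal p := (antidiagonal p.1 ×ˢ antidiagonal p.2).map
    ⟨fun q => ((q.1.1, q.2.1), (q.1.2, q.2.2)), fun q q' h => by
      simp only [Prod.mk.injEq] at h
      ext <;> simp [h]⟩
  mem_antidiagonal := by
    rintro ⟨a, b⟩ ⟨⟨a1, b1⟩, ⟨a2, b2⟩⟩
    simp only [Finset.mem_map, Finset.mem_product, mem_antidiagonal, Prod.mk.injEq, Prod.exists,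
      Prod.mk_add_mk]
    constructor
    · rintro ⟨c1, c2, d1, d2, ⟨h1, h2⟩, h⟩
      have h' : ((c1, d1), (c2, d2)) = ((a1, b1), (a2, b2)) := h
      simp only [Prod.mk.injEq] at h'
      obtain ⟨⟨rfl, rfl⟩, rfl, rfl⟩ := h'
      exact ⟨h1, h2⟩
    · rintro ⟨h1, h2⟩
      exact ⟨a1, a2, b1, b2, ⟨h1, h2⟩, rfl⟩

theorem sum_antidiagonal_prod {A B M : Type*} [AddMonoid A] [AddMonoid B]
    [Finset.HasAntidiagonal A] [Finset.HasAntidiagonal B] [AddCommMonoid M] (p : A × B)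
    (f : (A × B) × (A × B) → M) : ∑ q ∈ antidiagonal p, f q =
      ∑ q ∈ antidiagonal p.1, ∑ q' ∈ antidiagonal p.2, f ((q.1, q'.1), (q.2, q'.2)) := by
  rw [← Finset.sum_product']
  exact Finset.sum_map _ _ _

variable {σ 𝕜 : Type*} [NormedField 𝕜]

/-- The monomials of a series, evaluated at `1` in all variables and at `t` in `X`. -/
def evTerm (t : 𝕜) (g : MvPowerSeries σ (PowerSeries 𝕜)) (p : (σ →₀ ℕ) × ℕ) : 𝕜 :=
  PowerSeries.coeff p.2 (MvPowerSeries.coeff p.1 g) * t ^ p.2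

/-- Absolute convergence of a series at `1` in all variables and at `t` in `X`. -/
def AbsEv (t : 𝕜) (g : MvPowerSeries σ (PowerSeries 𝕜)) (z : 𝕜) : Prop :=
  Summable (fun p => ‖evTerm t g p‖) ∧ HasSum (evTerm t g) z

theorem evTerm_mul [DecidableEq σ] (t : 𝕜) (g h : MvPowerSeries σ (PowerSeries 𝕜))
    (p : (σ →₀ ℕ) × ℕ) :
    evTerm t (g * h) p = ∑ q ∈ antidiagonal p, evTerm t g q.1 * evTerm t h q.2 := by
  rw [sum_antidiagonal_prod, evTerm, MvPowerSeries.coeff_mul, map_sum, Finset.sum_mul]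
  refine Finset.sum_congr rfl fun q _ => ?_
  rw [PowerSeries.coeff_mul, Finset.sum_mul]
  refine Finset.sum_congr rfl fun q' hq' => ?_
  rw [← mem_antidiagonal.mp hq', evTerm, evTerm, pow_add]
  ring

variable {t : 𝕜} {g h : MvPowerSeries σ (PowerSeries 𝕜)} {z z' : 𝕜}

theorem summable_sum_antidiagonal {Ω : Type*} [AddCommMonoid Ω] [Finset.HasAntidiagonal Ω]
    {u v : Ω → ℝ} (hu : Summable u) (hv : Summable v) (hu0 : 0 ≤ u) (hv0 : 0 ≤ v) :
    (Summable fun p => ∑ q ∈ antidiagonal p, u q.1 * v q.2) ∧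
      ∑' p, ∑ q ∈ antidiagonal p, u q.1 * v q.2 = (∑' p, u p) * ∑' p, v p := by
  have h := hu.mul_of_nonneg hv hu0 hv0
  exact ⟨summable_sum_mul_antidiagonal_of_summable_mul h,
    (hu.tsum_mul_tsum_eq_tsum_sum_antidiagonal hv h).symm⟩

theorem norm_evTerm_mul_le [DecidableEq σ] (t : 𝕜) (g h : MvPowerSeries σ (PowerSeries 𝕜))
    (p : (σ →₀ ℕ) × ℕ) :
    ‖evTerm t (g * h) p‖ ≤ ∑ q ∈ antidiagonal p, ‖evTerm t g q.1‖ * ‖evTerm t h q.2‖ := by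
  rw [evTerm_mul]
  exact (norm_sum_le _ _).trans (Finset.sum_le_sum fun q _ => (norm_mul _ _).le)

theorem AbsEv.summable_mul (hg : AbsEv t g z) (hh : AbsEv t h z') :
    Summable (fun p => ‖evTerm t (g * h) p‖) ∧
      ∑' p, ‖evTerm t (g * h) p‖ ≤ (∑' p, ‖evTerm t g p‖) * ∑' p, ‖evTerm t h p‖ := by
  classical
  have h1 := summable_sum_antidiagonal hg.1 hh.1 (fun _ => norm_nonneg _) fun _ => norm_nonneg _
  have h2 := Summable.of_nonneg_of_le (fun _ => norm_nonneg _) (norm_evTerm_mul_le t g h) h1.1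
  exact ⟨h2, (h2.tsum_le_tsum (norm_evTerm_mul_le t g h) h1.1).trans h1.2.le⟩

theorem AbsEv.add (hg : AbsEv t g z) (hh : AbsEv t h z') : AbsEv t (g + h) (z + z') := by
  have h1 : evTerm t (g + h) = fun p => evTerm t g p + evTerm t h p := by
    ext p
    simp [evTerm, add_mul]
  rw [AbsEv, h1]
  exact ⟨Summable.of_nonneg_of_le (fun _ => norm_nonneg _) (fun _ => norm_add_le _ _)
    (hg.1.add hh.1), hg.2.add hh.2⟩

theorem AbsEv.zero : AbsEv t (0 : MvPowerSeries σ (PowerSeries 𝕜)) 0 := by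
  have h1 : evTerm t (0 : MvPowerSeries σ (PowerSeries 𝕜)) = fun _ => 0 := by
    ext p
    simp [evTerm]
  rw [AbsEv, h1]
  exact ⟨by simp, hasSum_zero⟩

theorem AbsEv.sum {ι : Type*} {s : Finset ι} {g : ι → MvPowerSeries σ (PowerSeries 𝕜)} {z : ι → 𝕜}
    (hg : ∀ i ∈ s, AbsEv t (g i) (z i)) : AbsEv t (∑ i ∈ s, g i) (∑ i ∈ s, z i) := by
  classical
  induction s using Finset.induction_on with
  | empty => simpa using AbsEv.zero
  | insert i s hi ih =>
    rw [Finset.sum_insert hi, Finset.sum_insert hi]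
    exact (hg i (Finset.mem_insert_self _ _)).add
      (ih fun j hj => hg j (Finset.mem_insert_of_mem hj))

theorem AbsEv.of_C {f : PowerSeries 𝕜}
    (h : AbsEv t (MvPowerSeries.C f : MvPowerSeries σ (PowerSeries 𝕜)) z) :
    (Summable fun m => ‖PowerSeries.coeff m f * t ^ m‖) ∧
      HasSum (fun m => PowerSeries.coeff m f * t ^ m) z := by
  classical
  have hinj : Function.Injective fun m : ℕ => ((0 : σ →₀ ℕ), m) := fun m m' h =>
    congrArg Prod.snd h
  have hout : ∀ p ∉ Set.range fun m : ℕ => ((0 : σ →₀ ℕ), m),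
      evTerm t (MvPowerSeries.C f : MvPowerSeries σ (PowerSeries 𝕜)) p = 0 := by
    rintro ⟨d, m⟩ hp
    rw [evTerm, MvPowerSeries.coeff_C, if_neg, map_zero, zero_mul]
    rintro rfl
    exact hp ⟨m, rfl⟩
  have hcomp : ∀ m : ℕ, evTerm t (MvPowerSeries.C f : MvPowerSeries σ (PowerSeries 𝕜)) (0, m) =
      PowerSeries.coeff m f * t ^ m := by
    intro m
    rw [evTerm, MvPowerSeries.coeff_zero_C]
  constructor
  · have := (hinj.summable_iff (f := fun p => ‖evTerm t _ p‖) fun p hp => by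
      rw [hout p hp, norm_zero]).mpr h.1
    simpa only [Function.comp_def, hcomp] using this
  · have := (hinj.hasSum_iff hout).mpr h.2
    simpa only [Function.comp_def, hcomp] using this

variable [CompleteSpace 𝕜]

theorem AbsEv.mul (hg : AbsEv t g z) (hh : AbsEv t h z') : AbsEv t (g * h) (z * z') := by
  classical
  have h1 := (hg.summable_mul hh).1
  refine ⟨h1, ?_⟩
  have h2 := summable_mul_of_summable_norm hg.1 hh.1
  have h3 := hg.2.summable.tsum_mul_tsum_eq_tsum_sum_antidiagonal hh.2.summable h2
  rw [hg.2.tsum_eq, hh.2.tsum_eq] at h3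
  rw [h3]
  simp only [← evTerm_mul]
  exact h1.of_norm.hasSum

/-- The series with the terms `fₙ` at the distinct exponents `eₙ`. -/
theorem absEv_of_injective {ι : Type*} {e : ι → σ →₀ ℕ} (he : Function.Injective e)
    {f : ι → PowerSeries 𝕜} (hf : ∀ i, MvPowerSeries.coeff (e i) g = f i)
    (h0 : ∀ d ∉ Set.range e, MvPowerSeries.coeff d g = 0) {y : ι → 𝕜} {c : ι → ℝ}
    (hsum : ∀ i, Summable fun m => ‖PowerSeries.coeff m (f i) * t ^ m‖)
    (hc : ∀ i, ∑' m, ‖PowerSeries.coeff m (f i) * t ^ m‖ ≤ c i) (hcs : Summable c)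
    (hy : ∀ i, HasSum (fun m => PowerSeries.coeff m (f i) * t ^ m) (y i)) :
    Summable y ∧ AbsEv t g (∑' i, y i) := by
  set ψ : ι × ℕ → (σ →₀ ℕ) × ℕ := fun q => (e q.1, q.2) with hψ
  have hinj : Function.Injective ψ := by
    rintro ⟨i, m⟩ ⟨i', m'⟩ h
    simp only [hψ, Prod.mk.injEq] at h
    exact Prod.ext (he h.1) h.2
  have hout : ∀ p ∉ Set.range ψ, evTerm t g p = 0 := by
    rintro ⟨d, m⟩ hp
    rw [evTerm, h0 d, map_zero, zero_mul]
    rintro ⟨i, rfl⟩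
    exact hp ⟨(i, m), rfl⟩
  have hcomp : ∀ q : ι × ℕ, evTerm t g (ψ q) = PowerSeries.coeff q.2 (f q.1) * t ^ q.2 := by
    intro q
    rw [evTerm, hf]
  have hs : Summable fun q : ι × ℕ => ‖evTerm t g (ψ q)‖ := by
    simp only [hcomp]
    rw [summable_prod_of_nonneg fun _ => norm_nonneg _]
    exact ⟨hsum, Summable.of_nonneg_of_le (fun i => tsum_nonneg fun _ => norm_nonneg _) hc hcs⟩
  have hs' : Summable fun p => ‖evTerm t g p‖ := by
    refine (hinj.summable_iff fun p hp => ?_).mp hs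
    rw [hout p hp, norm_zero]
  have h1 : HasSum (fun q : ι × ℕ => evTerm t g (ψ q)) (∑' q : ι × ℕ, evTerm t g (ψ q)) :=
    hs.of_norm.hasSum
  have h2 := h1.prod_fiberwise (g := y) fun i => by
    simp only [hcomp]
    exact hy i
  refine ⟨h2.summable, hs', ?_⟩
  rw [h2.tsum_eq]
  exact (hinj.hasSum_iff hout).mp h1

theorem absEv_C {f : PowerSeries 𝕜} (hf : Summable fun m => ‖PowerSeries.coeff m f * t ^ m‖)
    (hz : HasSum (fun m => PowerSeries.coeff m f * t ^ m) z) :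
    AbsEv t (MvPowerSeries.C f : MvPowerSeries σ (PowerSeries 𝕜)) z := by
  classical
  have := (absEv_of_injective (g := (MvPowerSeries.C f : MvPowerSeries σ (PowerSeries 𝕜)))
    (e := fun _ : Unit => 0) (fun _ _ _ => rfl) (f := fun _ => f) (t := t) (y := fun _ => z)
    (c := fun _ => ∑' m, ‖PowerSeries.coeff m f * t ^ m‖) (fun _ => by simp) (fun d hd => ?_)
    (fun _ => hf) (fun _ => le_rfl) Summable.of_finite (fun _ => hz)).2
  · simpa using this
  · rw [MvPowerSeries.coeff_C, if_neg]
    rintro rfl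
    exact hd ⟨(), rfl⟩

theorem AbsEv.one : AbsEv t (1 : MvPowerSeries σ (PowerSeries 𝕜)) 1 := by
  have h : ∀ m, m ≠ 0 → PowerSeries.coeff m (1 : PowerSeries 𝕜) * t ^ m = 0 := by
    intro m hm
    rw [PowerSeries.coeff_one, if_neg hm, zero_mul]
  have h1 : HasSum (fun m => PowerSeries.coeff m (1 : PowerSeries 𝕜) * t ^ m) 1 := by
    simpa using hasSum_single 0 h
  rw [← map_one MvPowerSeries.C]
  refine absEv_C ?_ h1
  exact summable_of_ne_finset_zero (s := {0}) fun m hm => by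
    rw [h m (by simpa using hm), norm_zero]

theorem AbsEv.pow (hg : AbsEv t g z) (j : ℕ) : AbsEv t (g ^ j) (z ^ j) := by
  induction j with
  | zero => simpa using AbsEv.one
  | succ j ih =>
    rw [pow_succ, pow_succ]
    exact ih.mul hg

/-- The `ℓ¹` norm is submultiplicative; this provides the majorant for the exponential series. -/
theorem AbsEv.norm_pow (hg : AbsEv t g z) (j : ℕ) :
    ∑' p, ‖evTerm t (g ^ j) p‖ ≤ (∑' p, ‖evTerm t g p‖) ^ j := by
  induction j with
  | zero =>
    classical
    rw [pow_zero, pow_zero, tsum_eq_single (0, 0)]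
    · simp [evTerm]
    · rintro ⟨d, m⟩ hp
      rw [evTerm, MvPowerSeries.coeff_one]
      by_cases hd : d = 0
      · have hm : m ≠ 0 := by
          rintro rfl
          exact hp (by rw [hd])
        simp [hd, PowerSeries.coeff_one, hm]
      · simp [hd]
  | succ j ih =>
    rw [pow_succ, pow_succ]
    exact ((hg.pow j).summable_mul hg).2.trans
      (mul_le_mul_of_nonneg_right ih (tsum_nonneg fun _ => norm_nonneg _))

theorem AbsEv.prod {ι : Type*} {s : Finset ι} {g : ι → MvPowerSeries σ (PowerSeries 𝕜)} {z : ι → 𝕜}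
    (hg : ∀ i ∈ s, AbsEv t (g i) (z i)) : AbsEv t (∏ i ∈ s, g i) (∏ i ∈ s, z i) := by
  classical
  induction s using Finset.induction_on with
  | empty => simpa using AbsEv.one
  | insert i s hi ih =>
    rw [Finset.prod_insert hi, Finset.prod_insert hi]
    exact (hg i (Finset.mem_insert_self _ _)).mul
      (ih fun j hj => hg j (Finset.mem_insert_of_mem hj))

end Evaluation

/-! ### Evaluation of exponentials. -/

section EvaluationExp

variable {σ : Type*} {t z : ℂ} {g : MvPowerSeries σ (PowerSeries ℂ)}

theorem hasSum_of_prod_fiberwise {α β : Type*} {v : α × β → ℂ} {u : β → ℂ} {z : ℂ}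
    (hv : Summable fun q => ‖v q‖) (hz : HasSum v z)
    (hu : ∀ p, HasSum (fun j => v (j, p)) (u p)) : Summable (fun p => ‖u p‖) ∧ HasSum u z := by
  have hswap : Summable fun q : β × α => ‖v (q.2, q.1)‖ :=
    (Equiv.prodComm _ _).summable_iff.mpr hv
  have h := (summable_prod_of_nonneg fun _ => norm_nonneg _).mp hswap
  constructor
  · refine Summable.of_nonneg_of_le (fun _ => norm_nonneg _) (fun p => ?_) h.2
    rw [← (hu p).tsum_eq]
    exact norm_tsum_le_tsum_norm (h.1 p)
  · have h1 : HasSum (fun q : β × α => v (q.2, q.1)) z := (Equiv.prodComm _ _).hasSum_iff.mpr hz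
    exact h1.prod_fiberwise hu

/-- Sum the double family `(1/j!)` times the terms of `g^j`. Over `j` first, finitely many terms
give each coefficient of the exponential; over monomials first, the sums are `z^j/j!`. The norms are
dominated by the exponential series of the `ℓ¹` norm of `g`, so the order is immaterial. -/
theorem AbsEv.exp (hg : AbsEv t g z) (h0 : MvPowerSeries.constantCoeff g = 0) :
    AbsEv t ((PowerSeries.exp ℚ).subst g) (Complex.exp z) := by
  have hs : PowerSeries.HasSubst g := PowerSeries.HasSubst.of_constantCoeff_zero h0
  set v : ℕ × ((σ →₀ ℕ) × ℕ) → ℂ := fun q => ((q.1.factorial : ℂ))⁻¹ * evTerm t (g ^ q.1) q.2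
    with hv
  have hfib : ∀ p, HasSum (fun j => v (j, p)) (evTerm t ((PowerSeries.exp ℚ).subst g) p) := by
    intro p
    have h1 := AddMonoidHom.map_finsum (PowerSeries.coeff (R := ℂ) p.2).toAddMonoidHom
      (PowerSeries.coeff_subst_finite hs (PowerSeries.exp ℚ) p.1)
    have h2 : ∀ j, (PowerSeries.coeff (R := ℂ) p.2).toAddMonoidHom
        (PowerSeries.coeff j (PowerSeries.exp ℚ) • MvPowerSeries.coeff p.1 (g ^ j)) * t ^ p.2 =
        v (j, p) := by
      intro j
      rw [LinearMap.toAddMonoidHom_coe, PowerSeries.coeff_exp]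
      simp only [hv, evTerm, one_div, eq_ratCast, Rat.cast_id]
      rw [map_rat_smul, Algebra.smul_def, mul_assoc]
      simp
    have h3 : (Function.support fun j => (PowerSeries.coeff (R := ℂ) p.2).toAddMonoidHom
        (PowerSeries.coeff j (PowerSeries.exp ℚ) • MvPowerSeries.coeff p.1 (g ^ j))).Finite := by
      refine (PowerSeries.coeff_subst_finite hs (PowerSeries.exp ℚ) p.1).subset ?_
      intro j hj h
      exact hj (by
        simp only at h ⊢
        rw [h, map_zero])
    have h4 : HasSum (fun j => (PowerSeries.coeff (R := ℂ) p.2).toAddMonoidHom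
        (PowerSeries.coeff j (PowerSeries.exp ℚ) • MvPowerSeries.coeff p.1 (g ^ j)))
        (PowerSeries.coeff p.2 (MvPowerSeries.coeff p.1 ((PowerSeries.exp ℚ).subst g))) := by
      rw [PowerSeries.coeff_subst hs]
      have h6 := (summable_of_hasFiniteSupport (L := SummationFilter.unconditional ℕ) h3).hasSum
      rw [tsum_eq_finsum h3, ← h1] at h6
      exact h6
    have h5 := h4.mul_right (t ^ p.2)
    simp only [h2] at h5
    exact h5
  have hnorm : ∀ j, HasSum (fun p => ‖v (j, p)‖)
      ((j.factorial : ℝ)⁻¹ * ∑' p, ‖evTerm t (g ^ j) p‖) := by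
    intro j
    have := (hg.pow j).1.hasSum.mul_left ((j.factorial : ℝ)⁻¹)
    simpa [hv] using this
  have hsum : Summable fun q => ‖v q‖ := by
    rw [summable_prod_of_nonneg fun _ => norm_nonneg _]
    refine ⟨fun j => (hnorm j).summable, ?_⟩
    simp only [(hnorm _).tsum_eq]
    refine Summable.of_nonneg_of_le (fun j => by positivity) (fun j => ?_)
      (Real.summable_pow_div_factorial (∑' p, ‖evTerm t g p‖))
    rw [div_eq_inv_mul]
    exact mul_le_mul_of_nonneg_left (hg.norm_pow j) (by positivity)
  have hexp : HasSum v (Complex.exp z) := by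
    have h0 : HasSum v (∑' q, v q) := hsum.of_norm.hasSum
    have hj : ∀ j, HasSum (fun p => v (j, p)) ((j.factorial : ℂ)⁻¹ * z ^ j) := fun j =>
      HasSum.mul_left (j.factorial : ℂ)⁻¹ (hg.pow j).2
    have h1 := h0.prod_fiberwise hj
    have h2 := NormedSpace.expSeries_div_hasSum_exp z
    rw [← Complex.exp_eq_exp_ℂ] at h2
    simp only [div_eq_inv_mul] at h2
    rw [← h1.unique h2]
    exact h0
  exact hasSum_of_prod_fiberwise hsum hexp hfib

end EvaluationExp

/-! ### Numerical convergence of Euler's product. -/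

section PartitionSum

open PowerSeries
open Finset.HasAntidiagonal (antidiagonal mem_antidiagonal)

/-- The series `1 / (1 - X ^ k)` with natural coefficients. -/
def multiples (k : ℕ) : ℕ⟦X⟧ := PowerSeries.mk fun m => if k ∣ m then 1 else 0

theorem map_multiples (K : Type*) [Field K] {k : ℕ} (hk : k ≠ 0) :
    PowerSeries.map (Nat.castRingHom K) (multiples k) = (1 - (X : K⟦X⟧) ^ k)⁻¹ := by
  symm
  rw [PowerSeries.inv_eq_iff_mul_eq_one (by simp [hk])]
  ext m
  rw [mul_sub, mul_one, map_sub, coeff_mul_X_pow', coeff_map, coeff_map, multiples, coeff_mk,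
    coeff_mk, coeff_one]
  rcases Nat.eq_zero_or_pos m with rfl | hm
  · simp [hk]
  · rw [if_neg hm.ne']
    by_cases hkm : k ≤ m
    · rw [if_pos hkm]
      have : k ∣ m - k ↔ k ∣ m := by
        constructor
        · intro h
          have := dvd_add h (dvd_refl k)
          rwa [Nat.sub_add_cancel hkm] at this
        · exact fun h => Nat.dvd_sub h (dvd_refl k)
      simp [this]
    · rw [if_neg hkm, sub_zero, if_neg fun h => hkm (Nat.le_of_dvd hm h), map_zero]

/-- The generating function of the partitions with parts in `s`, shifted by one. -/
def partialSeries (s : Finset ℕ) : ℕ⟦X⟧ := ∏ n ∈ s, multiples (n + 1)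

theorem coeff_prod_inv (K : Type*) [Field K] (s : Finset ℕ) (m : ℕ) :
    coeff m (∏ n ∈ s, (1 - (X : K⟦X⟧) ^ (n + 1))⁻¹) = ((coeff m (partialSeries s) : ℕ) : K) := by
  rw [← Finset.prod_congr rfl fun n _ => map_multiples K (Nat.succ_ne_zero n), ← map_prod,
    coeff_map]
  rfl

/-- Additional factors have natural coefficients and constant term `1`. This positivity makes the
partition numbers upper bounds for all partial products, which gives domination later. -/
theorem coeff_partialSeries_mono {s s' : Finset ℕ} (h : s ⊆ s') (m : ℕ) :
    coeff m (partialSeries s) ≤ coeff m (partialSeries s') := by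
  classical
  rw [partialSeries, partialSeries, ← Finset.prod_sdiff h, mul_comm, coeff_mul]
  have h0 : coeff 0 (∏ n ∈ s' \ s, multiples (n + 1)) = 1 := by
    rw [coeff_zero_eq_constantCoeff_apply, map_prod]
    refine Finset.prod_eq_one fun n _ => ?_
    rw [← coeff_zero_eq_constantCoeff_apply, multiples, coeff_mk]
    simp
  have := Finset.single_le_sum (f := fun p : ℕ × ℕ => coeff p.1 (∏ n ∈ s, multiples (n + 1)) *
    coeff p.2 (∏ n ∈ s' \ s, multiples (n + 1))) (fun _ _ => Nat.zero_le _)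
    (show (m, 0) ∈ antidiagonal m by rw [mem_antidiagonal, add_zero])
  simpa [h0] using this

theorem eventually_coeff_partialSeries (m : ℕ) : ∀ᶠ s : Finset ℕ in Filter.atTop,
    coeff m (partialSeries s) = (partitionsOf m).card := by
  filter_upwards [eventually_coeff_prod_eq ℚ m] with s hs
  rw [coeff_prod_inv, partitionSeries, coeff_mk] at hs
  exact_mod_cast hs

theorem coeff_partialSeries_le (s : Finset ℕ) (m : ℕ) :
    coeff m (partialSeries s) ≤ (partitionsOf m).card := by
  obtain ⟨s', h1, h2⟩ := ((eventually_coeff_partialSeries m).and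
    (Filter.eventually_ge_atTop s)).exists
  exact h1 ▸ coeff_partialSeries_mono h2 m

variable {𝕜 : Type*} [NormedField 𝕜] {t : 𝕜}

theorem hasSum_inv_one_sub_pow (ht : ‖t‖ < 1) {k : ℕ} (hk : k ≠ 0) :
    (Summable fun m => ‖coeff m ((1 - (X : 𝕜⟦X⟧) ^ k)⁻¹) * t ^ m‖) ∧
      HasSum (fun m => coeff m ((1 - (X : 𝕜⟦X⟧) ^ k)⁻¹) * t ^ m) (1 - t ^ k)⁻¹ := by
  have hc : ∀ m, coeff m ((1 - (X : 𝕜⟦X⟧) ^ k)⁻¹) * t ^ m = if k ∣ m then t ^ m else 0 := by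
    intro m
    rw [← map_multiples 𝕜 hk, coeff_map, multiples, coeff_mk]
    split_ifs <;> simp
  simp only [hc]
  constructor
  · refine Summable.of_nonneg_of_le (fun _ => norm_nonneg _) (fun m => ?_)
      (summable_geometric_of_lt_one (norm_nonneg t) ht)
    split_ifs
    · rw [norm_pow]
    · rw [norm_zero]
      positivity
  · have hinj : Function.Injective fun j : ℕ => k * j := fun j j' h =>
      Nat.eq_of_mul_eq_mul_left (Nat.pos_of_ne_zero hk) h
    rw [← hinj.hasSum_iff]
    · have h1 := hasSum_geometric_of_norm_lt_one (ξ := t ^ k) (by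
        rw [norm_pow]
        exact pow_lt_one₀ (norm_nonneg _) ht hk)
      convert h1 using 1
      ext j
      rw [Function.comp_apply, if_pos (dvd_mul_right k j), pow_mul]
    · intro m hm
      rw [if_neg]
      rintro ⟨j, rfl⟩
      exact hm ⟨j, rfl⟩

theorem hasSum_coeff_prod_inv [CompleteSpace 𝕜] (ht : ‖t‖ < 1) (s : Finset ℕ) :
    HasSum (fun m => ((coeff m (partialSeries s) : ℕ) : 𝕜) * t ^ m) (∏ n ∈ s, (1 - t ^ (n + 1))⁻¹) := by
  have h1 : AbsEv t (MvPowerSeries.C (∏ n ∈ s, (1 - (X : 𝕜⟦X⟧) ^ (n + 1))⁻¹) :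
      MvPowerSeries Empty (PowerSeries 𝕜)) (∏ n ∈ s, (1 - t ^ (n + 1))⁻¹) := by
    rw [map_prod]
    refine AbsEv.prod fun n _ => ?_
    have h := hasSum_inv_one_sub_pow ht (Nat.succ_ne_zero n)
    exact absEv_C h.1 h.2
  have h2 := h1.of_C.2
  simpa only [coeff_prod_inv] using h2

/-- On finitely many indices the partition numbers are coefficients of a partial product, so the
partial sums are at most `∏ 1/(1 - rⁿ)`. Each factor is at most `exp(rⁿ/(1 - r))`, which bounds all
these products uniformly. -/
theorem summable_card_partitionsOf {r : ℝ} (h0 : 0 ≤ r) (h1 : r < 1) :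
    Summable fun m => ((partitionsOf m).card : ℝ) * r ^ m := by
  have hr : ‖r‖ < 1 := by rwa [Real.norm_of_nonneg h0]
  have hgeo : Summable fun n : ℕ => r ^ (n + 1) / (1 - r) :=
    ((summable_geometric_of_lt_one h0 h1).comp_injective (add_left_injective 1)).div_const _
  refine summable_of_sum_le (c := Real.exp (∑' n : ℕ, r ^ (n + 1) / (1 - r)))
    (fun m => by positivity) fun T => ?_
  obtain ⟨s, hs⟩ := ((Finset.eventually_all T).mpr fun m _ =>
    eventually_coeff_partialSeries m).exists
  have h2 := hasSum_coeff_prod_inv hr s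
  calc ∑ m ∈ T, ((partitionsOf m).card : ℝ) * r ^ m
      = ∑ m ∈ T, ((coeff m (partialSeries s) : ℕ) : ℝ) * r ^ m :=
        Finset.sum_congr rfl fun m hm => by rw [hs m hm]
    _ ≤ ∏ n ∈ s, (1 - r ^ (n + 1))⁻¹ := sum_le_hasSum T (fun m _ => by positivity) h2
    _ ≤ ∏ n ∈ s, Real.exp (r ^ (n + 1) / (1 - r)) := by
        have hx1 : ∀ n : ℕ, r ^ (n + 1) ≤ r := fun n => by
          rw [pow_succ]
          exact mul_le_of_le_one_left h0 (pow_le_one₀ h0 h1.le)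
        refine Finset.prod_le_prod (fun n _ => ?_) fun n _ => ?_
        · have := hx1 n
          exact inv_nonneg.mpr (by linarith)
        · have hx := hx1 n
          have hx0 : 0 ≤ r ^ (n + 1) := by positivity
          refine le_trans ?_ (Real.add_one_le_exp _)
          have h3 : r ^ (n + 1) / (1 - r ^ (n + 1)) ≤ r ^ (n + 1) / (1 - r) :=
            div_le_div_of_nonneg_left hx0 (by linarith) (by linarith)
          have h4 : (1 - r ^ (n + 1))⁻¹ = r ^ (n + 1) / (1 - r ^ (n + 1)) + 1 := by
            have : 1 - r ^ (n + 1) ≠ 0 := by linarith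
            field_simp
            ring
          linarith
    _ = Real.exp (∑ n ∈ s, r ^ (n + 1) / (1 - r)) := (Real.exp_sum _ _).symm
    _ ≤ _ := Real.exp_le_exp.mpr (hgeo.sum_le_tsum s fun n _ => by
        have : 0 < 1 - r := by linarith
        positivity)

theorem multipliable_inv_one_sub_pow [CompleteSpace 𝕜] (ht : ‖t‖ < 1) :
    Multipliable fun n : ℕ => (1 - t ^ (n + 1))⁻¹ := by
  have hn : ∀ n : ℕ, ‖t ^ (n + 1)‖ ≤ ‖t‖ := fun n => by
    rw [norm_pow, pow_succ]
    exact mul_le_of_le_one_left (norm_nonneg _) (pow_le_one₀ (norm_nonneg _) ht.le)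
  have hne : ∀ n : ℕ, 1 - ‖t‖ ≤ ‖1 - t ^ (n + 1)‖ := fun n => by
    have h1 := norm_sub_norm_le (1 : 𝕜) (t ^ (n + 1))
    rw [norm_one] at h1
    have := hn n
    linarith
  have h0 : 0 < 1 - ‖t‖ := by linarith
  have h1 : ∀ n : ℕ, (1 - t ^ (n + 1))⁻¹ = 1 + t ^ (n + 1) / (1 - t ^ (n + 1)) := by
    intro n
    have : 1 - t ^ (n + 1) ≠ 0 := norm_pos_iff.mp (h0.trans_le (hne n))
    field_simp
    ring
  simp only [h1]
  refine multipliable_one_add_of_summable (Summable.of_nonneg_of_le (fun _ => norm_nonneg _)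
    (fun n => ?_) (((summable_geometric_of_lt_one (norm_nonneg t) ht).comp_injective
      (add_left_injective 1)).div_const (1 - ‖t‖)))
  rw [norm_div, norm_pow]
  exact div_le_div_of_nonneg_left (by positivity) h0 (hne n)

/-- Dominated convergence: the coefficients of the partial products are eventually the partition
numbers and never exceed them. -/
theorem hasSum_partitions {t : ℂ} (ht : ‖t‖ < 1) :
    (Summable fun m => ‖coeff m (partitionSeries ℂ) * t ^ m‖) ∧
    HasSum (fun m => coeff m (partitionSeries ℂ) * t ^ m) (∏' n : ℕ, (1 - t ^ (n + 1))⁻¹) := by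
  have hs := summable_card_partitionsOf (norm_nonneg t) ht
  have hs' : Summable fun m => ‖coeff m (partitionSeries ℂ) * t ^ m‖ := by
    simpa [partitionSeries] using hs
  refine ⟨hs', ?_⟩
  have h1 : Filter.Tendsto (fun s : Finset ℕ => ∑' m, ((coeff m (partialSeries s) : ℕ) : ℂ) * t ^ m)
      Filter.atTop (nhds (∑' m, coeff m (partitionSeries ℂ) * t ^ m)) := by
    refine tendsto_tsum_of_dominated_convergence hs (fun m => ?_)
      (Filter.Eventually.of_forall fun s m => ?_)
    · refine tendsto_const_nhds.congr' ?_
      filter_upwards [eventually_coeff_partialSeries m] with s h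
      rw [h, partitionSeries, coeff_mk]
    · rw [norm_mul, norm_pow, Complex.norm_natCast]
      exact mul_le_mul_of_nonneg_right (by exact_mod_cast coeff_partialSeries_le s m)
        (by positivity)
  simp only [(hasSum_coeff_prod_inv ht _).tsum_eq] at h1
  have h2 := (multipliable_inv_one_sub_pow ht).hasProd
  rw [HasProd, SummationFilter.unconditional_filter] at h2
  rw [tendsto_nhds_unique h2 h1]
  exact hs'.of_norm.hasSum

end PartitionSum

/-! ### One formal variable per specialization, recording degrees. -/

section Marking

open Finset.HasAntidiagonal (antidiagonal mem_antidiagonal)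

variable {σ A : Type*} [CommRing A]

/-- The series `H(x z)` in `z`, where `x` is the variable with index `j`. -/
def mark (j : σ) (H : PowerSeries A) : PowerSeries (MvPowerSeries σ A) :=
  PowerSeries.mk fun n => MvPowerSeries.monomial (Finsupp.single j n) (PowerSeries.coeff n H)

theorem isNewton_mark (j : σ) {q : ℕ → A} {H : PowerSeries A} (h : IsNewton q H) :
    IsNewton (fun n => MvPowerSeries.monomial (Finsupp.single j n) (q n)) (mark j H) := by
  rw [isNewton_iff] at h ⊢
  refine ⟨?_, fun n => ?_⟩
  · rw [← PowerSeries.coeff_zero_eq_constantCoeff_apply, mark, PowerSeries.coeff_mk,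
      PowerSeries.coeff_zero_eq_constantCoeff_apply, h.1, Finsupp.single_zero]
    rfl
  · have h1 : ∀ p ∈ antidiagonal n,
        MvPowerSeries.monomial (Finsupp.single j p.1) (q p.1) *
          PowerSeries.coeff p.2 (mark j H) =
        MvPowerSeries.monomial (Finsupp.single j n) (q p.1 * PowerSeries.coeff p.2 H) := by
      intro p hp
      rw [mark, PowerSeries.coeff_mk, MvPowerSeries.monomial_mul_monomial, ← Finsupp.single_add,
        mem_antidiagonal.mp hp]
    rw [Finset.sum_congr rfl h1, ← map_sum, ← h.2 n, mark, PowerSeries.coeff_mk,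
      ← nsmul_eq_mul, ← nsmul_eq_mul, map_nsmul]

theorem isHom_monomial (e : σ →₀ ℕ) (r : A) : IsHom id e (MvPowerSeries.monomial e r) := by
  classical
  intro d hd
  rw [MvPowerSeries.coeff_monomial] at hd
  rw [Finsupp.mapDomain_id]
  by_contra h
  exact hd (if_neg h)

theorem isHom_mark (j : σ) (H : PowerSeries A) (n : ℕ) :
    IsHom id (Finsupp.single j n) (PowerSeries.coeff n (mark j H)) := by
  rw [mark, PowerSeries.coeff_mk]
  exact isHom_monomial _ _

/-- By homogeneity the marked weight is a single monomial, so its coefficient is the value with all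
marks equal to `1`. Setting variables to `1` is not defined on power series, hence the detour
through polynomials. -/
theorem coeff_skewProd_mark {N : ℕ} [NeZero N] (Ha Hb : Fin N → PowerSeries A) (x : PartSeq N)
    (e : Fin N ⊕ Fin N →₀ ℕ) [Decidable (e = expo (sizes x))] :
    MvPowerSeries.coeff e (skewProd (fun k => mark (Sum.inl k) (Ha k))
      (fun k => mark (Sum.inr k) (Hb k)) x) =
    if e = expo (sizes x) then skewProd Ha Hb x else 0 := by
  set markP : Fin N ⊕ Fin N → PowerSeries A → PowerSeries (MvPolynomial (Fin N ⊕ Fin N) A) :=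
    fun j H => PowerSeries.mk fun n =>
      MvPolynomial.monomial (Finsupp.single j n) (PowerSeries.coeff n H) with hmarkP
  have h1 : ∀ j H, PowerSeries.map MvPolynomial.coeToMvPowerSeries.ringHom (markP j H) =
      mark j H := by
    intro j H
    ext1 n
    rw [PowerSeries.coeff_map, hmarkP, mark, PowerSeries.coeff_mk, PowerSeries.coeff_mk]
    exact MvPolynomial.coe_monomial _ _
  have h2 : ∀ j H, PowerSeries.map (MvPolynomial.eval fun _ => 1) (markP j H) = H := by
    intro j H
    ext1 n
    rw [PowerSeries.coeff_map, hmarkP, PowerSeries.coeff_mk, MvPolynomial.eval_monomial]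
    simp
  set P := skewProd (fun k => markP (Sum.inl k) (Ha k)) (fun k => markP (Sum.inr k) (Hb k)) x
    with hP
  have h3 := map_skewProd MvPolynomial.coeToMvPowerSeries.ringHom
    (fun k => markP (Sum.inl k) (Ha k)) (fun k => markP (Sum.inr k) (Hb k)) x
  have h4 := map_skewProd (MvPolynomial.eval fun _ => 1)
    (fun k => markP (Sum.inl k) (Ha k)) (fun k => markP (Sum.inr k) (Hb k)) x
  simp only [h1, h2] at h3 h4
  rw [← hP] at h3 h4
  have h5 : ∀ d, MvPolynomial.coeff d P ≠ 0 → d = expo (sizes x) := by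
    intro d hd
    have := IsHom.skewProd (g := id) (fun k n => isHom_mark (Sum.inl k) (Ha k) n)
      (fun k n => isHom_mark (Sum.inr k) (Hb k) n) x d
    rw [Finsupp.mapDomain_id, ← h3] at this
    exact this hd
  have h6 : MvPowerSeries.coeff e (MvPolynomial.coeToMvPowerSeries.ringHom P) =
    MvPolynomial.coeff e P := rfl
  rw [← h3, h6]
  split_ifs with h
  · rw [← h4, MvPolynomial.eval_eq, Finset.sum_eq_single e]
    · simp
    · intro d hd hde
      exact absurd ((h5 d (MvPolynomial.mem_support_iff.mp hd)).trans h.symm) hde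
    · intro hd
      rw [MvPolynomial.notMem_support_iff.mp hd, zero_mul]
  · by_contra hne
    exact h (h5 e hne)

end Marking

/-! ### Absolute convergence of the exponent. -/

section NumericalExponent

variable {t : ℂ}

theorem one_sub_pow_ne_zero (ht : ‖t‖ < 1) {n : ℕ} (hn : n ≠ 0) : 1 - t ^ n ≠ 0 := by
  intro h
  have h1 : ‖t ^ n‖ < 1 := by
    rw [norm_pow]
    exact pow_lt_one₀ (norm_nonneg _) ht hn
  rw [← sub_eq_zero.mp h, norm_one] at h1
  exact lt_irrefl _ h1

/-- The factor of a product of power sums in the exponent. -/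
def factorSeries (δ : ℂ) (n : ℕ) : PowerSeries ℂ :=
  PowerSeries.C δ + PowerSeries.X ^ n * (1 - PowerSeries.X ^ n)⁻¹

theorem coeff_factorSeries (δ : ℂ) {n : ℕ} (hn : n ≠ 0) (m : ℕ) :
    PowerSeries.coeff m (factorSeries δ n) =
      (if m = 0 then δ - 1 else 0) + PowerSeries.coeff m ((1 - PowerSeries.X ^ n)⁻¹) := by
  have h : (PowerSeries.X ^ n * (1 - PowerSeries.X ^ n)⁻¹ : PowerSeries ℂ) =
      (1 - PowerSeries.X ^ n)⁻¹ - 1 := by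
    have := PowerSeries.mul_inv_cancel (1 - PowerSeries.X ^ n : PowerSeries ℂ) (by simp [hn])
    linear_combination -this
  rw [factorSeries, h, map_add, map_sub, PowerSeries.coeff_C, PowerSeries.coeff_one]
  split_ifs <;> ring

theorem norm_coeff_factorSeries_le {δ : ℂ} (hδ : δ = 0 ∨ δ = 1) {n : ℕ} (hn : n ≠ 0) (m : ℕ) :
    ‖PowerSeries.coeff m (factorSeries δ n)‖ ≤ 1 := by
  rw [coeff_factorSeries δ hn, ← map_multiples ℂ hn, PowerSeries.coeff_map, multiples,
    PowerSeries.coeff_mk]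
  rcases eq_or_ne m 0 with rfl | hm
  · rcases hδ with rfl | rfl <;> simp
  · rw [if_neg hm]
    split_ifs <;> simp

theorem hasSum_factorSeries (ht : ‖t‖ < 1) (δ : ℂ) {n : ℕ} (hn : n ≠ 0) :
    HasSum (fun m => PowerSeries.coeff m (factorSeries δ n) * t ^ m) (δ + t ^ n / (1 - t ^ n)) := by
  have h1 := (hasSum_inv_one_sub_pow ht hn).2
  have h2 : HasSum (fun m : ℕ => (if m = 0 then δ - 1 else 0) * t ^ m) (δ - 1) := by
    convert hasSum_ite_eq 0 (δ - 1) using 2 with m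
    split_ifs with h <;> simp [h]
  have h3 : δ + t ^ n / (1 - t ^ n) = δ - 1 + (1 - t ^ n)⁻¹ := by
    have := one_sub_pow_ne_zero ht hn
    field_simp
    ring
  rw [h3]
  convert h2.add h1 using 2 with m
  rw [coeff_factorSeries δ hn, add_mul]

variable {N : ℕ}

/-- The power sums of a marked series. -/
def markPower (j : Fin N ⊕ Fin N) (q : ℕ → ℂ) (n : ℕ) : MvPowerSeries (Fin N ⊕ Fin N) ℂ :=
  MvPowerSeries.monomial (Finsupp.single j n) (q n)

/-- The exponents of a product of two power sums. -/
def pairExp (k l : Fin N) (n : ℕ) : Fin N ⊕ Fin N →₀ ℕ :=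
  Finsupp.single (Sum.inl k) n + Finsupp.single (Sum.inr l) n

theorem weightA_pairExp (k l : Fin N) (n : ℕ) : weightA id (pairExp k l n) = n := by
  classical
  change ∑ i, (pairExp k l n).mapDomain id (Sum.inl i) = n
  rw [Finsupp.mapDomain_id]
  simp [pairExp, Finsupp.single_apply]

theorem traceSums_markPower (α β : Fin N → ℕ → ℂ) (n : ℕ) :
    traceSums (fun k => markPower (Sum.inl k) (α k)) (fun l => markPower (Sum.inr l) (β l)) n =
    ∑ k, ∑ l, MvPowerSeries.monomial (pairExp k l n)
      (factorSeries (if l < k then 1 else 0) n * PowerSeries.C (α k n * β l n)) := by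
  have h : ∀ k l, MvPowerSeries.monomial (pairExp k l n)
      (factorSeries (if l < k then 1 else 0) n * PowerSeries.C (α k n * β l n)) =
      (if l < k then incl (markPower (Sum.inl k) (α k) n * markPower (Sum.inr l) (β l) n) else 0) +
      MvPowerSeries.C (PowerSeries.X ^ n * (1 - PowerSeries.X ^ n)⁻¹) *
        incl (markPower (Sum.inl k) (α k) n * markPower (Sum.inr l) (β l) n) := by
    intro k l
    have h1 : incl (markPower (Sum.inl k) (α k) n * markPower (Sum.inr l) (β l) n) =
        MvPowerSeries.monomial (pairExp k l n) (PowerSeries.C (α k n * β l n)) := by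
      rw [markPower, markPower, MvPowerSeries.monomial_mul_monomial, incl,
        MvPowerSeries.map_monomial]
      rfl
    rw [h1, ← MvPowerSeries.monomial_zero_eq_C_apply, MvPowerSeries.monomial_mul_monomial, zero_add,
      factorSeries, add_mul, map_add]
    congr 1
    split_ifs
    · rw [map_one, one_mul]
    · rw [map_zero, zero_mul, map_zero]
  rw [traceSums, Finset.sum_mul_sum]
  simp only [h, Finset.sum_add_distrib, map_sum, Finset.sum_filter, Finset.mul_sum,
    apply_ite (incl (σ := Fin N ⊕ Fin N) (K := ℂ)), map_zero]

/-- For `n > 0` the coefficients of `δ + Xⁿ/(1 - Xⁿ)` are `0` or `1`, so `|cₙ| |t|^m` is a summable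
majorant. Different `n` occupy different monomials. The condition `c 0 = 0` removes the degenerate
factor at `n = 0`. -/
theorem absEv_pair (ht : ‖t‖ < 1) (k l : Fin N) {δ : ℂ} (hδ : δ = 0 ∨ δ = 1) {c : ℕ → ℂ}
    (hc0 : c 0 = 0) (hc : Summable fun n => ‖c n‖) {g : MvPowerSeries (Fin N ⊕ Fin N) (PowerSeries ℂ)}
    (hg : ∀ e, MvPowerSeries.coeff e g = if e = pairExp k l (weightA id e) then
      factorSeries δ (weightA id e) * PowerSeries.C (c (weightA id e)) else 0) :
    Summable (fun n => c n * (δ + t ^ n / (1 - t ^ n))) ∧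
      AbsEv t g (∑' n, c n * (δ + t ^ n / (1 - t ^ n))) := by
  have hcoeff : ∀ n m, PowerSeries.coeff m (factorSeries δ n * PowerSeries.C (c n)) * t ^ m =
      c n * (PowerSeries.coeff m (factorSeries δ n) * t ^ m) := by
    intro n m
    rw [PowerSeries.coeff_mul_C]
    ring
  have hgeo := summable_geometric_of_lt_one (norm_nonneg t) ht
  have hle : ∀ n m, ‖c n * (PowerSeries.coeff m (factorSeries δ n) * t ^ m)‖ ≤
      ‖c n‖ * ‖t‖ ^ m := by
    intro n m
    rcases eq_or_ne n 0 with rfl | hn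
    · simp [hc0]
    · rw [norm_mul, norm_mul, norm_pow]
      refine mul_le_mul_of_nonneg_left ?_ (norm_nonneg _)
      exact mul_le_of_le_one_left (by positivity) (norm_coeff_factorSeries_le hδ hn m)
  have hs : ∀ n, Summable fun m => ‖c n * (PowerSeries.coeff m (factorSeries δ n) * t ^ m)‖ :=
    fun n => Summable.of_nonneg_of_le (fun _ => norm_nonneg _) (hle n) (hgeo.mul_left _)
  refine absEv_of_injective (e := pairExp k l) (c := fun n => ‖c n‖ * (1 - ‖t‖)⁻¹)
    (f := fun n => factorSeries δ n * PowerSeries.C (c n)) ?_ ?_ ?_ ?_ ?_ (hc.mul_right _) ?_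
  · intro n n' h
    rw [← weightA_pairExp k l n, h, weightA_pairExp]
  · intro n
    rw [hg, weightA_pairExp, if_pos rfl]
  · intro d hd
    rw [hg, if_neg]
    intro h
    exact hd ⟨_, h.symm⟩
  · intro n
    simp only [hcoeff]
    exact hs n
  · intro n
    simp only [hcoeff]
    rw [← tsum_geometric_of_lt_one (norm_nonneg t) ht, ← tsum_mul_left]
    exact (hs n).tsum_le_tsum (hle n) (hgeo.mul_left _)
  · intro n
    simp only [hcoeff]
    rcases eq_or_ne n 0 with rfl | hn
    · simp [hc0, hasSum_zero]
    · exact (hasSum_factorSeries ht δ hn).mul_left _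

theorem absEv_collect_traceSums (ht : ‖t‖ < 1) {α β : Fin N → ℕ → ℂ}
    (h : ∀ k l, Summable fun n : ℕ => ‖(n : ℂ)⁻¹ * (α k n * β l n)‖) :
    (∀ k l, Summable fun n : ℕ => (n : ℂ)⁻¹ * (α k n * β l n) *
      ((if l < k then 1 else 0) + t ^ n / (1 - t ^ n))) ∧
    AbsEv t (collect (weightA id) (traceSums (fun k => markPower (Sum.inl k) (α k))
      (fun l => markPower (Sum.inr l) (β l))))
      (∑ k, ∑ l, ∑' n : ℕ, (n : ℂ)⁻¹ * (α k n * β l n) *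
        ((if l < k then 1 else 0) + t ^ n / (1 - t ^ n))) := by
  classical
  have h1 : collect (weightA id) (traceSums (fun k => markPower (Sum.inl k) (α k))
      (fun l => markPower (Sum.inr l) (β l))) =
      ∑ k, ∑ l, collect (weightA id) fun n => MvPowerSeries.monomial (pairExp k l n)
        (factorSeries (if l < k then 1 else 0) n * PowerSeries.C (α k n * β l n)) := by
    ext1 e
    simp only [coeff_collect, map_sum, traceSums_markPower, Finset.smul_sum]
  have h2 : ∀ k l : Fin N, _ := fun k l => absEv_pair ht k l
    (δ := if l < k then 1 else 0) (c := fun n : ℕ => (n : ℂ)⁻¹ * (α k n * β l n))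
    (g := collect (weightA id) fun n => MvPowerSeries.monomial (pairExp k l n)
        (factorSeries (if l < k then 1 else 0) n * PowerSeries.C (α k n * β l n)))
    (by split_ifs <;> simp) (by simp) (h k l) (fun e => by
      rw [coeff_collect, MvPowerSeries.coeff_monomial, smul_ite, smul_zero]
      congr 1
      rw [map_mul PowerSeries.C (_⁻¹), mul_left_comm, Algebra.smul_def]
      congr 1
      have h3 : algebraMap ℚ ℂ ((weightA id e : ℕ) : ℚ)⁻¹ = ((weightA id e : ℕ) : ℂ)⁻¹ := by simp
      rw [IsScalarTower.algebraMap_apply ℚ ℂ (PowerSeries ℂ), h3]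
      rfl)
  refine ⟨fun k l => (h2 k l).1, ?_⟩
  rw [h1]
  exact AbsEv.sum fun k _ => AbsEv.sum fun l _ => (h2 k l).2

end NumericalExponent

/-! ### From sums over sizes to sums over all families. -/

section Fiberwise

theorem hasSum_of_hasSum_fiberwise {X D : Type*} {w : X → ℂ} {f : X → D} {u : D → Finset X}
    (hu : ∀ d x, x ∈ u d ↔ f x = d) {Z : ℂ} (h : HasSum (fun d => ∑ x ∈ u d, w x) Z)
    (hw : Summable w) : HasSum w Z := by
  have h1 := hw.hasSum.tsum_fiberwise f
  have h2 : ∀ d, ∑' x : f ⁻¹' {d}, w x = ∑ x ∈ u d, w x := by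
    intro d
    rw [← Finset.tsum_subtype]
    have h3 : f ⁻¹' {d} = {x | x ∈ u d} := by
      ext x
      simp [hu]
    rw [h3]
    rfl
  simp only [h2] at h1
  rw [← h1.unique h]
  exact hw.hasSum

/-- A finite set of families is contained in finitely many complete fibres, so its sum is bounded by
the real part of the total. -/
theorem summable_of_nonneg_fiberwise {X D : Type*} {w : X → ℂ} {f : X → D} {u : D → Finset X}
    (hu : ∀ d x, x ∈ u d ↔ f x = d) {Z : ℂ} (h : HasSum (fun d => ∑ x ∈ u d, w x) Z)
    (hw : ∀ x, 0 ≤ (w x).re ∧ (w x).im = 0) : Summable w := by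
  classical
  have h1 := Complex.hasSum_re h
  simp only [Complex.re_sum] at h1
  have h2 : Summable fun x => (w x).re := by
    refine summable_of_sum_le (c := Z.re) (fun x => (hw x).1) fun s => ?_
    refine le_trans ?_ (sum_le_hasSum (s.image f)
      (fun d _ => Finset.sum_nonneg fun x _ => (hw x).1) h1)
    rw [← Finset.sum_fiberwise_of_maps_to fun x hx => Finset.mem_image_of_mem f hx]
    refine Finset.sum_le_sum fun d _ => Finset.sum_le_sum_of_subset_of_nonneg (fun x hx => ?_)
      fun x _ _ => (hw x).1
    exact (hu d x).mpr (Finset.mem_filter.mp hx).2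
  refine (Complex.ofRealCLM.summable h2).congr fun x => ?_
  exact Complex.ext rfl (hw x).2.symm

end Fiberwise

/-! ### The numerical identity. -/

section NumericalIdentity

variable {t : ℂ} {N : ℕ} {a b : Fin N → (SymmFun ℂ →ₐ[ℂ] ℂ)}

/-- The terms agree since `n (p/n)(q/n) = pq/n`; the added term at `n = 0` is zero. -/
theorem summable_powerSumSeq
    (h : ∀ k l : Fin N, Summable fun n : ℕ =>
      ‖((n + 1 : ℕ) : ℂ) * scaledPower (a k) (n + 1) * scaledPower (b l) (n + 1)‖) (k l : Fin N) :
    Summable fun n : ℕ => ‖(n : ℂ)⁻¹ * (a k (powerSumSeq ℂ n) * b l (powerSumSeq ℂ n))‖ := by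
  rw [← summable_nat_add_iff 1]
  refine (h k l).congr fun n => ?_
  congr 1
  have hn : ((n + 1 : ℕ) : ℂ) ≠ 0 := by exact_mod_cast Nat.succ_ne_zero n
  rw [scaledPower, scaledPower, powerSumSeq_succ, smul_eq_mul, smul_eq_mul]
  field_simp

theorem hasSum_exponentTerm {α β : Fin N → ℕ → ℂ} (hα : ∀ k n, α k n = a k (powerSumSeq ℂ n))
    (hβ : ∀ k n, β k n = b k (powerSumSeq ℂ n))
    (h : ∀ k l, Summable fun n : ℕ => (n : ℂ)⁻¹ * (α k n * β l n) *
      ((if l < k then 1 else 0) + t ^ n / (1 - t ^ n))) :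
    HasSum (fun n : ℕ => exponentTerm t a b (n + 1)) (∑ k, ∑ l, ∑' n : ℕ, (n : ℂ)⁻¹ *
      (α k n * β l n) * ((if l < k then 1 else 0) + t ^ n / (1 - t ^ n))) := by
  have h1 : ∀ n : ℕ, exponentTerm t a b (n + 1) = ∑ k, ∑ l, ((n + 1 : ℕ) : ℂ)⁻¹ *
      (α k (n + 1) * β l (n + 1)) * ((if l < k then 1 else 0) +
        t ^ (n + 1) / (1 - t ^ (n + 1))) := by
    intro n
    rw [exponentTerm_eq t a b (n := n + 1) (Nat.succ_ne_zero n), Finset.sum_mul_sum]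
    simp only [hα, hβ, powerSumSeq_succ, smul_eq_mul, Finset.mul_sum, mul_add,
      Finset.sum_add_distrib, Finset.sum_filter, mul_ite, mul_one, mul_zero]
    congr 1
    refine Finset.sum_congr rfl fun k _ => Finset.sum_congr rfl fun l _ => ?_
    ring
  simp only [h1]
  refine hasSum_sum fun k _ => hasSum_sum fun l _ => ?_
  have h2 := (hasSum_nat_add_iff 1 (g := ∑' n : ℕ, (n : ℂ)⁻¹ *
      (α k n * β l n) * ((if l < k then 1 else 0) + t ^ n / (1 - t ^ n)))
    (f := fun n : ℕ => (n : ℂ)⁻¹ *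
      (α k n * β l n) * ((if l < k then 1 else 0) + t ^ n / (1 - t ^ n)))).mpr
  refine h2 ?_
  simpa using (h k l).hasSum

theorem mem_sequencesOfSize {d : (Fin N → ℕ) × (Fin N → ℕ)} {x : PartSeq N} :
    x ∈ sequencesOfSize d ↔ sizes x = d := by
  simp only [sequencesOfSize, Finset.mem_product, Fintype.mem_piFinset, mem_partitionsOf, sizes,
    Prod.ext_iff, funext_iff]

variable [NeZero N]

theorem weight_eq_zero {x : PartSeq N} (h : ¬ Interlaced (sizes x)) : weight t a b x = 0 := by
  rw [weight_eq, skewProd_eq_zero h, smul_zero]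

/-- The generating function of the weights, with marked degrees. -/
def markedSeries (a b : Fin N → (SymmFun ℂ →ₐ[ℂ] ℂ)) :
    MvPowerSeries (Fin N ⊕ Fin N) (PowerSeries ℂ) :=
  MvPowerSeries.C (partitionSeries ℂ) * (PowerSeries.exp ℚ).subst (collect (weightA id)
    (traceSums (fun k => markPower (Sum.inl k) fun n => a k (powerSumSeq ℂ n))
      (fun l => markPower (Sum.inr l) fun n => b l (powerSumSeq ℂ n))))

theorem evTerm_markedSeries (e : Fin N ⊕ Fin N →₀ ℕ) {m M : ℕ} (hM : m + weightA id e ≤ M) :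
    evTerm t (markedSeries a b) (e, m) = ∑ x ∈ sequencesLE N M,
      if e = expo (sizes x) ∧ (x.1 (0 - 1)).card = m then weight t a b x else 0 := by
  classical
  have h1 := sum_coeff_skewProd (g := id) (M := M)
    (fun k => isNewton_mark (Sum.inl k) (isNewton_specSeries (a k)))
    (fun k => isNewton_mark (Sum.inr k) (isNewton_specSeries (b k)))
    (fun k n => isHom_mark _ _ n) (fun k n => isHom_mark _ _ n) e hM
  have h2 : PowerSeries.coeff m (MvPowerSeries.coeff e (markedSeries a b)) = _ :=
    (congrArg (PowerSeries.coeff m) (MvPowerSeries.coeff_C_mul _ _ _)).trans h1.symm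
  rw [evTerm, h2, Finset.sum_mul, Finset.sum_filter]
  refine Finset.sum_congr rfl fun x _ => ?_
  rw [coeff_skewProd_mark]
  by_cases h3 : (x.1 (0 - 1)).card = m
  · by_cases h4 : e = expo (sizes x)
    · rw [if_pos h3, if_pos h4, if_pos ⟨h4, h3⟩, weight_eq, h3, smul_eq_mul, mul_comm]
    · rw [if_pos h3, if_neg h4, if_neg fun h => h4 h.1, zero_mul]
  · rw [if_neg h3, if_neg fun h => h3 h.2]

/-- The monomial given by the degrees and `|λ^{(0)}|` determines interlaced sizes, and sizes that do
not interlace carry weight zero. The sum over monomials is therefore the sum over sizes reindexed.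
-/
theorem hasSum_sequencesOfSize_of_absEv {Z : ℂ} (h : AbsEv t (markedSeries a b) Z) :
    HasSum (fun d : (Fin N → ℕ) × (Fin N → ℕ) => ∑ x ∈ sequencesOfSize d, weight t a b x) Z := by
  classical
  set ι : {d : (Fin N → ℕ) × (Fin N → ℕ) | Interlaced d} → (Fin N ⊕ Fin N →₀ ℕ) × ℕ :=
    fun d => (expo d.1, d.1.1 (0 - 1)) with hι
  have hinj : Function.Injective ι := by
    rintro ⟨d, hd⟩ ⟨d', hd'⟩ h
    have h' := Prod.ext_iff.mp h
    exact Subtype.ext (Interlaced.eq hd hd' h'.1 h'.2)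
  have h0 : ∀ p ∉ Set.range ι, evTerm t (markedSeries a b) p = 0 := by
    rintro ⟨e, m⟩ hp
    rw [evTerm_markedSeries e le_rfl]
    refine Finset.sum_eq_zero fun x _ => ?_
    split_ifs with h1
    · refine weight_eq_zero fun hI => hp ⟨⟨sizes x, hI⟩, ?_⟩
      exact Prod.ext h1.1.symm h1.2
    · rfl
  have h1 : evTerm t (markedSeries a b) ∘ ι =
      (fun d : (Fin N → ℕ) × (Fin N → ℕ) => ∑ x ∈ sequencesOfSize d, weight t a b x) ∘ (↑) := by
    ext1 ⟨d, hd⟩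
    set M := d.1 (0 - 1) + weightA id (expo d) + (∑ k, d.1 k + ∑ k, d.2 k) with hM
    change evTerm t (markedSeries a b) (expo d, d.1 (0 - 1)) = ∑ x ∈ sequencesOfSize d, weight t a b x
    rw [evTerm_markedSeries (M := M) _ (Nat.le_add_right _ _)]
    symm
    have hx : ∀ x ∈ sequencesOfSize d, weight t a b x =
        if expo d = expo (sizes x) ∧ (x.1 (0 - 1)).card = d.1 (0 - 1) then weight t a b x
        else 0 := by
      intro x hx
      rw [mem_sequencesOfSize] at hx
      rw [if_pos]
      rw [← hx]
      exact ⟨rfl, rfl⟩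
    rw [Finset.sum_congr rfl hx]
    refine Finset.sum_subset (fun x hx => ?_) fun x _ hx => ?_
    · rw [mem_sequencesOfSize] at hx
      rw [mem_sequencesLE]
      have h1 : ∀ k, d.1 k ≤ ∑ k, d.1 k := fun k =>
        Finset.single_le_sum (fun _ _ => Nat.zero_le _) (Finset.mem_univ k)
      have h2 : ∀ k, d.2 k ≤ ∑ k, d.2 k := fun k =>
        Finset.single_le_sum (fun _ _ => Nat.zero_le _) (Finset.mem_univ k)
      constructor
      · intro k
        have h3 : (x.1 k).card = d.1 k := congrFun (congrArg Prod.fst hx) k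
        have := h1 k
        omega
      · intro k
        have h3 : (x.2 k).card = d.2 k := congrFun (congrArg Prod.snd hx) k
        have := h2 k
        omega
    · split_ifs with h2
      · refine weight_eq_zero fun hI => hx (mem_sequencesOfSize.mpr ?_)
        exact (Interlaced.eq hd hI h2.1 h2.2.symm).symm
      · rfl
  have h2 := (hinj.hasSum_iff h0).mpr h.2
  rw [h1] at h2
  refine (hasSum_subtype_iff_of_support_subset fun d hd => ?_).mp h2
  by_contra hI
  refine hd (Finset.sum_eq_zero fun x hx => weight_eq_zero ?_)
  rwa [mem_sequencesOfSize.mp hx]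

theorem hasSum_sequencesOfSize (ht : ‖t‖ < 1)
    (h : ∀ k l : Fin N, Summable fun n : ℕ =>
      ‖((n + 1 : ℕ) : ℂ) * scaledPower (a k) (n + 1) * scaledPower (b l) (n + 1)‖) :
    Summable (fun n : ℕ => exponentTerm t a b (n + 1)) ∧
    HasSum (fun d : (Fin N → ℕ) × (Fin N → ℕ) => ∑ x ∈ sequencesOfSize d, weight t a b x)
      ((∏' n : ℕ, (1 - t ^ (n + 1))⁻¹) * Complex.exp (∑' n : ℕ, exponentTerm t a b (n + 1))) := by
  have h1 := absEv_collect_traceSums ht (summable_powerSumSeq h)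
  have h2 := hasSum_exponentTerm (fun _ _ => rfl) (fun _ _ => rfl) h1.1
  refine ⟨h2.summable, hasSum_sequencesOfSize_of_absEv ?_⟩
  rw [h2.tsum_eq]
  have h3 := hasSum_partitions ht
  exact (absEv_C h3.1 h3.2).mul (h1.2.exp (constantCoeff_collect _ _))

end NumericalIdentity

end PeriodicSchur

end

/-! ### The formal and numerical statements combined. -/

open PeriodicSchur in
theorem proposition1p1 (N : ℕ) [NeZero N] (K : Type*) [Field K] [CharZero K] :
    -- the identity of formal series, in `t` and in `s` with `t = s ^ N`
    ((∀ t : K⸨X⸩, t = formalVar K →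
      Multipliable (fun n : ℕ => (1 - t ^ (n + 1))⁻¹) ∧
      Summable (fun n : ℕ => exponentTerm t (formalA K N) (formalB K N) (n + 1)) ∧
      MvPowerSeries.constantCoeff
        (∑' n : ℕ, exponentTerm t (formalA K N) (formalB K N) (n + 1)) = 0 ∧
      HasSum (weight t (formalA K N) (formalB K N))
        ((∏' n : ℕ, (1 - t ^ (n + 1))⁻¹) •
          formalExp (∑' n : ℕ, exponentTerm t (formalA K N) (formalB K N) (n + 1)))) ∧
     (∀ s t : K⸨X⸩, s = formalVar K → t = s ^ N →
      Multipliable (fun n : ℕ => (1 - s ^ ((n + 1) * N))⁻¹) ∧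
      Summable (fun n : ℕ => symExponentTerm s (formalA K N) (formalB K N) (n + 1)) ∧
      MvPowerSeries.constantCoeff
        (∑' n : ℕ, symExponentTerm s (formalA K N) (formalB K N) (n + 1)) = 0 ∧
      HasSum (weight t (formalA K N) (formalB K N))
        ((∏' n : ℕ, (1 - s ^ ((n + 1) * N))⁻¹) •
          formalExp (∑' n : ℕ, symExponentTerm s (formalA K N) (formalB K N) (n + 1))))) ∧
    -- the numerical identity
    (∀ (t : ℂ) (a b : Fin N → (SymmFun ℂ →ₐ[ℂ] ℂ)), ‖t‖ < 1 →
      (∀ k l : Fin N, Summable fun n : ℕ =>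
        ‖((n + 1 : ℕ) : ℂ) * scaledPower (a k) (n + 1) * scaledPower (b l) (n + 1)‖) →
      ∃ Z : ℂ,
        -- `Z` is the sum of all the weights, taken according to the sizes of the partitions
        HasSum (fun d : (Fin N → ℕ) × (Fin N → ℕ) => ∑ x ∈ sequencesOfSize d, weight t a b x) Z ∧
        -- and in any order, if the weights are absolutely summable or non-negative
        ((Summable fun x : PartSeq N => ‖weight t a b x‖) → HasSum (weight t a b) Z) ∧
        ((∀ x : PartSeq N, 0 ≤ (weight t a b x).re ∧ (weight t a b x).im = 0) →
          HasSum (weight t a b) Z) ∧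
        (Multipliable (fun n : ℕ => (1 - t ^ (n + 1))⁻¹) ∧
          Summable (fun n : ℕ => exponentTerm t a b (n + 1)) ∧
          Z = (∏' n : ℕ, (1 - t ^ (n + 1))⁻¹) *
            Complex.exp (∑' n : ℕ, exponentTerm t a b (n + 1))) ∧
        (∀ s : ℂ, s ≠ 0 → s ^ N = t →
          Multipliable (fun n : ℕ => (1 - s ^ ((n + 1) * N))⁻¹) ∧
          Summable (fun n : ℕ => symExponentTerm s a b (n + 1)) ∧
          Z = (∏' n : ℕ, (1 - s ^ ((n + 1) * N))⁻¹) *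
            Complex.exp (∑' n : ℕ, symExponentTerm s a b (n + 1)))) := by
  have : CharZero K⸨X⸩ := algebraRat.charZero _
  have hN : N ≠ 0 := NeZero.ne N
  have hv : formalVar K ≠ 0 := HahnSeries.single_ne_zero one_ne_zero
  refine ⟨⟨?_, ?_⟩, ?_⟩
  · intro t ht
    -- Both formal statements are instances of one identity in `formalVar K ^ r`, with `r = 1` here
    -- and `r = N` for the second.
    obtain rfl : t = formalVar K ^ 1 := by rw [ht, pow_one]
    have h1 := hasProd_powVar (K := K) 1 one_ne_zero
    have h2 := hasSum_exponentTerm_formal (K := K) (N := N) one_ne_zero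
    rw [h1.tprod_eq, h2.tsum_eq]
    exact ⟨h1.multipliable, h2.summable, constantCoeff_formalExponent one_ne_zero,
      hasSum_weight_formal one_ne_zero⟩
  · rintro s t rfl rfl
    have h1 := hasProd_powVar (K := K) N hN
    have h2 := hasSum_exponentTerm_formal (K := K) (N := N) hN
    have h3 : ∀ n : ℕ, symExponentTerm (formalVar K) (formalA K N) (formalB K N) (n + 1) =
        exponentTerm (formalVar K ^ N) (formalA K N) (formalB K N) (n + 1) := fun n =>
      symExponentTerm_eq hv _ _ (formalVar_pow_ne_one hN (Nat.succ_ne_zero n))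
    simp only [h3, mul_comm _ N, pow_mul]
    rw [h1.tprod_eq, h2.tsum_eq]
    exact ⟨h1.multipliable, h2.summable, constantCoeff_formalExponent hN, hasSum_weight_formal hN⟩
  · intro t a b ht h
    have h1 := hasSum_sequencesOfSize ht h
    refine ⟨_, h1.2, fun hw => ?_, fun hw => ?_, ⟨multipliable_inv_one_sub_pow ht, h1.1, rfl⟩,
      fun s hs hst => ?_⟩
    -- The families of given sizes are the fibres of `sizes`, and they are finite.
    · exact hasSum_of_hasSum_fiberwise (fun _ _ => mem_sequencesOfSize) h1.2 hw.of_norm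
    · exact hasSum_of_hasSum_fiberwise (fun _ _ => mem_sequencesOfSize) h1.2
        (summable_of_nonneg_fiberwise (fun _ _ => mem_sequencesOfSize) h1.2 hw)
    · subst hst
      have h3 : ∀ n : ℕ, symExponentTerm s a b (n + 1) = exponentTerm (s ^ N) a b (n + 1) :=
        fun n => symExponentTerm_eq hs _ _ (one_sub_pow_ne_zero ht (Nat.succ_ne_zero n))
      simp only [h3, mul_comm _ N, pow_mul]
      exact ⟨multipliable_inv_one_sub_pow ht, h1.1, trivial⟩
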